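/- Let $\mathbb D=\{z\in\mathbb C:|z|<1\}$ and let $\alpha\in(1,2]$. Let $Co(\alpha)$ be the class of all functions $f:\mathbb D\to\mathbb C$ such that (i) $f$ is analytic in $\mathbb D$, $f(0)=0$, $f'(0)=1$, and $f(1)=\infty$, i.e. $f(z)\to\infty$ as $z\to1$ in $\mathbb D$; (ii) $f$ maps $\mathbb D$ conformally (injectively) onto a set whose complement in $\mathbb C$ is convex; (iii) the opening angle of $f(\mathbb D)$ at $\infty$, i.e. $\limsup_{R\to\infty}\left|\{t\in(-\pi,\pi]: Re^{it}\in f(\mathbb D)\}\right|$, where $|\cdot|$ is Lebesgue measure, is at most $\pi\alpha$. For $f\in Co(\alpha)$ put $T_f=f''/f'$. Then for every $z\in\mathbb D$, $$\{(1-|z|^2)\,T_f(z): f\in Co(\alpha)\}$$ is exactly the closed disk with center $$2\overline z+(\alpha+1)\frac{1-\overline z}{1-z}$$ and radius $\alpha-1$. Moreover, for a function $f:\mathbb D\to\mathbb C$, the following are equivalent: (a) $f\in Co(\alpha)$ and $(1-|z|^2)T_f(z)$ lies on the boundary circle of this disk; (b) $f=g_\theta$ on $\mathbb D$ for some $\theta\in[0,2\pi]$,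 where $$g_\theta(z)=\frac{1}{\alpha(1+e^{i\theta})}\left[\left(\frac{1+e^{i\theta}z}{1-z}\right)^{\alpha}-1\right]\quad(\theta\in[0,2\pi]\setminus\{\pi\}),\qquad g_\pi(z)=\frac{z}{1-z},$$ with the principal branch of the power. -/

import Mathlib

open Complex Filter Topology Bornology

/-- The opening angle at `∞` of a plane set `Ω`: the asymptotic angular measure of the part of the
circle `|w| = R` which lies in `Ω`, as `R → ∞`.  (If the complement of `Ω` is convex, the upper
limit is a limit; a sector of opening `β ≤ 2π` has opening angle `β`, a half-plane has `π`, and the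
complement of a ray or of a half-strip has `2π`.) -/
noncomputable def openingAngleAtInfinity (Ω : Set ℂ) : ENNReal :=
  limsup (fun R : ℝ => MeasureTheory.volume
    {t : ℝ | t ∈ Set.Ioc (-Real.pi) Real.pi ∧ (R : ℂ) * exp ((t : ℂ) * I) ∈ Ω}) atTop

/-- `f` belongs to the class `Co(α)` of concave univalent functions on the open unit disk.
All conditions depend only on the values of `f` on the disk. -/
structure IsConcaveUnivalent (α : ℝ) (f : ℂ → ℂ) : Prop where
  /-- `f` is analytic in the unit disk. -/
  analytic : DifferentiableOn ℂ f (Metric.ball 0 1)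
  map_zero : f 0 = 0
  deriv_zero : deriv f 0 = 1
  /-- `f(1) = ∞`, that is, `f(z) → ∞` as `z → 1` inside the disk. -/
  map_one : Tendsto f (𝓝[Metric.ball 0 1] 1) (cobounded ℂ)
  /-- `f` is conformal, that is, injective (and analytic) in the disk. -/
  injective : Set.InjOn f (Metric.ball 0 1)
  /-- The complement of the image of the disk is convex. -/
  convex_compl : Convex ℝ (f '' Metric.ball 0 1)ᶜ
  /-- The opening angle at `∞` of the image of the disk is at most `πα`. -/
  opening_angle_le : openingAngleAtInfinity (f '' Metric.ball 0 1) ≤ ENNReal.ofReal (Real.pi * α)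

/-- The class `Co(α)`. -/
def Co (α : ℝ) : Set (ℂ → ℂ) := {f | IsConcaveUnivalent α f}

/-- The pre-Schwarzian derivative `T_f = f'' / f'`. -/
noncomputable def preSchwarzian (f : ℂ → ℂ) (z : ℂ) : ℂ :=
  deriv (deriv f) z / deriv f z

/-- The functional `f ↦ (1 - |z|²) T_f(z)`. -/
noncomputable def weightedPreSchwarzian (z : ℂ) (f : ℂ → ℂ) : ℂ :=
  (1 - (‖z‖ : ℂ) ^ 2) * preSchwarzian f z

/-- The centre `2 z̄ + (α + 1)(1 - z̄)/(1 - z)`. -/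
noncomputable def variabilityCenter (α : ℝ) (z : ℂ) : ℂ :=
  2 * starRingEnd ℂ z + ((α : ℂ) + 1) * (1 - starRingEnd ℂ z) / (1 - z)

open Classical in
/-- The functions `g_θ`.  For `θ ≠ π` and `|z| < 1` the quotient `(1 + e^{iθ} z)/(1 - z)` lies in an
open half-plane that contains `1` and whose boundary line passes through `0`, so it avoids
`(-∞, 0]`, and the principal power is the analytic branch that is `1` at `z = 0`. -/
noncomputable def extremalFun (α θ : ℝ) (z : ℂ) : ℂ :=
  if θ = Real.pi then z / (1 - z)
  else 1 / ((α : ℂ) * (1 + exp ((θ : ℂ) * I))) *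
    (((1 + exp ((θ : ℂ) * I) * z) / (1 - z)) ^ (α : ℂ) - 1)

/-! Everything is transported to the right half-plane by u = (1+z)/(1-z). With F the transported
function, N = F''/F' and x = Re u, the weighted pre-Schwarzian minus the centre is a unimodular
factor times 2xN(u) - (α-1). The disk of variability therefore says x|N|² ≤ (α-1) Re N, that is, N =
0 or Re((α-1)/N(u)) ≥ Re u. This is Julia's inequality at infinity, and it needs two inputs: Re N ≥
0, and x Re N(x) ≤ α-1+ε for arbitrarily large real x.

For Re N ≥ 0, let k be an omitted value. Since the complement is convex, the dilations w ↦ k +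
e^s(w-k), s ≥ 0, map the image into itself and pull back to a semigroup of self-maps of the disk. A
Wolff-type argument (`exists_horocycle_le`) gives a boundary point whose horocycles are respected,
and f(1) = ∞ forces this point to be 1. Hence the generator G_k = (F-k)/F' has nonnegative real part
(`re_sub_div_deriv_nonneg`). For fixed u, the function F'(u)/(F(u)-F(v)) - 1/(u-v) of v takes the
value N(u)/2 at v = u. As v tends to an imaginary b with F(v) → k, its real part tends to
Re(1/G_k(u)) - Re(1/(u-b)), which is nonnegative by a boundary Schwarz–Pick estimate
(`re_mul_norm_sq_le_of_boundary_limit`). At infinity both terms vanish, and the minimum principle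
concludes.

For the behaviour at infinity, the opening angle makes the recession cone of the complement large,
so the image lies in a sector of opening πα (`IsConcaveUnivalent.exists_sector`). An α-th root then
maps the half-plane to itself, which gives F'(x) = O(x^(α-1)) and with it the bound on x Re N(x).

If equality holds at one point, then either N vanishes identically, or (α-1)/N(u) - u has
nonnegative real part vanishing at a point and so is an imaginary constant r. Thus F is affine or an
affine function of (u+r)^α: these are the g_θ. Letting Re r ≥ 0 fills the disk. The powers belong to
the class because the power map takes half-planes to sets with convex complement
(`convex_compl_image_cpow`), a consequence of the log-concavity of the cosine. -/

/-! ### Univalent functions and their inverses. -/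

theorem isOpen_image_of_injOn {f : ℂ → ℂ} {U : Set ℂ} (hU : IsOpen U)
    (hf : DifferentiableOn ℂ f U) (hi : Set.InjOn f U) : IsOpen (f '' U) := by
  rw [isOpen_iff_mem_nhds]
  rintro _ ⟨z, hz, rfl⟩
  have ha : AnalyticAt ℂ f z := hf.analyticAt (hU.mem_nhds hz)
  rcases ha.eventually_constant_or_nhds_le_map_nhds with h | h
  · exfalso
    have h1 : ∀ᶠ w in 𝓝[≠] z, f w = f z ∧ w ∈ U ∧ w ≠ z := by
      filter_upwards [h.filter_mono nhdsWithin_le_nhds,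
        (hU.mem_nhds hz |> mem_nhdsWithin_of_mem_nhds), self_mem_nhdsWithin] with w h1 h2 h3
      exact ⟨h1, h2, h3⟩
    obtain ⟨w, h1, h2, h3⟩ := h1.exists
    exact h3 (hi h2 hz h1)
  · exact h (image_mem_map (hU.mem_nhds hz))

theorem exists_continuousOn_leftInverse {f : ℂ → ℂ} {U : Set ℂ} (hU : IsOpen U)
    (hf : DifferentiableOn ℂ f U) (hi : Set.InjOn f U) :
    ∃ g : ℂ → ℂ, ContinuousOn g (f '' U) ∧ ∀ z ∈ U, g (f z) = z := by
  refine ⟨Function.invFunOn f U, ?_, fun z hz => hi.leftInvOn_invFunOn hz⟩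
  rintro _ ⟨z, hz, rfl⟩
  refine ContinuousAt.continuousWithinAt ?_
  rw [ContinuousAt, hi.leftInvOn_invFunOn hz]
  intro V hV
  obtain ⟨W, hWV, hWo, hzW⟩ := mem_nhds_iff.1 (Filter.inter_mem hV (hU.mem_nhds hz))
  have hWU : W ⊆ U := fun w hw => (hWV hw).2
  have h1 := isOpen_image_of_injOn hWo (hf.mono hWU) (hi.mono hWU)
  refine mem_map.2 (mem_of_superset (h1.mem_nhds ⟨z, hzW, rfl⟩) ?_)
  rintro _ ⟨w, hw, rfl⟩
  show Function.invFunOn f U (f w) ∈ V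
  rw [hi.leftInvOn_invFunOn (hWU hw)]
  exact (hWV hw).1

/-- A univalent function has a holomorphic inverse. -/
theorem exists_differentiableOn_leftInverse {f : ℂ → ℂ} {U : Set ℂ} (hU : IsOpen U)
    (hf : DifferentiableOn ℂ f U) (hi : Set.InjOn f U) :
    ∃ g : ℂ → ℂ, DifferentiableOn ℂ g (f '' U) ∧ ∀ z ∈ U, g (f z) = z := by
  obtain ⟨g, hgc, hg⟩ := exists_continuousOn_leftInverse hU hf hi
  refine ⟨g, ?_, hg⟩
  have ho := isOpen_image_of_injOn hU hf hi
  -- Nonvanishing of the derivative is not available yet: it will follow from this lemma. Critical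
  -- points are isolated, so the continuous inverse has at most removable singularities at their
  -- images.
  have key : ∀ z ∈ U, deriv f z ≠ 0 → DifferentiableAt ℂ g (f z) := by
    intro z hz h0
    have hc : ContinuousAt g (f z) := hgc.continuousAt (ho.mem_nhds ⟨z, hz, rfl⟩)
    have hdz : HasDerivAt f (deriv f z) (g (f z)) := by
      rw [hg z hz]; exact (hf.differentiableAt (hU.mem_nhds hz)).hasDerivAt
    refine (hdz.of_local_left_inverse hc h0 ?_).differentiableAt
    filter_upwards [ho.mem_nhds ⟨z, hz, rfl⟩] with w hw
    obtain ⟨x, hx, rfl⟩ := hw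
    rw [hg x hx]
  rintro _ ⟨z, hz, rfl⟩
  refine DifferentiableAt.differentiableWithinAt ?_
  have ha : AnalyticAt ℂ (deriv f) z := (hf.analyticAt (hU.mem_nhds hz)).deriv
  have hne : ∀ᶠ w in 𝓝[≠] z, deriv f w ≠ 0 := by
    rcases ha.eventually_eq_zero_or_eventually_ne_zero with h | h
    · exfalso
      obtain ⟨r, hr, hb⟩ := Metric.eventually_nhds_iff_ball.1 (h.and (hU.mem_nhds hz))
      have hbU : Metric.ball z r ⊆ U := fun w hw => (hb w hw).2
      have hcst : ∀ w ∈ Metric.ball z r, f w = f z := by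
        intro w hw
        refine Metric.isOpen_ball.is_const_of_deriv_eq_zero (convex_ball z r).isPreconnected
          (hf.mono hbU) (fun x hx => (hb x hx).1) hw (Metric.mem_ball_self hr)
      have hw : z + (r / 2 : ℝ) ∈ Metric.ball z r := by
        simp [abs_of_pos hr]; linarith
      have := hi (hbU hw) hz (hcst _ hw)
      have h3 : ((r / 2 : ℝ) : ℂ) = 0 := by simpa using this
      rw [ofReal_eq_zero] at h3
      linarith
    · exact h
  have hev : ∀ᶠ w in 𝓝[≠] (f z), DifferentiableAt ℂ g w := by
    rw [eventually_nhdsWithin_iff] at hne ⊢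
    have hc : ContinuousAt g (f z) := hgc.continuousAt (ho.mem_nhds ⟨z, hz, rfl⟩)
    have hc' : Tendsto g (𝓝 (f z)) (𝓝 z) := by simpa [ContinuousAt, hg z hz] using hc
    filter_upwards [hc'.eventually hne, ho.mem_nhds ⟨z, hz, rfl⟩] with w h1 h2 h3
    obtain ⟨x, hx, rfl⟩ := h2
    rw [hg x hx] at h1
    exact key x hx (h1 (fun h => h3 (by rw [Set.mem_singleton_iff] at *; rw [h])))
  exact (analyticAt_of_differentiable_on_punctured_nhds_of_continuousAt hev
    (hgc.continuousAt (ho.mem_nhds ⟨z, hz, rfl⟩))).differentiableAt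

theorem deriv_mul_deriv_leftInverse {f g : ℂ → ℂ} {U : Set ℂ} (hU : IsOpen U)
    (hf : DifferentiableOn ℂ f U) (hi : Set.InjOn f U) (hgd : DifferentiableOn ℂ g (f '' U))
    (hg : ∀ z ∈ U, g (f z) = z) {z : ℂ} (hz : z ∈ U) : deriv g (f z) * deriv f z = 1 := by
  have ho := isOpen_image_of_injOn hU hf hi
  have h1 : HasDerivAt g (deriv g (f z)) (f z) :=
    (hgd.differentiableAt (ho.mem_nhds ⟨z, hz, rfl⟩)).hasDerivAt
  have h2 : HasDerivAt f (deriv f z) z := (hf.differentiableAt (hU.mem_nhds hz)).hasDerivAt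
  have h3 := h1.comp z h2
  refine h3.unique ((hasDerivAt_id z).congr_of_eventuallyEq ?_)
  filter_upwards [hU.mem_nhds hz] with w hw
  exact hg w hw

theorem deriv_ne_zero_of_injOn {f : ℂ → ℂ} {U : Set ℂ} (hU : IsOpen U)
    (hf : DifferentiableOn ℂ f U) (hi : Set.InjOn f U) {z : ℂ} (hz : z ∈ U) : deriv f z ≠ 0 := by
  obtain ⟨g, hgd, hg⟩ := exists_differentiableOn_leftInverse hU hf hi
  exact right_ne_zero_of_mul_eq_one (deriv_mul_deriv_leftInverse hU hf hi hgd hg hz)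

/-! ### Schwarz–Pick in the right half-plane. -/

/-- The open right half-plane. -/
def rightHalfPlane : Set ℂ := {u | 0 < u.re}

theorem isOpen_rightHalfPlane : IsOpen rightHalfPlane := isOpen_lt continuous_const continuous_re

theorem convex_rightHalfPlane : Convex ℝ rightHalfPlane := convex_halfSpace_re_gt 0

theorem norm_add_conj_sq (a b : ℂ) :
    ‖a + starRingEnd ℂ b‖ ^ 2 = ‖a - b‖ ^ 2 + 4 * (a.re * b.re) := by
  rw [← normSq_eq_norm_sq, ← normSq_eq_norm_sq, normSq_apply, normSq_apply]
  simp; ring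

theorem add_conj_ne_zero {a b : ℂ} (ha : 0 < a.re) (hb : 0 < b.re) :
    a + starRingEnd ℂ b ≠ 0 := by
  intro h
  have := congrArg re h
  simp at this; linarith

/-- The Schwarz–Pick inequality for the right half-plane. -/
theorem schwarz_pick_of_pos {φ : ℂ → ℂ} (hd : DifferentiableOn ℂ φ rightHalfPlane)
    (hm : ∀ u ∈ rightHalfPlane, 0 < (φ u).re) {u w : ℂ} (hu : u ∈ rightHalfPlane)
    (hw : w ∈ rightHalfPlane) :
    ‖φ u - φ w‖ ^ 2 * (u.re * w.re) ≤ ‖u - w‖ ^ 2 * ((φ u).re * (φ w).re) := by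
  have hu' : 0 < u.re := hu
  have hw' : 0 < w.re := hw
  have hφu := hm u hu
  have hφw := hm w hw
  -- The Möbius map of the disk onto the half-plane with 0 ↦ w. Composing φ ∘ m with the map that
  -- sends φ w to 0 gives ψ, to which Schwarz's lemma applies.
  let m : ℂ → ℂ := fun ζ => (w + starRingEnd ℂ w * ζ) / (1 - ζ)
  have h1 : ∀ ζ ∈ Metric.ball (0 : ℂ) 1, 1 - ζ ≠ 0 := by
    intro ζ hζ h
    rw [mem_ball_zero_iff] at hζ
    rw [sub_eq_zero] at h
    rw [← h] at hζ
    simp at hζ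
  have hmH : ∀ ζ ∈ Metric.ball (0 : ℂ) 1, m ζ ∈ rightHalfPlane := by
    intro ζ hζ
    have hn := h1 ζ hζ
    show 0 < (m ζ).re
    have : (m ζ).re = w.re * (1 - ‖ζ‖ ^ 2) / normSq (1 - ζ) := by
      simp only [m, div_re]
      rw [← normSq_eq_norm_sq, normSq_apply ζ, ← add_div]
      simp; ring
    rw [this]
    rw [mem_ball_zero_iff] at hζ
    have := normSq_pos.2 hn
    have h2 : ‖ζ‖ ^ 2 < 1 := by nlinarith [norm_nonneg ζ]
    have : 0 < 1 - ‖ζ‖ ^ 2 := by linarith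
    positivity
  let ψ : ℂ → ℂ := fun ζ => (φ (m ζ) - φ w) / (φ (m ζ) + starRingEnd ℂ (φ w))
  have hmd : DifferentiableOn ℂ m (Metric.ball 0 1) := by
    refine DifferentiableOn.div (by fun_prop) (by fun_prop) h1
  have hφm : DifferentiableOn ℂ (fun ζ => φ (m ζ)) (Metric.ball 0 1) := hd.comp hmd hmH
  have hψd : DifferentiableOn ℂ ψ (Metric.ball 0 1) :=
    (hφm.sub_const _).div (hφm.add_const _) fun ζ hζ => add_conj_ne_zero (hm _ (hmH ζ hζ)) hφw
  have hψm : Set.MapsTo ψ (Metric.ball 0 1) (Metric.ball 0 1) := by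
    intro ζ hζ
    have hp := hm _ (hmH ζ hζ)
    rw [mem_ball_zero_iff]
    simp only [ψ, norm_div]
    rw [div_lt_one (norm_pos_iff.2 (add_conj_ne_zero hp hφw))]
    refine lt_of_pow_lt_pow_left₀ 2 (norm_nonneg _) ?_
    rw [norm_add_conj_sq]
    nlinarith [mul_pos hp hφw]
  have hne := add_conj_ne_zero hu' hw'
  have hmem : (u - w) / (u + starRingEnd ℂ w) ∈ Metric.ball (0 : ℂ) 1 := by
    rw [mem_ball_zero_iff, norm_div, div_lt_one (norm_pos_iff.2 hne)]
    refine lt_of_pow_lt_pow_left₀ 2 (norm_nonneg _) ?_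
    rw [norm_add_conj_sq]
    nlinarith [mul_pos hu' hw']
  have hmu : m ((u - w) / (u + starRingEnd ℂ w)) = u := by
    have h2 := h1 _ hmem
    have h3 : w + starRingEnd ℂ w ≠ 0 := add_conj_ne_zero hw' hw'
    have h4 : 1 - (u - w) / (u + starRingEnd ℂ w)
        = (w + starRingEnd ℂ w) / (u + starRingEnd ℂ w) := by field_simp; ring
    simp only [m]
    rw [h4]
    field_simp
    ring
  have hψ0 : ψ 0 = 0 := by simp [ψ, m]
  have key := norm_le_norm_of_mapsTo_ball hψd (hψm.mono_right Metric.ball_subset_closedBall) hψ0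
    (mem_ball_zero_iff.1 hmem)
  simp only [ψ, hmu, norm_div] at key
  rw [div_le_div_iff₀ (norm_pos_iff.2 (add_conj_ne_zero hφu hφw)) (norm_pos_iff.2 hne)] at key
  have h5 := pow_le_pow_left₀ (by positivity) key 2
  rw [mul_pow, mul_pow, norm_add_conj_sq, norm_add_conj_sq] at h5
  nlinarith

/-- Apply the strict version to φ + ε and let ε → 0. Allowing real part zero is what later yields
rigidity. -/
theorem schwarz_pick {φ : ℂ → ℂ} (hd : DifferentiableOn ℂ φ rightHalfPlane)
    (hm : ∀ u ∈ rightHalfPlane, 0 ≤ (φ u).re) {u w : ℂ} (hu : u ∈ rightHalfPlane)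
    (hw : w ∈ rightHalfPlane) :
    ‖φ u - φ w‖ ^ 2 * (u.re * w.re) ≤ ‖u - w‖ ^ 2 * ((φ u).re * (φ w).re) := by
  have key : ∀ ε : ℝ, 0 < ε → ‖φ u - φ w‖ ^ 2 * (u.re * w.re) ≤
      ‖u - w‖ ^ 2 * (((φ u).re + ε) * ((φ w).re + ε)) := by
    intro ε hε
    have := schwarz_pick_of_pos (φ := fun v => φ v + ε) (hd.add_const _)
      (fun v hv => by simpa using add_pos_of_nonneg_of_pos (hm v hv) hε) hu hw
    simpa using this
  have ht : Tendsto (fun ε : ℝ => ‖u - w‖ ^ 2 * (((φ u).re + ε) * ((φ w).re + ε))) (𝓝[>] 0)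
      (𝓝 (‖u - w‖ ^ 2 * (((φ u).re + 0) * ((φ w).re + 0)))) :=
    tendsto_nhdsWithin_of_tendsto_nhds (Continuous.tendsto (by fun_prop) 0)
  simp only [add_zero] at ht
  refine ge_of_tendsto ht ?_
  filter_upwards [self_mem_nhdsWithin] with ε hε using key ε hε

/-- The infinitesimal form of Schwarz–Pick: divide by |w - u|² and let w → u. -/
theorem norm_deriv_mul_re_le {φ : ℂ → ℂ} (hd : DifferentiableOn ℂ φ rightHalfPlane)
    (hm : ∀ u ∈ rightHalfPlane, 0 ≤ (φ u).re) {u : ℂ} (hu : u ∈ rightHalfPlane) :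
    ‖deriv φ u‖ * u.re ≤ (φ u).re := by
  have hu' : 0 < u.re := hu
  have hdu := hd.differentiableAt (isOpen_rightHalfPlane.mem_nhds hu)
  have h1 : Tendsto (slope φ u) (𝓝[≠] u) (𝓝 (deriv φ u)) :=
    hasDerivAt_iff_tendsto_slope.1 hdu.hasDerivAt
  have h2 : Tendsto (fun w : ℂ => w.re) (𝓝[≠] u) (𝓝 u.re) :=
    tendsto_nhdsWithin_of_tendsto_nhds (continuous_re.tendsto u)
  have h3 : Tendsto (fun w : ℂ => (φ w).re) (𝓝[≠] u) (𝓝 (φ u).re) :=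
    tendsto_nhdsWithin_of_tendsto_nhds
      ((continuous_re.tendsto _).comp hdu.continuousAt)
  have h4 : ‖deriv φ u‖ ^ 2 * (u.re * u.re) ≤ (φ u).re * (φ u).re := by
    refine le_of_tendsto_of_tendsto (((h1.norm.pow 2).mul (h2.mul_const _)))
      (h3.mul_const _) ?_
    filter_upwards [self_mem_nhdsWithin,
      mem_nhdsWithin_of_mem_nhds (isOpen_rightHalfPlane.mem_nhds hu)] with w hw hwH
    have := schwarz_pick hd hm hwH hu
    have hpos : 0 < ‖w - u‖ := norm_pos_iff.2 (sub_ne_zero.2 hw)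
    rw [slope_def_field, norm_div, div_pow, div_mul_eq_mul_div, div_le_iff₀ (by positivity)]
    linarith
  refine (sq_le_sq₀ (by positivity) (hm u hu)).1 ?_
  rw [mul_pow]; nlinarith

/-! ### Cayley transforms and Schwarz–Pick in the disk. -/

/-- The Cayley transform of the right half-plane onto the unit disk. -/
noncomputable def toDisk (u : ℂ) : ℂ := (u - 1) / (u + 1)

/-- The Cayley transform of the unit disk onto the right half-plane. -/
noncomputable def toHalf (z : ℂ) : ℂ := (1 + z) / (1 - z)

theorem one_sub_ne_zero_of_mem_ball {z : ℂ} (hz : z ∈ Metric.ball (0 : ℂ) 1) : 1 - z ≠ 0 := by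
  intro h
  rw [mem_ball_zero_iff] at hz
  rw [sub_eq_zero] at h
  rw [← h] at hz
  simp at hz

theorem add_one_ne_zero_of_mem {u : ℂ} (hu : u ∈ rightHalfPlane) : u + 1 ≠ 0 := by
  simpa using add_conj_ne_zero (b := 1) hu (by simp)

theorem re_toHalf (z : ℂ) : (toHalf z).re = (1 - ‖z‖ ^ 2) / ‖1 - z‖ ^ 2 := by
  simp only [toHalf, div_re]
  rw [← normSq_eq_norm_sq, ← normSq_eq_norm_sq, normSq_apply z, ← add_div]
  simp; ring

theorem one_sub_norm_sq_pos {z : ℂ} (hz : z ∈ Metric.ball (0 : ℂ) 1) : 0 < 1 - ‖z‖ ^ 2 := by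
  rw [mem_ball_zero_iff] at hz
  nlinarith [norm_nonneg z]

theorem toHalf_mem {z : ℂ} (hz : z ∈ Metric.ball (0 : ℂ) 1) : toHalf z ∈ rightHalfPlane := by
  show 0 < (toHalf z).re
  rw [re_toHalf]
  have := norm_pos_iff.2 (one_sub_ne_zero_of_mem_ball hz)
  have := one_sub_norm_sq_pos hz
  positivity

theorem toDisk_mem {u : ℂ} (hu : u ∈ rightHalfPlane) : toDisk u ∈ Metric.ball (0 : ℂ) 1 := by
  have hu' : 0 < u.re := hu
  have hne := add_one_ne_zero_of_mem hu
  rw [mem_ball_zero_iff, toDisk, norm_div, div_lt_one (norm_pos_iff.2 hne)]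
  refine lt_of_pow_lt_pow_left₀ 2 (norm_nonneg _) ?_
  have := norm_add_conj_sq u 1
  simp only [map_one, one_re, mul_one] at this
  rw [this]
  linarith

theorem toHalf_toDisk {u : ℂ} (hu : u ∈ rightHalfPlane) : toHalf (toDisk u) = u := by
  have hne := add_one_ne_zero_of_mem hu
  have h4 : 1 - toDisk u = 2 / (u + 1) := by rw [toDisk]; field_simp; ring
  rw [toHalf, h4, toDisk]
  field_simp
  ring

theorem toDisk_toHalf {z : ℂ} (hz : z ≠ 1) : toDisk (toHalf z) = z := by
  have hne : 1 - z ≠ 0 := sub_ne_zero.2 hz.symm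
  have h4 : toHalf z + 1 = 2 / (1 - z) := by rw [toHalf]; field_simp; ring
  rw [toDisk, h4, toHalf]
  field_simp
  ring

theorem differentiableOn_toHalf : DifferentiableOn ℂ toHalf (Metric.ball 0 1) :=
  DifferentiableOn.div (by fun_prop) (by fun_prop) fun _ h => one_sub_ne_zero_of_mem_ball h

theorem differentiableOn_toDisk : DifferentiableOn ℂ toDisk rightHalfPlane :=
  DifferentiableOn.div (by fun_prop) (by fun_prop) fun _ h => add_one_ne_zero_of_mem h

theorem toHalf_sub_toHalf {z w : ℂ} (hz : z ∈ Metric.ball (0 : ℂ) 1)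
    (hw : w ∈ Metric.ball (0 : ℂ) 1) :
    toHalf z - toHalf w = 2 * (z - w) / ((1 - z) * (1 - w)) := by
  have h1 := one_sub_ne_zero_of_mem_ball hz
  have h2 := one_sub_ne_zero_of_mem_ball hw
  simp only [toHalf]
  field_simp
  ring

/-- The Cayley transform turns |u-w|²/(Re u Re w) into 4|z-w|²/((1-|z|²)(1-|w|²)), so this is the
half-plane inequality conjugated. -/
theorem schwarz_pick_disk {φ : ℂ → ℂ} (hd : DifferentiableOn ℂ φ (Metric.ball 0 1))
    (hm : Set.MapsTo φ (Metric.ball 0 1) (Metric.ball 0 1)) {z w : ℂ}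
    (hz : z ∈ Metric.ball (0 : ℂ) 1) (hw : w ∈ Metric.ball (0 : ℂ) 1) :
    ‖φ z - φ w‖ ^ 2 * ((1 - ‖z‖ ^ 2) * (1 - ‖w‖ ^ 2)) ≤
      ‖z - w‖ ^ 2 * ((1 - ‖φ z‖ ^ 2) * (1 - ‖φ w‖ ^ 2)) := by
  have h := schwarz_pick_of_pos (φ := fun u => toHalf (φ (toDisk u)))
    (differentiableOn_toHalf.comp (hd.comp differentiableOn_toDisk fun _ h => toDisk_mem h)
      fun u h => hm (toDisk_mem h)) (fun u h => toHalf_mem (hm (toDisk_mem h)))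
    (toHalf_mem hz) (toHalf_mem hw)
  have hz1 : z ≠ 1 := fun h => one_sub_ne_zero_of_mem_ball hz (by rw [h, sub_self])
  have hw1 : w ≠ 1 := fun h => one_sub_ne_zero_of_mem_ball hw (by rw [h, sub_self])
  simp only [toDisk_toHalf hz1, toDisk_toHalf hw1, toHalf_sub_toHalf hz hw,
    toHalf_sub_toHalf (hm hz) (hm hw), re_toHalf, norm_div, norm_mul] at h
  have p1 := norm_pos_iff.2 (one_sub_ne_zero_of_mem_ball hz)
  have p2 := norm_pos_iff.2 (one_sub_ne_zero_of_mem_ball hw)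
  have p3 := norm_pos_iff.2 (one_sub_ne_zero_of_mem_ball (hm hz))
  have p4 := norm_pos_iff.2 (one_sub_ne_zero_of_mem_ball (hm hw))
  have h2 : ‖(2 : ℂ)‖ = 2 := by simp
  rw [h2] at h
  have e1 : (2 * ‖φ z - φ w‖ / (‖1 - φ z‖ * ‖1 - φ w‖)) ^ 2 *
      ((1 - ‖z‖ ^ 2) / ‖1 - z‖ ^ 2 * ((1 - ‖w‖ ^ 2) / ‖1 - w‖ ^ 2)) =
      4 / (‖1 - φ z‖ * ‖1 - φ w‖ * ‖1 - z‖ * ‖1 - w‖) ^ 2 *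
      (‖φ z - φ w‖ ^ 2 * ((1 - ‖z‖ ^ 2) * (1 - ‖w‖ ^ 2))) := by field_simp; ring
  have e2 : (2 * ‖z - w‖ / (‖1 - z‖ * ‖1 - w‖)) ^ 2 *
      ((1 - ‖φ z‖ ^ 2) / ‖1 - φ z‖ ^ 2 * ((1 - ‖φ w‖ ^ 2) / ‖1 - φ w‖ ^ 2)) =
      4 / (‖1 - φ z‖ * ‖1 - φ w‖ * ‖1 - z‖ * ‖1 - w‖) ^ 2 *
      (‖z - w‖ ^ 2 * ((1 - ‖φ z‖ ^ 2) * (1 - ‖φ w‖ ^ 2))) := by field_simp; ring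
  rw [e1, e2] at h
  exact le_of_mul_le_mul_left h (by positivity)

/-! ### The dilation semigroup and its generator. -/

/-- Supplies arbitrarily late times after which an orbit never comes closer to the origin. Past some
S the function exceeds h T, so a minimum over a compact interval is a minimum over the whole ray. -/
theorem exists_le_forall_ge {h : ℝ → ℝ} (hc : ContinuousOn h (Set.Ici 0)) (h1 : ∀ t ≥ 0, h t < 1)
    (ht : Tendsto h atTop (𝓝 1)) (T : ℝ) (hT : 0 ≤ T) :
    ∃ t ≥ T, ∀ s ≥ t, h t ≤ h s := by
  obtain ⟨S, hS⟩ := eventually_atTop.1 (ht.eventually (lt_mem_nhds (h1 T hT)))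
  have hne : (Set.Icc T (max S T)).Nonempty := ⟨T, le_rfl, le_max_right _ _⟩
  obtain ⟨t, htm, hmin⟩ := isCompact_Icc.exists_isMinOn hne
    (hc.mono fun x hx => hT.trans hx.1)
  refine ⟨t, htm.1, fun s hs => ?_⟩
  by_cases hs' : s ≤ max S T
  · exact hmin ⟨htm.1.trans hs, hs'⟩
  · have h2 : S ≤ s := (le_max_left _ _).trans (not_le.1 hs').le
    exact (hmin (Set.left_mem_Icc.2 (le_max_right _ _))).trans (hS s h2).le

/-- Otherwise w would lie on the segment between two points of the complement, k and its dilated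
image. -/
theorem add_smul_sub_mem_of_convex_compl {Ω : Set ℂ} (hK : Convex ℝ Ωᶜ) {k w : ℂ} (hk : k ∉ Ω)
    (hw : w ∈ Ω) {s : ℝ} (hs : 0 ≤ s) : k + exp s * (w - k) ∈ Ω := by
  by_contra h
  have h1 : 1 ≤ Real.exp s := Real.one_le_exp hs
  have h2 := Real.exp_pos s
  have := hK hk h (a := 1 - (Real.exp s)⁻¹) (b := (Real.exp s)⁻¹)
    (sub_nonneg.2 (inv_le_one_of_one_le₀ h1)) (by positivity) (by ring)
  refine this ?_
  have h3 : exp (s : ℂ) ≠ 0 := exp_ne_zero _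
  convert hw using 1
  simp only [real_smul]
  push_cast
  field_simp
  ring

/-- Boundary fixed point of the dilation semigroup of a domain with convex complement. -/
theorem exists_horocycle_le {f : ℂ → ℂ} (hf : DifferentiableOn ℂ f (Metric.ball 0 1))
    (hi : Set.InjOn f (Metric.ball 0 1)) (hK : Convex ℝ (f '' Metric.ball 0 1)ᶜ) {k : ℂ}
    (hk : k ∉ f '' Metric.ball 0 1) :
    ∃ τ : ℂ, ‖τ‖ = 1 ∧ ∀ z ∈ Metric.ball (0 : ℂ) 1, ∀ z' ∈ Metric.ball (0 : ℂ) 1, ∀ s : ℝ, 0 ≤ s →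
      f z' = k + exp s * (f z - k) →
      ‖z' - τ‖ ^ 2 * (1 - ‖z‖ ^ 2) ≤ ‖z - τ‖ ^ 2 * (1 - ‖z'‖ ^ 2) := by
  obtain ⟨g, hgd, hg⟩ := exists_differentiableOn_leftInverse Metric.isOpen_ball hf hi
  have h0 : (0 : ℂ) ∈ Metric.ball (0 : ℂ) 1 := Metric.mem_ball_self one_pos
  let φ : ℝ → ℂ → ℂ := fun s z => g (k + exp s * (f z - k))
  have hin : ∀ s : ℝ, 0 ≤ s → ∀ z ∈ Metric.ball (0 : ℂ) 1,
      k + exp s * (f z - k) ∈ f '' Metric.ball 0 1 := fun s hs z hz =>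
    add_smul_sub_mem_of_convex_compl hK hk ⟨z, hz, rfl⟩ hs
  have hφf : ∀ s : ℝ, 0 ≤ s → ∀ z ∈ Metric.ball (0 : ℂ) 1,
      φ s z ∈ Metric.ball (0 : ℂ) 1 ∧ f (φ s z) = k + exp s * (f z - k) := by
    intro s hs z hz
    obtain ⟨x, hx, hxe⟩ := hin s hs z hz
    have : φ s z = x := by simp only [φ]; rw [← hxe, hg x hx]
    rw [this]; exact ⟨hx, hxe⟩
  have hφd : ∀ s : ℝ, 0 ≤ s → DifferentiableOn ℂ (φ s) (Metric.ball 0 1) := fun s hs =>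
    hgd.comp (((hf.sub_const _).const_mul _).const_add _) (hin s hs)
  have hadd : ∀ s t : ℝ, 0 ≤ s → 0 ≤ t → ∀ z ∈ Metric.ball (0 : ℂ) 1,
      φ s (φ t z) = φ (s + t) z := by
    intro s t hs ht z hz
    obtain ⟨h1, h2⟩ := hφf t ht z hz
    simp only [φ] at h2 ⊢
    rw [h2]
    congr 1
    push_cast
    rw [Complex.exp_add]
    ring
  let x : ℝ → ℂ := fun t => φ t 0
  have hxm : ∀ t ≥ 0, x t ∈ Metric.ball (0 : ℂ) 1 := fun t ht => (hφf t ht 0 h0).1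
  have hxc : ContinuousOn x (Set.Ici 0) := by
    refine hgd.continuousOn.comp (f := fun t : ℝ => k + exp (t : ℂ) * (f 0 - k)) ?_ fun t ht => hin t ht 0 h0
    exact Continuous.continuousOn (by fun_prop)
  have hfk : 0 < ‖f 0 - k‖ := by
    rw [norm_pos_iff, sub_ne_zero]
    rintro rfl
    exact hk ⟨0, h0, rfl⟩
  -- The orbit leaves every compact subset of the disk because its image under f escapes to infinity
  -- like e^t.
  have hlim : Tendsto (fun t => ‖x t‖) atTop (𝓝 1) := by
    rw [tendsto_order]
    constructor
    · intro r hr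
      have hcomp : IsCompact (Metric.closedBall (0 : ℂ) r) := isCompact_closedBall _ _
      obtain ⟨C, hC⟩ := hcomp.exists_bound_of_continuousOn
        ((hf.continuousOn.mono (Metric.closedBall_subset_ball hr)).sub continuousOn_const (g := fun _ => k))
      have hexp : Tendsto (fun t : ℝ => Real.exp t * ‖f 0 - k‖) atTop atTop :=
        Real.tendsto_exp_atTop.atTop_mul_const hfk
      filter_upwards [hexp.eventually_gt_atTop C, eventually_ge_atTop 0] with t ht1 ht0
      by_contra hle
      have h1 := hC (x t) (by rw [mem_closedBall_zero_iff]; exact not_lt.1 hle)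
      have h2 := (hφf t ht0 0 h0).2
      change ‖f (φ t 0) - k‖ ≤ C at h1
      rw [h2, add_sub_cancel_left, norm_mul, norm_exp, ofReal_re] at h1
      linarith
    · intro r hr
      filter_upwards [eventually_ge_atTop 0] with t ht
      exact (mem_ball_zero_iff.1 (hxm t ht)).trans hr
  have hrec : ∀ n : ℕ, ∃ t : ℝ, t ≥ n ∧ ∀ s ≥ t, ‖x t‖ ≤ ‖x s‖ := fun n =>
    exists_le_forall_ge hxc.norm (fun t ht => mem_ball_zero_iff.1 (hxm t ht)) hlim n
      (Nat.cast_nonneg n)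
  choose t htn ht using hrec
  have ht0 : ∀ n, 0 ≤ t n := fun n => (Nat.cast_nonneg n).trans (htn n)
  have httop : Tendsto t atTop atTop := tendsto_atTop_mono htn tendsto_natCast_atTop_atTop
  obtain ⟨τ, -, ψ, hψ, hτ⟩ := (isCompact_closedBall (0 : ℂ) 1).tendsto_subseq
    (x := fun n => x (t n)) fun n => Metric.ball_subset_closedBall (hxm _ (ht0 n))
  have htψ : Tendsto (fun n => t (ψ n)) atTop atTop := httop.comp hψ.tendsto_atTop
  have hτ1 : ‖τ‖ = 1 := tendsto_nhds_unique hτ.norm (hlim.comp htψ)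
  refine ⟨τ, hτ1, fun z hz z' hz' s hs hzz' => ?_⟩
  have hz'φ : z' = φ s z := by simp only [φ]; rw [← hzz', hg z' hz']
  -- By Schwarz–Pick for φ_t the points x(t) and x(t+s) stay at bounded hyperbolic distance. As both
  -- approach the circle, their Euclidean distance tends to 0.
  have hstep : Tendsto (fun n => x (t (ψ n) + s)) atTop (𝓝 τ) := by
    have hb : ∀ n, ‖x (t (ψ n) + s) - x (t (ψ n))‖ ^ 2 * (1 - ‖φ s 0‖ ^ 2) ≤
        ‖φ s 0‖ ^ 2 * ((1 - ‖x (t (ψ n) + s)‖ ^ 2) * (1 - ‖x (t (ψ n))‖ ^ 2)) := by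
      intro n
      have := schwarz_pick_disk (hφd (t (ψ n)) (ht0 _)) (fun z hz => (hφf _ (ht0 _) z hz).1)
        (hφf s hs 0 h0).1 h0
      rw [hadd _ _ (ht0 _) hs 0 h0] at this
      simpa [x] using this
    have hpos := one_sub_norm_sq_pos (hφf s hs 0 h0).1
    have hl1 : Tendsto (fun n => ‖x (t (ψ n))‖) atTop (𝓝 1) := hlim.comp htψ
    have hl2 : Tendsto (fun n => ‖x (t (ψ n) + s)‖) atTop (𝓝 1) :=
      hlim.comp (tendsto_atTop_add_const_right _ _ htψ)
    have hz0 : Tendsto (fun n => ‖x (t (ψ n) + s) - x (t (ψ n))‖ ^ 2) atTop (𝓝 0) := by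
      have h3 : Tendsto (fun n => ‖φ s 0‖ ^ 2 * ((1 - ‖x (t (ψ n) + s)‖ ^ 2) *
          (1 - ‖x (t (ψ n))‖ ^ 2)) / (1 - ‖φ s 0‖ ^ 2)) atTop
          (𝓝 (‖φ s 0‖ ^ 2 * ((1 - 1 ^ 2) * (1 - 1 ^ 2)) / (1 - ‖φ s 0‖ ^ 2))) :=
        (((hl2.pow 2).const_sub 1).mul ((hl1.pow 2).const_sub 1)).const_mul _ |>.div_const _
      simp only [one_pow, sub_self, mul_zero, zero_div] at h3
      refine squeeze_zero (fun n => by positivity) (fun n => ?_) h3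
      rw [le_div_iff₀ hpos]; exact hb n
    have hz1 : Tendsto (fun n => ‖x (t (ψ n) + s) - x (t (ψ n))‖) atTop (𝓝 0) := by
      have := hz0.sqrt
      simpa using this
    have := (tendsto_zero_iff_norm_tendsto_zero.2 hz1).add hτ
    simpa using this
  -- Schwarz–Pick for φ_s between z and x(t). The choice of t gives 1-|x(t+s)|² ≤ 1-|x(t)|², so this
  -- factor cancels in the favourable direction.
  have hineq : ∀ n, ‖z' - x (t (ψ n) + s)‖ ^ 2 * (1 - ‖z‖ ^ 2) ≤
      ‖z - x (t (ψ n))‖ ^ 2 * (1 - ‖z'‖ ^ 2) := by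
    intro n
    have hxm' := hxm _ (ht0 (ψ n))
    have h1 := schwarz_pick_disk (hφd s hs) (fun z hz => (hφf s hs z hz).1) hz hxm'
    have h2 : φ s (x (t (ψ n))) = x (t (ψ n) + s) := by
      rw [add_comm]; exact hadd _ _ hs (ht0 _) 0 h0
    rw [h2, ← hz'φ] at h1
    have h3 : ‖x (t (ψ n))‖ ≤ ‖x (t (ψ n) + s)‖ := ht (ψ n) _ (le_add_of_nonneg_right hs)
    have hp := one_sub_norm_sq_pos hxm'
    have h4 : 1 - ‖x (t (ψ n) + s)‖ ^ 2 ≤ 1 - ‖x (t (ψ n))‖ ^ 2 := by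
      have := pow_le_pow_left₀ (norm_nonneg _) h3 2
      linarith
    have h5 : ‖z - x (t (ψ n))‖ ^ 2 * ((1 - ‖z'‖ ^ 2) * (1 - ‖x (t (ψ n) + s)‖ ^ 2)) ≤
        ‖z - x (t (ψ n))‖ ^ 2 * ((1 - ‖z'‖ ^ 2) * (1 - ‖x (t (ψ n))‖ ^ 2)) :=
      mul_le_mul_of_nonneg_left
        (mul_le_mul_of_nonneg_left h4 (one_sub_norm_sq_pos hz').le) (by positivity)
    have h6 := h1.trans h5
    rw [← mul_assoc, ← mul_assoc] at h6
    exact le_of_mul_le_mul_right h6 hp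
  exact le_of_tendsto_of_tendsto' (((hstep.const_sub z').norm.pow 2).mul_const _)
    (((hτ.const_sub z)).norm.pow 2 |>.mul_const _) hineq

/-- The quotient is the velocity at s = 0 of the pulled-back dilation orbit through u, and the real
part does not decrease along that orbit. -/
theorem re_sub_div_deriv_nonneg_of_re_le {F : ℂ → ℂ} (hF : DifferentiableOn ℂ F rightHalfPlane)
    (hi : Set.InjOn F rightHalfPlane) (hK : Convex ℝ (F '' rightHalfPlane)ᶜ) {k : ℂ}
    (hk : k ∉ F '' rightHalfPlane)
    (hmono : ∀ u ∈ rightHalfPlane, ∀ u' ∈ rightHalfPlane, ∀ s : ℝ, 0 ≤ s →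
      F u' = k + exp s * (F u - k) → u.re ≤ u'.re) {u : ℂ} (hu : u ∈ rightHalfPlane) :
    0 ≤ ((F u - k) / deriv F u).re := by
  obtain ⟨g, hgd, hg⟩ := exists_differentiableOn_leftInverse isOpen_rightHalfPlane hF hi
  have ho := isOpen_image_of_injOn isOpen_rightHalfPlane hF hi
  have hin : ∀ s : ℝ, 0 ≤ s → k + exp s * (F u - k) ∈ F '' rightHalfPlane := fun s hs =>
    add_smul_sub_mem_of_convex_compl hK hk ⟨u, hu, rfl⟩ hs
  have hne := deriv_ne_zero_of_injOn isOpen_rightHalfPlane hF hi hu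
  have hg' : deriv g (F u) = (deriv F u)⁻¹ :=
    eq_inv_of_mul_eq_one_left (deriv_mul_deriv_leftInverse isOpen_rightHalfPlane hF hi hgd hg hu)
  have h1 : HasDerivAt g (deriv F u)⁻¹ (k + exp ((0 : ℝ) : ℂ) * (F u - k)) := by
    rw [← hg']
    have : k + exp ((0 : ℝ) : ℂ) * (F u - k) = F u := by simp
    rw [this]
    exact (hgd.differentiableAt (ho.mem_nhds ⟨u, hu, rfl⟩)).hasDerivAt
  have h2 : HasDerivAt (fun s : ℝ => k + exp (s : ℂ) * (F u - k)) (F u - k) 0 := by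
    have := ((hasDerivAt_exp ((0 : ℝ) : ℂ)).comp_ofReal.mul_const (F u - k)).const_add k
    simpa using this
  have h3 : HasDerivAt (fun s : ℝ => g (k + exp (s : ℂ) * (F u - k)))
      ((deriv F u)⁻¹ * (F u - k)) 0 := h1.comp (0 : ℝ) h2
  have h4 : HasDerivAt (fun s : ℝ => (g (k + exp (s : ℂ) * (F u - k))).re)
      ((deriv F u)⁻¹ * (F u - k)).re 0 :=
    (reCLM.hasFDerivAt.comp_hasDerivAt (0 : ℝ) h3)
  rw [div_eq_inv_mul]
  have h5 := (hasDerivAt_iff_tendsto_slope.1 h4).mono_left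
    (nhdsWithin_mono (0 : ℝ) (fun x (hx : x ∈ Set.Ioi (0 : ℝ)) => (ne_of_gt hx : x ≠ 0)))
  refine ge_of_tendsto h5 ?_
  filter_upwards [self_mem_nhdsWithin] with s hs
  have hs' : 0 < s := hs
  obtain ⟨u', hu', he⟩ := hin s hs'.le
  have h6 := hmono u hu u' hu' s hs'.le he
  rw [slope_def_field]
  refine div_nonneg ?_ (by linarith)
  have : k + exp ((0 : ℝ) : ℂ) * (F u - k) = F u := by simp
  rw [this, ← he, hg u hu, hg u' hu']
  linarith

theorem add_ofReal_mem {u : ℂ} (hu : u ∈ rightHalfPlane) {t : ℝ} (ht : 0 ≤ t) :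
    u + t ∈ rightHalfPlane := by
  have : 0 < u.re := hu
  show 0 < (u + t).re
  simp; linarith

theorem re_inv_nonneg {a : ℂ} (h : 0 ≤ a.re) : 0 ≤ (a⁻¹).re := by
  rw [inv_re]; exact div_nonneg h (normSq_nonneg _)

/-- The logarithmic derivative of |F(u+t)-k| in t is Re(F'/(F-k)) ≥ 0. This bounds F near a finite
boundary point by its values one unit to the right. -/
theorem norm_sub_le_norm_add_sub {F : ℂ → ℂ} (hF : DifferentiableOn ℂ F rightHalfPlane) {k : ℂ}
    (hk : k ∉ F '' rightHalfPlane)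
    (hG : ∀ u ∈ rightHalfPlane, 0 ≤ ((F u - k) / deriv F u).re) {u : ℂ} (hu : u ∈ rightHalfPlane)
    {t : ℝ} (ht : 0 ≤ t) : ‖F u - k‖ ≤ ‖F (u + t) - k‖ := by
  have hd : ∀ s : ℝ, 0 ≤ s → HasDerivAt (fun s : ℝ => ‖F (u + s) - k‖ ^ 2)
      (2 * inner ℝ (F (u + s) - k) (deriv F (u + s))) s := by
    intro s hs
    have h1 : HasDerivAt F (deriv F (u + s)) (u + s) :=
      (hF.differentiableAt (isOpen_rightHalfPlane.mem_nhds (add_ofReal_mem hu hs))).hasDerivAt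
    have h2 : HasDerivAt (fun s : ℂ => F (u + s) - k) (deriv F (u + s)) (s : ℂ) :=
      (h1.comp_const_add u (s : ℂ)).sub_const k
    exact h2.comp_ofReal.norm_sq
  have hmono : MonotoneOn (fun s : ℝ => ‖F (u + s) - k‖ ^ 2) (Set.Ici 0) := by
    refine monotoneOn_of_deriv_nonneg (convex_Ici 0)
      (fun s hs => (hd s hs).continuousAt.continuousWithinAt) ?_ ?_
    · intro s hs
      rw [interior_Ici] at hs
      exact (hd s (le_of_lt hs)).differentiableAt.differentiableWithinAt
    · intro s hs
      rw [interior_Ici] at hs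
      have hs' : 0 ≤ s := le_of_lt hs
      rw [(hd s hs').deriv]
      have hm := add_ofReal_mem hu hs'
      have h3 := re_inv_nonneg (hG _ hm)
      rw [inv_div] at h3
      have hne : F (u + s) - k ≠ 0 := by
        rw [sub_ne_zero]; rintro rfl; exact hk ⟨_, hm, rfl⟩
      have h4 : inner ℝ (F (u + s) - k) (deriv F (u + s)) =
          normSq (F (u + s) - k) * (deriv F (u + s) / (F (u + s) - k)).re := by
        rw [Complex.inner, div_re]
        have := normSq_pos.2 hne
        field_simp
        simp
        ring
      rw [h4]
      have := normSq_nonneg (F (u + s) - k)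
      positivity
  have := hmono Set.self_mem_Ici (Set.mem_Ici.2 ht) ht
  simpa using (sq_le_sq₀ (norm_nonneg _) (norm_nonneg _)).1 this

instance neBot_nhdsWithin_ball : (𝓝[Metric.ball (0 : ℂ) 1] 1).NeBot := by
  rw [← mem_closure_iff_nhdsWithin_neBot, closure_ball _ one_ne_zero]
  simp

theorem image_comp_toDisk (f : ℂ → ℂ) :
    (fun u => f (toDisk u)) '' rightHalfPlane = f '' Metric.ball 0 1 := by
  ext w
  constructor
  · rintro ⟨u, hu, rfl⟩; exact ⟨_, toDisk_mem hu, rfl⟩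
  · rintro ⟨z, hz, rfl⟩
    refine ⟨toHalf z, toHalf_mem hz, ?_⟩
    have hz1 : z ≠ 1 := fun h => one_sub_ne_zero_of_mem_ball hz (by rw [h, sub_self])
    simp [toDisk_toHalf hz1]

theorem injOn_comp_toDisk {f : ℂ → ℂ} (hi : Set.InjOn f (Metric.ball 0 1)) :
    Set.InjOn (fun u => f (toDisk u)) rightHalfPlane := by
  intro u hu v hv h
  have := hi (toDisk_mem hu) (toDisk_mem hv) h
  rw [← toHalf_toDisk hu, ← toHalf_toDisk hv, this]

theorem differentiableOn_comp_toDisk {f : ℂ → ℂ} (hf : DifferentiableOn ℂ f (Metric.ball 0 1)) :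
    DifferentiableOn ℂ (fun u => f (toDisk u)) rightHalfPlane :=
  hf.comp differentiableOn_toDisk fun _ h => toDisk_mem h

theorem re_eq_of_mem {u : ℂ} (hu : u ∈ rightHalfPlane) :
    u.re = (1 - ‖toDisk u‖ ^ 2) / ‖1 - toDisk u‖ ^ 2 := by
  rw [← re_toHalf, toHalf_toDisk hu]

theorem rotate_mem_ball {τ : ℂ} (hτ : ‖τ‖ = 1) {z : ℂ} (hz : z ∈ Metric.ball (0 : ℂ) 1) :
    τ * z ∈ Metric.ball (0 : ℂ) 1 := by
  rw [mem_ball_zero_iff] at *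
  rwa [norm_mul, hτ, one_mul]

theorem image_rotate {τ : ℂ} (hτ : ‖τ‖ = 1) (f : ℂ → ℂ) :
    (fun z => f (τ * z)) '' Metric.ball 0 1 = f '' Metric.ball 0 1 := by
  have h0 : τ ≠ 0 := by rintro rfl; simp at hτ
  ext w
  constructor
  · rintro ⟨u, hu, rfl⟩; exact ⟨_, rotate_mem_ball hτ hu, rfl⟩
  · rintro ⟨z, hz, rfl⟩
    exact ⟨τ⁻¹ * z, rotate_mem_ball (by rw [norm_inv, hτ, inv_one]) hz,
      by simp [mul_inv_cancel_left₀ h0]⟩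

/-- The dilation generator of a concave univalent function with `f(1) = ∞`, in half-plane
coordinates, has nonnegative real part. -/
theorem re_sub_div_deriv_nonneg {f : ℂ → ℂ} (hf : DifferentiableOn ℂ f (Metric.ball 0 1))
    (hi : Set.InjOn f (Metric.ball 0 1)) (hK : Convex ℝ (f '' Metric.ball 0 1)ᶜ)
    (h1 : Tendsto f (𝓝[Metric.ball 0 1] 1) (cobounded ℂ)) {k : ℂ}
    (hk : k ∉ f '' Metric.ball 0 1) {u : ℂ} (hu : u ∈ rightHalfPlane) :
    0 ≤ ((f (toDisk u) - k) / deriv (fun u => f (toDisk u)) u).re := by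
  obtain ⟨τ, hτ, hτm⟩ := exists_horocycle_le hf hi hK hk
  have h0 : τ ≠ 0 := by rintro rfl; simp at hτ
  -- After rotating τ to 1, the horocycle inequality becomes monotonicity of the real part in the
  -- half-plane.
  let fτ : ℂ → ℂ := fun z => f (τ * z)
  have himg : (fun u => fτ (toDisk u)) '' rightHalfPlane = f '' Metric.ball 0 1 := by
    rw [image_comp_toDisk fτ]; exact image_rotate hτ f
  have hfτ : DifferentiableOn ℂ fτ (Metric.ball 0 1) :=
    hf.comp (by fun_prop) fun z hz => rotate_mem_ball hτ hz
  have hiτ : Set.InjOn fτ (Metric.ball 0 1) := by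
    intro z hz w hw h
    exact mul_left_cancel₀ h0 (hi (rotate_mem_ball hτ hz) (rotate_mem_ball hτ hw) h)
  have hG : ∀ u ∈ rightHalfPlane,
      0 ≤ ((fτ (toDisk u) - k) / deriv (fun u => fτ (toDisk u)) u).re := by
    intro u hu
    refine re_sub_div_deriv_nonneg_of_re_le (differentiableOn_comp_toDisk hfτ)
      (injOn_comp_toDisk hiτ) (by rw [himg]; exact hK) (by rw [himg]; exact hk) ?_ hu
    intro v hv v' hv' s hs he
    have h2 := hτm _ (rotate_mem_ball hτ (toDisk_mem hv)) _ (rotate_mem_ball hτ (toDisk_mem hv'))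
      s hs he
    have e : ∀ z : ℂ, ‖τ * z - τ‖ = ‖1 - z‖ := by
      intro z
      have : τ * z - τ = τ * (z - 1) := by ring
      rw [this, norm_mul, hτ, one_mul, norm_sub_rev]
    rw [e, e, norm_mul, norm_mul, hτ, one_mul, one_mul] at h2
    rw [re_eq_of_mem hv, re_eq_of_mem hv']
    have p1 := norm_pos_iff.2 (one_sub_ne_zero_of_mem_ball (toDisk_mem hv))
    have p2 := norm_pos_iff.2 (one_sub_ne_zero_of_mem_ball (toDisk_mem hv'))
    rw [div_le_div_iff₀ (by positivity) (by positivity)]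
    linarith
  -- If τ ≠ 1, then in the rotated coordinates the point 1 becomes a finite boundary point of the
  -- half-plane. There the shift by 1 keeps f bounded, contradicting f(1) = ∞.
  have hτ1 : τ = 1 := by
    by_contra hne
    have hτinv : τ⁻¹ ≠ 1 := fun h => hne (by rw [← inv_inv τ, h, inv_one])
    have hninv : ‖τ⁻¹‖ = 1 := by rw [norm_inv, hτ, inv_one]
    have hc1 : ContinuousAt (fun z : ℂ => toHalf (τ⁻¹ * z) + (1 : ℝ)) 1 := by
      have : (1 : ℂ) - τ⁻¹ * 1 ≠ 0 := by rw [mul_one, sub_ne_zero]; exact hτinv.symm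
      unfold toHalf
      fun_prop (disch := assumption)
    have hmem : toHalf (τ⁻¹ * 1) + (1 : ℝ) ∈ rightHalfPlane := by
      show 0 < (toHalf (τ⁻¹ * 1) + (1 : ℝ)).re
      rw [add_re, re_toHalf, mul_one, hninv]
      simp
    have hc2 : ContinuousAt (fun u => fτ (toDisk u)) (toHalf (τ⁻¹ * 1) + (1 : ℝ)) :=
      ((differentiableOn_comp_toDisk hfτ).differentiableAt
        (isOpen_rightHalfPlane.mem_nhds hmem)).continuousAt
    have hc3 := (((hc2.comp_of_eq hc1 rfl).sub (continuousAt_const (y := k))).norm.tendsto).mono_left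
      (nhdsWithin_le_nhds (s := Metric.ball (0 : ℂ) 1))
    refine not_tendsto_nhds_of_tendsto_atTop ?_ _ hc3
    have h2 : Tendsto (fun z => ‖f z‖ - ‖k‖) (𝓝[Metric.ball 0 1] 1) atTop :=
      tendsto_atTop_add_const_right _ _ (tendsto_norm_cobounded_atTop.comp h1)
    refine tendsto_atTop_mono' _ ?_ h2
    filter_upwards [self_mem_nhdsWithin] with z hz
    have hz' := rotate_mem_ball hninv hz
    have h3 := norm_sub_le_norm_add_sub (differentiableOn_comp_toDisk hfτ)
      (by rw [himg]; exact hk) hG (toHalf_mem hz') (t := 1) zero_le_one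
    have hz1 : τ⁻¹ * z ≠ 1 := fun h => one_sub_ne_zero_of_mem_ball hz' (by rw [h, sub_self])
    rw [toDisk_toHalf hz1] at h3
    simp only [fτ, mul_inv_cancel_left₀ h0] at h3
    refine (norm_sub_norm_le _ _).trans (h3.trans (le_of_eq ?_))
    simp [fτ]
  have := hG u hu
  simpa [fτ, hτ1] using this

/-! ### Nonnegativity of the real part of the pre-Schwarzian. -/

/-- Minimum principle for the real part, with lower bounds at the boundary of the disk. -/
theorem re_nonneg_of_boundary {m : ℂ → ℂ} (hm : DifferentiableOn ℂ m (Metric.ball 0 1))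
    (hb : ∀ ξ : ℂ, ‖ξ‖ = 1 → ∀ ε > 0, ∀ᶠ ζ in 𝓝[Metric.ball 0 1] ξ, -ε ≤ (m ζ).re) {z : ℂ}
    (hz : z ∈ Metric.ball (0 : ℂ) 1) : 0 ≤ (m z).re := by
  have key : ∀ ε > 0, -ε ≤ (m z).re := by
    intro ε hε
    obtain ⟨r, hr1, hr⟩ : ∃ r < 1, ∀ ζ ∈ Metric.ball (0 : ℂ) 1, r < ‖ζ‖ → -ε ≤ (m ζ).re := by
      by_contra! hcon
      have hlt : ∀ n : ℕ, 1 - 1 / ((n : ℝ) + 1) < 1 := fun n => by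
        have : 0 < 1 / ((n : ℝ) + 1) := by positivity
        linarith
      choose ζ hζ1 hζ2 hζ3 using fun n : ℕ => hcon _ (hlt n)
      obtain ⟨ξ, -, ψ, hψ, hξ⟩ := (isCompact_closedBall (0 : ℂ) 1).tendsto_subseq
        fun n => Metric.ball_subset_closedBall (hζ1 n)
      have hn : Tendsto (fun n => ‖ζ n‖) atTop (𝓝 1) := by
        refine tendsto_of_tendsto_of_tendsto_of_le_of_le
          (g := fun n : ℕ => 1 - 1 / ((n : ℝ) + 1)) ?_ tendsto_const_nhds
          (fun n => (hζ2 n).le) (fun n => (mem_ball_zero_iff.1 (hζ1 n)).le)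
        simpa using tendsto_one_div_add_atTop_nhds_zero_nat.const_sub (1 : ℝ)
      have hξ1 : ‖ξ‖ = 1 := tendsto_nhds_unique hξ.norm (hn.comp hψ.tendsto_atTop)
      have h2 : Tendsto (ζ ∘ ψ) atTop (𝓝[Metric.ball 0 1] ξ) :=
        tendsto_nhdsWithin_iff.2 ⟨hξ, Eventually.of_forall fun n => hζ1 _⟩
      obtain ⟨n, hn⟩ := (h2.eventually (hb ξ hξ1 ε hε)).exists
      exact absurd hn (not_le.2 (hζ3 _))
    rw [mem_ball_zero_iff] at hz
    let ρ := (1 + max r ‖z‖) / 2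
    have hmax : max r ‖z‖ < 1 := max_lt hr1 hz
    have hρ1 : ρ < 1 := by simp only [ρ]; linarith
    have hρ2 : max r ‖z‖ < ρ := by simp only [ρ]; linarith
    have hρ0 : ρ ≠ 0 := ((norm_nonneg z).trans_lt ((le_max_right _ _).trans_lt hρ2)).ne'
    have hd : DifferentiableOn ℂ (fun ζ => exp (-m ζ)) (Metric.ball 0 1) := hm.neg.cexp
    have hdc : DiffContOnCl ℂ (fun ζ => exp (-m ζ)) (Metric.ball 0 ρ) := by
      refine DifferentiableOn.diffContOnCl ?_
      rw [closure_ball _ hρ0]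
      exact hd.mono (Metric.closedBall_subset_ball hρ1)
    have h3 := norm_le_of_forall_mem_frontier_norm_le Metric.isBounded_ball hdc (C := Real.exp ε)
      (fun ζ hζ => by
        rw [frontier_ball _ hρ0, mem_sphere_zero_iff_norm] at hζ
        rw [norm_exp, Real.exp_le_exp, neg_re]
        have := hr ζ (by rw [mem_ball_zero_iff, hζ]; exact hρ1)
          (by rw [hζ]; exact (le_max_left _ _).trans_lt hρ2)
        linarith) (z := z) (subset_closure (by
          rw [mem_ball_zero_iff]; exact (le_max_right _ _).trans_lt hρ2))
    rw [norm_exp, Real.exp_le_exp, neg_re] at h3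
    linarith
  by_contra h
  have := key (-(m z).re / 2) (by linarith)
  linarith

/-- Since k is the point of a convex set nearest to F v, the image contains a half-plane with k on
its edge and F v at distance |F v - k| from it. Infinitesimal Schwarz–Pick for the inverse on this
half-plane is the estimate. -/
theorem norm_sub_div_deriv_le {F : ℂ → ℂ} (hF : DifferentiableOn ℂ F rightHalfPlane)
    (hi : Set.InjOn F rightHalfPlane) (hK : Convex ℝ (F '' rightHalfPlane)ᶜ) {k v : ℂ}
    (hv : v ∈ rightHalfPlane) (hk : k ∉ F '' rightHalfPlane)
    (hmin : ∀ k' ∉ F '' rightHalfPlane, ‖F v - k‖ ≤ ‖F v - k'‖) :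
    ‖(F v - k) / deriv F v‖ ≤ v.re := by
  obtain ⟨g, hgd, hg⟩ := exists_differentiableOn_leftInverse isOpen_rightHalfPlane hF hi
  have ho := isOpen_image_of_injOn isOpen_rightHalfPlane hF hi
  have hne0 : F v - k ≠ 0 := by rw [sub_ne_zero]; rintro rfl; exact hk ⟨v, hv, rfl⟩
  have hd : 0 < ‖F v - k‖ := norm_pos_iff.2 hne0
  have hd' : ((‖F v - k‖ : ℝ) : ℂ) ≠ 0 := ofReal_ne_zero.2 hd.ne'
  have hinner : ∀ k' ∉ F '' rightHalfPlane, inner ℝ (F v - k) (k' - k) ≤ 0 := by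
    refine (norm_eq_iInf_iff_real_inner_le_zero hK (v := k) hk).1 ?_
    have : Nonempty ((F '' rightHalfPlane)ᶜ : Set ℂ) := ⟨⟨k, hk⟩⟩
    refine le_antisymm (le_ciInf fun k' => hmin k' k'.2) ?_
    exact ciInf_le (f := fun w : ((F '' rightHalfPlane)ᶜ : Set ℂ) => ‖F v - w‖)
      ⟨0, by rintro _ ⟨x, rfl⟩; exact norm_nonneg _⟩ ⟨k, hk⟩
  have hin : ∀ p ∈ rightHalfPlane,
      k + (F v - k) / (‖F v - k‖ : ℝ) * p ∈ F '' rightHalfPlane := by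
    intro p hp
    by_contra hcon
    have h1 := hinner _ hcon
    have hp' : 0 < p.re := hp
    have h2 : inner ℝ (F v - k) (k + (F v - k) / (‖F v - k‖ : ℝ) * p - k) =
        ‖F v - k‖ * p.re := by
      rw [Complex.inner, add_sub_cancel_left]
      have : starRingEnd ℂ (F v - k) * ((F v - k) / (‖F v - k‖ : ℝ) * p) =
          ((‖F v - k‖ : ℝ) : ℂ) * p := by
        have h3 : (F v - k) * starRingEnd ℂ (F v - k) = ((‖F v - k‖ : ℝ) : ℂ) ^ 2 := mul_conj' _
        field_simp
        rw [h3]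
      rw [mul_comm ((F v - k) / _ * p), this, re_ofReal_mul]
    rw [h2] at h1
    have := mul_pos hd hp'
    linarith
  have hdr : ((‖F v - k‖ : ℝ) : ℂ) ∈ rightHalfPlane := by
    show 0 < ((‖F v - k‖ : ℝ) : ℂ).re
    rw [ofReal_re]; exact hd
  have hval : k + (F v - k) / (‖F v - k‖ : ℝ) * (‖F v - k‖ : ℝ) = F v := by
    rw [div_mul_cancel₀ _ hd']; ring
  have h4 := norm_deriv_mul_re_le (φ := fun p => g (k + (F v - k) / (‖F v - k‖ : ℝ) * p))
    (hgd.comp (by fun_prop) hin) (fun p hp => by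
      obtain ⟨x, hx, he⟩ := hin p hp
      show 0 ≤ (g _).re
      rw [← he, hg x hx]
      exact le_of_lt hx) hdr
  have h5 : HasDerivAt (fun p => g (k + (F v - k) / (‖F v - k‖ : ℝ) * p))
      (deriv g (F v) * ((F v - k) / (‖F v - k‖ : ℝ))) ((‖F v - k‖ : ℝ) : ℂ) := by
    have h6 : HasDerivAt g (deriv g (F v))
        (k + (F v - k) / (‖F v - k‖ : ℝ) * (‖F v - k‖ : ℝ)) := by
      rw [hval]; exact (hgd.differentiableAt (ho.mem_nhds ⟨v, hv, rfl⟩)).hasDerivAt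
    refine h6.comp (((‖F v - k‖ : ℝ) : ℂ)) ?_
    simpa using ((hasDerivAt_id ((‖F v - k‖ : ℝ) : ℂ)).const_mul
      ((F v - k) / (‖F v - k‖ : ℝ))).const_add k
  rw [h5.deriv, hval, hg v hv, ofReal_re, norm_mul, norm_div, norm_real, norm_norm,
    div_self hd.ne', mul_one,
    eq_inv_of_mul_eq_one_left (deriv_mul_deriv_leftInverse isOpen_rightHalfPlane hF hi hgd hg hv),
    norm_inv] at h4
  rw [norm_div, div_eq_inv_mul]
  exact h4

theorem differentiableOn_sub_div_deriv {F : ℂ → ℂ} (hF : DifferentiableOn ℂ F rightHalfPlane)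
    (hi : Set.InjOn F rightHalfPlane) (k : ℂ) :
    DifferentiableOn ℂ (fun u => (F u - k) / deriv F u) rightHalfPlane :=
  (hF.sub_const k).div (hF.deriv isOpen_rightHalfPlane) fun _ hu =>
    deriv_ne_zero_of_injOn isOpen_rightHalfPlane hF hi hu

/-- Equivalent to Re(1/G) ≥ Re(1/(u-b)) for G = (F u - k)/F'(u): a Julia inequality at a boundary
zero of the generator. Nothing is known about F' near b, so k is replaced by the omitted point κ n
nearest to F(v n). Its generator at v n is at most Re(v n), which cancels in Schwarz–Pick. -/
theorem re_mul_norm_sq_le_of_boundary_limit {F : ℂ → ℂ}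
    (hF : DifferentiableOn ℂ F rightHalfPlane) (hi : Set.InjOn F rightHalfPlane)
    (hK : Convex ℝ (F '' rightHalfPlane)ᶜ)
    (hG : ∀ k ∉ F '' rightHalfPlane, ∀ u ∈ rightHalfPlane, 0 ≤ ((F u - k) / deriv F u).re)
    {v : ℕ → ℂ} (hv : ∀ n, v n ∈ rightHalfPlane) {b k : ℂ} (hb : b.re = 0)
    (hvb : Tendsto v atTop (𝓝 b)) (hk : k ∉ F '' rightHalfPlane)
    (hFk : Tendsto (fun n => F (v n)) atTop (𝓝 k)) {u : ℂ} (hu : u ∈ rightHalfPlane) :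
    u.re * ‖(F u - k) / deriv F u‖ ^ 2 ≤ ((F u - k) / deriv F u).re * ‖u - b‖ ^ 2 := by
  have ho := isOpen_image_of_injOn isOpen_rightHalfPlane hF hi
  have hex : ∀ n, ∃ k' ∉ F '' rightHalfPlane, ∀ l ∉ F '' rightHalfPlane,
      ‖F (v n) - k'‖ ≤ ‖F (v n) - l‖ := by
    intro n
    obtain ⟨k', hk', he⟩ := ho.isClosed_compl.exists_infDist_eq_dist ⟨k, hk⟩ (F (v n))
    refine ⟨k', hk', fun l hl => ?_⟩
    rw [← dist_eq_norm, ← dist_eq_norm, ← he]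
    exact Metric.infDist_le_dist_of_mem hl
  choose κ hκ hmin using hex
  have hκk : Tendsto κ atTop (𝓝 k) := by
    have h1 : Tendsto (fun n => F (v n) - κ n) atTop (𝓝 0) := by
      rw [tendsto_zero_iff_norm_tendsto_zero]
      refine squeeze_zero (fun _ => norm_nonneg _) (fun n => hmin n k hk) ?_
      simpa using (hFk.sub_const k).norm
    simpa using hFk.sub h1
  have hre : Tendsto (fun n => (v n).re) atTop (𝓝 0) := by
    rw [← hb]; exact (continuous_re.tendsto b).comp hvb
  have hG0 : Tendsto (fun n => (F (v n) - κ n) / deriv F (v n)) atTop (𝓝 0) :=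
    squeeze_zero_norm (fun n => norm_sub_div_deriv_le hF hi hK (hv n) (hκ n) (hmin n)) hre
  have hG1 : Tendsto (fun n => (F u - κ n) / deriv F u) atTop (𝓝 ((F u - k) / deriv F u)) :=
    (hκk.const_sub _).div_const _
  have hineq : ∀ n, u.re * ‖(F u - κ n) / deriv F u - (F (v n) - κ n) / deriv F (v n)‖ ^ 2 ≤
      ((F u - κ n) / deriv F u).re * ‖u - v n‖ ^ 2 := by
    intro n
    have hp : 0 < (v n).re := hv n
    have h1 := schwarz_pick (differentiableOn_sub_div_deriv hF hi (κ n)) (hG _ (hκ n)) hu (hv n)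
    have h2 := (re_le_norm _).trans (norm_sub_div_deriv_le hF hi hK (hv n) (hκ n) (hmin n))
    have h3 : ‖u - v n‖ ^ 2 * (((F u - κ n) / deriv F u).re *
        ((F (v n) - κ n) / deriv F (v n)).re) ≤
        ‖u - v n‖ ^ 2 * (((F u - κ n) / deriv F u).re * (v n).re) :=
      mul_le_mul_of_nonneg_left (mul_le_mul_of_nonneg_left h2 (hG _ (hκ n) u hu)) (by positivity)
    refine le_of_mul_le_mul_right ?_ hp
    linarith
  have hlim := le_of_tendsto_of_tendsto' (((hG1.sub hG0).norm.pow 2).const_mul u.re)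
    (((continuous_re.tendsto _).comp hG1).mul ((hvb.const_sub u).norm.pow 2)) hineq
  simpa using hlim

theorem re_one_div (a : ℂ) : (1 / a).re = a.re / ‖a‖ ^ 2 := by
  rw [one_div, inv_re, normSq_eq_norm_sq]

/-- Differentiate F v = F u + (v-u) `dslope F u v` twice at u. -/
theorem deriv_dslope_self {F : ℂ → ℂ} {U : Set ℂ} (hU : IsOpen U) (hF : DifferentiableOn ℂ F U)
    {u : ℂ} (hu : u ∈ U) : deriv (deriv F) u = 2 * deriv (dslope F u) u := by
  have hD : DifferentiableOn ℂ (dslope F u) U := (differentiableOn_dslope (hU.mem_nhds hu)).2 hF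
  have hD' := hD.deriv hU
  have h1 : ∀ v ∈ U, deriv F v = dslope F u v + (v - u) * deriv (dslope F u) v := by
    intro v hv
    have h2 : HasDerivAt (fun v => F u + (v - u) * dslope F u v)
        (1 * dslope F u v + (v - u) * deriv (dslope F u) v) v :=
      (((hasDerivAt_id v).sub_const u).mul
        (hD.differentiableAt (hU.mem_nhds hv)).hasDerivAt).const_add _
    have h3 : F = fun v => F u + (v - u) * dslope F u v := by
      funext v
      have := sub_smul_dslope F u v
      rw [smul_eq_mul] at this
      rw [this]; ring
    rw [one_mul] at h2
    conv_lhs => rw [h3]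
    exact h2.deriv
  have h4 : HasDerivAt (fun v => dslope F u v + (v - u) * deriv (dslope F u) v)
      (deriv (dslope F u) u + (1 * deriv (dslope F u) u +
        (u - u) * deriv (deriv (dslope F u)) u)) u :=
    (hD.differentiableAt (hU.mem_nhds hu)).hasDerivAt.add
      (((hasDerivAt_id u).sub_const u).mul (hD'.differentiableAt (hU.mem_nhds hu)).hasDerivAt)
  have h5 := (h4.congr_of_eventuallyEq (f := fun v => dslope F u v + (v - u) * deriv (dslope F u) v)
    (f₁ := deriv F) (by filter_upwards [hU.mem_nhds hu] with v hv using h1 v hv)).deriv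
  rw [h5]; ring

theorem ne_one_of_mem_ball {z : ℂ} (hz : z ∈ Metric.ball (0 : ℂ) 1) : z ≠ 1 := fun h =>
  one_sub_ne_zero_of_mem_ball hz (by rw [h, sub_self])

/-- Otherwise the inverse would be a bounded entire function, hence constant by Liouville. -/
theorem exists_not_mem_image {f : ℂ → ℂ} (hf : DifferentiableOn ℂ f (Metric.ball 0 1))
    (hi : Set.InjOn f (Metric.ball 0 1)) : ∃ k, k ∉ f '' Metric.ball 0 1 := by
  by_contra! hcon
  have hcon' : f '' Metric.ball 0 1 = Set.univ := Set.eq_univ_of_forall hcon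
  obtain ⟨g, hgd, hg⟩ := exists_differentiableOn_leftInverse Metric.isOpen_ball hf hi
  rw [hcon', differentiableOn_univ] at hgd
  have hmem : ∀ w, g w ∈ Metric.ball (0 : ℂ) 1 := by
    intro w
    obtain ⟨z, hz, rfl⟩ := hcon w
    rwa [hg z hz]
  have hb : Bornology.IsBounded (Set.range g) :=
    Metric.isBounded_ball.subset (Set.range_subset_iff.2 hmem)
  have h0 : (0 : ℂ) ∈ Metric.ball (0 : ℂ) 1 := by simp
  have h1 : (1 / 2 : ℂ) ∈ Metric.ball (0 : ℂ) 1 := by simp; norm_num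
  have := hgd.apply_eq_apply_of_bounded hb (f 0) (f (1 / 2))
  rw [hg _ h0, hg _ h1] at this
  norm_num at this

/-- In half-plane coordinates the pre-Schwarzian of a concave univalent function has nonnegative
real part. -/
theorem re_preSchwarzian_nonneg {f : ℂ → ℂ} (hf : DifferentiableOn ℂ f (Metric.ball 0 1))
    (hi : Set.InjOn f (Metric.ball 0 1)) (hK : Convex ℝ (f '' Metric.ball 0 1)ᶜ)
    (h1 : Tendsto f (𝓝[Metric.ball 0 1] 1) (cobounded ℂ)) {u : ℂ} (hu : u ∈ rightHalfPlane) :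
    0 ≤ (preSchwarzian (fun u => f (toDisk u)) u).re := by
  set F : ℂ → ℂ := fun u => f (toDisk u) with hFdef
  have hFd : DifferentiableOn ℂ F rightHalfPlane := differentiableOn_comp_toDisk hf
  have hFi : Set.InjOn F rightHalfPlane := injOn_comp_toDisk hi
  have himg : F '' rightHalfPlane = f '' Metric.ball 0 1 := image_comp_toDisk f
  have hFK : Convex ℝ (F '' rightHalfPlane)ᶜ := by rw [himg]; exact hK
  have hG : ∀ k ∉ F '' rightHalfPlane, ∀ u ∈ rightHalfPlane,
      0 ≤ ((F u - k) / deriv F u).re := fun k hk u hu =>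
    re_sub_div_deriv_nonneg hf hi hK h1 (by rw [← himg]; exact hk) hu
  have hne := deriv_ne_zero_of_injOn isOpen_rightHalfPlane hFd hFi hu
  have hD : DifferentiableOn ℂ (dslope F u) rightHalfPlane :=
    (differentiableOn_dslope (isOpen_rightHalfPlane.mem_nhds hu)).2 hFd
  have hDD : DifferentiableOn ℂ (dslope (dslope F u) u) rightHalfPlane :=
    (differentiableOn_dslope (isOpen_rightHalfPlane.mem_nhds hu)).2 hD
  have hD0 : ∀ v ∈ rightHalfPlane, dslope F u v ≠ 0 := by
    intro v hv
    rcases eq_or_ne v u with rfl | h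
    · rwa [dslope_same]
    · rw [dslope_of_ne _ h, slope_def_field]
      exact div_ne_zero (sub_ne_zero.2 fun he => h (hFi hv hu he)) (sub_ne_zero.2 h)
  -- This is F'(u)/(F u - F v) - 1/(u - v), written with divided differences so that it is visibly
  -- holomorphic at v = u.
  let M : ℂ → ℂ := fun v => dslope (dslope F u) u v / dslope F u v
  have hMd : DifferentiableOn ℂ M rightHalfPlane := hDD.div hD hD0
  have hMu : M u = preSchwarzian F u / 2 := by
    simp only [M, dslope_same, preSchwarzian]
    rw [deriv_dslope_self isOpen_rightHalfPlane hFd hu]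
    ring
  have hMv : ∀ v ∈ rightHalfPlane, v ≠ u → M v = deriv F u / (F u - F v) - 1 / (u - v) := by
    intro v hv h
    have e1 : v - u ≠ 0 := sub_ne_zero.2 h
    have e2 : F v - F u ≠ 0 := sub_ne_zero.2 fun he => h (hFi hv hu he)
    have e3 : u - v ≠ 0 := sub_ne_zero.2 h.symm
    have e4 : F u - F v ≠ 0 := sub_ne_zero.2 fun he => h (hFi hv hu he.symm)
    simp only [M]
    rw [dslope_of_ne _ h, slope_def_field, dslope_same, dslope_of_ne _ h, slope_def_field]
    rw [← neg_sub (F v) (F u), ← neg_sub v u]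
    field_simp
    ring
  have key : 0 ≤ (M (toHalf (toDisk u))).re := by
    refine re_nonneg_of_boundary (m := fun ζ => M (toHalf ζ))
      (hMd.comp differentiableOn_toHalf fun _ h => toHalf_mem h) ?_ (toDisk_mem hu)
    intro ξ hξ ε hε
    by_contra hcon
    rw [not_eventually] at hcon
    obtain ⟨ζ, hζξ, hζb, hζu, hζ⟩ : ∃ ζ : ℕ → ℂ, Tendsto ζ atTop (𝓝[Metric.ball 0 1] ξ) ∧
        (∀ n, ζ n ∈ Metric.ball (0 : ℂ) 1) ∧ (∀ n, toHalf (ζ n) ≠ u) ∧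
        ∀ n, (M (toHalf (ζ n))).re < -ε := by
      have hne : ∀ᶠ ζ in 𝓝[Metric.ball 0 1] ξ, ζ ≠ toDisk u := by
        refine eventually_nhdsWithin_of_eventually_nhds (eventually_ne_nhds ?_)
        rintro rfl
        exact (mem_ball_zero_iff.1 (toDisk_mem hu)).ne hξ
      obtain ⟨ζ, hζξ, hζ⟩ := exists_seq_forall_of_frequently
        ((hcon.and_eventually hne).and_eventually self_mem_nhdsWithin)
      refine ⟨ζ, hζξ, fun n => (hζ n).2, fun n h => (hζ n).1.2 ?_, fun n => not_le.1 (hζ n).1.1⟩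
      rw [← h, toDisk_toHalf (ne_one_of_mem_ball (hζ n).2)]
    have hζξ' : Tendsto ζ atTop (𝓝 ξ) := hζξ.mono_right nhdsWithin_le_nhds
    have hFζ : ∀ n, F (toHalf (ζ n)) = f (ζ n) := fun n => by
      simp only [F, toDisk_toHalf (ne_one_of_mem_ball (hζb n))]
    have hMζ : ∀ n, M (toHalf (ζ n)) =
        deriv F u / (F u - f (ζ n)) - 1 / (u - toHalf (ζ n)) := fun n => by
      rw [hMv _ (toHalf_mem (hζb n)) (hζu n), hFζ]
    rcases eq_or_ne ξ 1 with rfl | hξ1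
    · have l1 : Tendsto (fun n => deriv F u / (F u - f (ζ n))) atTop (𝓝 0) := by
        have h2 : Tendsto (fun n => F u - f (ζ n)) atTop (cobounded ℂ) := by
          have := (tendsto_const_sub_cobounded (F u)).comp (h1.comp hζξ)
          exact this
        have := (tendsto_inv₀_cobounded.comp h2).const_mul (deriv F u)
        simpa [div_eq_mul_inv] using this
      have l2 : Tendsto (fun n => 1 / (u - toHalf (ζ n))) atTop (𝓝 0) := by
        have h2 : ∀ n, 1 / (u - toHalf (ζ n)) = (1 - ζ n) / (u * (1 - ζ n) - (1 + ζ n)) := by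
          intro n
          have h3 := one_sub_ne_zero_of_mem_ball (hζb n)
          have h4 : u - toHalf (ζ n) = (u * (1 - ζ n) - (1 + ζ n)) / (1 - ζ n) := by
            rw [toHalf]; field_simp
          rw [h4, one_div_div]
        simp only [h2]
        have h5 : Tendsto (fun n => (1 - ζ n) / (u * (1 - ζ n) - (1 + ζ n))) atTop
            (𝓝 ((1 - 1) / (u * (1 - 1) - (1 + 1)))) :=
          (hζξ'.const_sub 1).div (((hζξ'.const_sub 1).const_mul u).sub (hζξ'.const_add 1))
            (by norm_num)
        simpa using h5
      have l3 := (continuous_re.tendsto _).comp (l1.sub l2)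
      have l4 : (0 : ℝ) ≤ -ε := by
        refine le_of_tendsto' (x := atTop) (f := fun n => (M (toHalf (ζ n))).re) ?_
          fun n => (hζ n).le
        simpa [Function.comp_def, hMζ] using l3
      linarith
    · have hvb : Tendsto (fun n => toHalf (ζ n)) atTop (𝓝 (toHalf ξ)) := by
        have : ContinuousAt toHalf ξ := by
          have : 1 - ξ ≠ 0 := sub_ne_zero.2 hξ1.symm
          unfold toHalf
          fun_prop (disch := assumption)
        exact this.tendsto.comp hζξ'
      have hb0 : (toHalf ξ).re = 0 := by rw [re_toHalf, hξ]; simp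
      obtain ⟨k₀, hk₀⟩ := exists_not_mem_image hf hi
      rw [← himg] at hk₀
      -- F need not have a limit at the boundary point, but it is bounded there, so a subsequence of
      -- values converges. Its limit k is omitted, since the inverse is continuous on the image.
      have hbdd : IsBounded (Set.range fun n => F (toHalf (ζ n))) := by
        have hmem : toHalf ξ + (1 : ℝ) ∈ rightHalfPlane := by
          show 0 < (toHalf ξ + (1 : ℝ)).re
          rw [add_re, hb0]; simp
        have h2 : Tendsto (fun n => F (toHalf (ζ n) + (1 : ℝ)) - k₀) atTop
            (𝓝 (F (toHalf ξ + (1 : ℝ)) - k₀)) :=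
          (((hFd.differentiableAt (isOpen_rightHalfPlane.mem_nhds hmem)).continuousAt.tendsto.comp
            (hvb.add_const _))).sub_const _
        obtain ⟨C, hC⟩ := (Metric.isBounded_range_of_tendsto _ h2).exists_norm_le
        refine isBounded_iff_forall_norm_le.2 ⟨C + ‖k₀‖, ?_⟩
        rintro _ ⟨n, rfl⟩
        have h3 := hC _ ⟨n, rfl⟩
        have h4 := norm_sub_le_norm_add_sub hFd hk₀ (hG _ hk₀) (toHalf_mem (hζb n)) (t := 1)
          zero_le_one
        have h5 := norm_sub_norm_le (F (toHalf (ζ n))) k₀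
        dsimp only at h3 ⊢
        linarith
      obtain ⟨k, -, ψ, hψ, hk⟩ := tendsto_subseq_of_bounded hbdd fun n => ⟨n, rfl⟩
      have hvψ : Tendsto (fun n => toHalf (ζ (ψ n))) atTop (𝓝 (toHalf ξ)) :=
        hvb.comp hψ.tendsto_atTop
      have hkK : k ∉ F '' rightHalfPlane := by
        rintro ⟨x, hx, rfl⟩
        obtain ⟨g, hgd, hg⟩ := exists_differentiableOn_leftInverse isOpen_rightHalfPlane hFd hFi
        have ho := isOpen_image_of_injOn isOpen_rightHalfPlane hFd hFi
        have h2 := (hgd.differentiableAt (ho.mem_nhds ⟨x, hx, rfl⟩)).continuousAt.tendsto.comp hk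
        rw [hg x hx] at h2
        have h3 : Tendsto (fun n => toHalf (ζ (ψ n))) atTop (𝓝 x) := by
          refine h2.congr fun n => ?_
          exact hg _ (toHalf_mem (hζb _))
        have h4 := tendsto_nhds_unique h3 hvψ
        have hx' : 0 < x.re := hx
        rw [h4, hb0] at hx'
        exact lt_irrefl _ hx'
      have hmain := re_mul_norm_sq_le_of_boundary_limit hFd hFi hFK hG
        (fun n => toHalf_mem (hζb (ψ n))) hb0 hvψ hkK hk hu
      have hu' : 0 < u.re := hu
      have hub : 0 < ‖u - toHalf ξ‖ := by
        rw [norm_pos_iff]; intro h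
        have := congrArg re h
        rw [sub_re, hb0, zero_re] at this
        linarith
      have hFk : F u - k ≠ 0 := by rw [sub_ne_zero]; rintro rfl; exact hkK ⟨u, hu, rfl⟩
      have hGpos : 0 < ‖(F u - k) / deriv F u‖ := norm_pos_iff.2 (div_ne_zero hFk hne)
      have l1 : Tendsto (fun n => deriv F u / (F u - f (ζ (ψ n)))) atTop
          (𝓝 (deriv F u / (F u - k))) := by
        refine tendsto_const_nhds.div (Tendsto.const_sub _ ?_) hFk
        refine hk.congr fun n => ?_
        exact hFζ _
      have l2 : Tendsto (fun n => 1 / (u - toHalf (ζ (ψ n)))) atTop (𝓝 (1 / (u - toHalf ξ))) :=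
        tendsto_const_nhds.div (hvψ.const_sub u) (norm_pos_iff.1 hub)
      have l3 := (continuous_re.tendsto _).comp (l1.sub l2)
      have l4 : (deriv F u / (F u - k) - 1 / (u - toHalf ξ)).re ≤ -ε := by
        refine le_of_tendsto' (x := atTop) (f := fun n => (M (toHalf (ζ (ψ n)))).re) ?_
          fun n => (hζ _).le
        simpa [Function.comp_def, hMζ] using l3
      have h6 : deriv F u / (F u - k) = 1 / ((F u - k) / deriv F u) := by rw [one_div_div]
      rw [sub_re, h6, re_one_div, re_one_div, sub_re, hb0, sub_zero] at l4
      have h7 : u.re / ‖u - toHalf ξ‖ ^ 2 ≤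
          ((F u - k) / deriv F u).re / ‖(F u - k) / deriv F u‖ ^ 2 := by
        rw [div_le_div_iff₀ (by positivity) (by positivity)]
        exact hmain
      linarith
  rw [toHalf_toDisk hu, hMu] at key
  have e : (preSchwarzian F u / 2).re = (preSchwarzian F u).re / 2 := by simp
  rw [e] at key
  linarith

/-! ### Recession cones, opening angle and the enclosing sector. -/

/-- The recession cone of the set `K` at the point `k`. -/
def recessionCone (K : Set ℂ) (k : ℂ) : Set ℂ := {d | ∀ t : ℝ, 0 ≤ t → k + t * d ∈ K}

theorem smul_mem_recessionCone {K : Set ℂ} {k d : ℂ} (hd : d ∈ recessionCone K k) {r : ℝ}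
    (hr : 0 ≤ r) : (r : ℂ) * d ∈ recessionCone K k := by
  intro t ht
  have := hd (t * r) (mul_nonneg ht hr)
  rwa [ofReal_mul, mul_assoc] at this

theorem add_mem_recessionCone {K : Set ℂ} (hK : Convex ℝ K) {k d e : ℂ}
    (hd : d ∈ recessionCone K k) (he : e ∈ recessionCone K k) : d + e ∈ recessionCone K k := by
  intro t ht
  have := hK (hd (2 * t) (by positivity)) (he (2 * t) (by positivity)) (a := 1 / 2) (b := 1 / 2)
    (by norm_num) (by norm_num) (by norm_num)
  convert this using 1
  simp only [real_smul]
  push_cast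
  ring

theorem isClosed_recessionCone {K : Set ℂ} (hK : IsClosed K) (k : ℂ) :
    IsClosed (recessionCone K k) := by
  have : recessionCone K k = ⋂ t : ℝ, ⋂ _ : 0 ≤ t, (fun d : ℂ => k + t * d) ⁻¹' K := by
    ext d; simp [recessionCone]
  rw [this]
  exact isClosed_iInter fun t => isClosed_iInter fun _ => hK.preimage (by fun_prop)

/-- The point k + t d is the limit of the convex combinations (1 - t/R) k + (t/R)(R d). The base
point k does not matter in the limit, so circles about 0 suffice. -/
theorem mem_recessionCone_of_frequently {K : Set ℂ} (hK : Convex ℝ K) (hKc : IsClosed K) {k d : ℂ}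
    (hk : k ∈ K) (hd : ∃ᶠ R : ℝ in atTop, (R : ℂ) * d ∈ K) : d ∈ recessionCone K k := by
  intro t ht
  have hlim : Tendsto (fun R : ℝ => (1 - ((t / R : ℝ) : ℂ)) * k + (t : ℂ) * d) atTop
      (𝓝 ((1 - ((0 : ℝ) : ℂ)) * k + t * d)) := by
    have h1 : Tendsto (fun R : ℝ => t / R) atTop (𝓝 0) := tendsto_const_nhds.div_atTop tendsto_id
    exact ((((continuous_ofReal.tendsto 0).comp h1).const_sub 1).mul_const k).add_const _
  simp only [ofReal_zero, sub_zero, one_mul] at hlim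
  refine hKc.mem_of_frequently_of_tendsto ?_ hlim
  refine (hd.and_eventually ((eventually_ge_atTop t).and (eventually_gt_atTop 0))).mono ?_
  rintro R ⟨hR, hRt, hR0⟩
  have := hK hk hR (a := 1 - t / R) (b := t / R) (sub_nonneg.2 ((div_le_one hR0).2 hRt))
    (by positivity) (by ring)
  convert this using 1
  simp only [real_smul]
  have : (R : ℂ) ≠ 0 := ofReal_ne_zero.2 hR0.ne'
  push_cast
  field_simp

/-- The directions of a closed convex cone between two of its directions, less than `π` apart. -/
theorem exp_mem_recessionCone {K : Set ℂ} (hK : Convex ℝ K) {k : ℂ} {a b x : ℝ}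
    (ha : exp (a * I) ∈ recessionCone K k) (hb : exp (b * I) ∈ recessionCone K k)
    (hax : a ≤ x) (hxb : x ≤ b) (hab : b - a < Real.pi) : exp (x * I) ∈ recessionCone K k := by
  rcases eq_or_lt_of_le (hax.trans hxb) with h | h
  · have : x = a := by linarith
    rwa [this]
  have hs : 0 < Real.sin (b - a) := Real.sin_pos_of_pos_of_lt_pi (by linarith) hab
  have h1 : 0 ≤ Real.sin (b - x) := Real.sin_nonneg_of_nonneg_of_le_pi (by linarith) (by linarith)
  have h2 : 0 ≤ Real.sin (x - a) := Real.sin_nonneg_of_nonneg_of_le_pi (by linarith) (by linarith)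
  have key := add_mem_recessionCone hK
    (smul_mem_recessionCone ha (div_nonneg h1 hs.le))
    (smul_mem_recessionCone hb (div_nonneg h2 hs.le))
  have hc : exp (x * I) = ((Real.sin (b - x) / Real.sin (b - a) : ℝ) : ℂ) * exp (a * I) +
      ((Real.sin (x - a) / Real.sin (b - a) : ℝ) : ℂ) * exp (b * I) := by
    have hs' : ((Real.sin (b - a) : ℝ) : ℂ) ≠ 0 := ofReal_ne_zero.2 hs.ne'
    rw [ofReal_div, ofReal_div, div_mul_eq_mul_div, div_mul_eq_mul_div, ← add_div, eq_div_iff hs']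
    apply Complex.ext
    · simp only [mul_re, add_re, exp_ofReal_mul_I_re, exp_ofReal_mul_I_im, ofReal_re, ofReal_im,
        Real.sin_sub]
      have := Real.sin_sq_add_cos_sq a
      have := Real.sin_sq_add_cos_sq b
      ring
    · simp only [mul_im, add_im, exp_ofReal_mul_I_re, exp_ofReal_mul_I_im, ofReal_re, ofReal_im,
        Real.sin_sub]
      ring
  rwa [hc]

theorem measurableSet_exp_preimage {A : Set ℂ} (hA : MeasurableSet A) :
    MeasurableSet {t : ℝ | exp (t * I) ∈ A} :=
  (Continuous.measurable (by fun_prop : Continuous fun t : ℝ => exp (t * I))) hA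

theorem volume_exp_preimage_inter_Ioc {A : Set ℂ} (hA : MeasurableSet A) (a b : ℝ) :
    MeasureTheory.volume ({t : ℝ | exp (t * I) ∈ A} ∩ Set.Ioc a (a + 2 * Real.pi)) =
      MeasureTheory.volume ({t : ℝ | exp (t * I) ∈ A} ∩ Set.Ioc b (b + 2 * Real.pi)) := by
  refine (isAddFundamentalDomain_Ioc Real.two_pi_pos a).measure_set_eq
    (isAddFundamentalDomain_Ioc Real.two_pi_pos b) (measurableSet_exp_preimage hA) ?_
  rintro ⟨g, hg⟩
  obtain ⟨n, rfl⟩ := AddSubgroup.mem_zmultiples_iff.1 hg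
  ext t
  have : exp (((n • (2 * Real.pi) + t : ℝ) : ℂ) * I) = exp (t * I) := by
    have h := exp_periodic.int_mul n (t * I)
    rw [← h]
    congr 1
    push_cast [zsmul_eq_mul]
    ring
  simp only [Set.mem_preimage, Set.mem_ofPred_eq, AddSubgroup.vadd_def, vadd_eq_add, this]

/-- A convex cone other than the plane with angular measure at least `2η` contains a closed sector
of half-angle `η`. -/
theorem exists_sector_subset_recessionCone {K : Set ℂ} (hK : Convex ℝ K) (hKc : IsClosed K) {k : ℂ}
    (hne : K ≠ Set.univ) {η : ℝ} (hη : 0 < η)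
    (hvol : ENNReal.ofReal (2 * η) ≤ MeasureTheory.volume
      ({t : ℝ | exp (t * I) ∈ recessionCone K k} ∩ Set.Ioc (-Real.pi) Real.pi)) :
    ∃ c : ℝ, ∀ s : ℝ, |s| ≤ η → exp ((c + s : ℝ) * I) ∈ recessionCone K k := by
  set C := recessionCone K k with hC
  have hCc : IsClosed C := isClosed_recessionCone hKc k
  obtain ⟨w, hw⟩ := (Set.ne_univ_iff_exists_notMem K).1 hne
  set θ := arg (w - k) with hθ
  have hθC : exp (θ * I) ∉ C := by
    intro h
    have := h ‖w - k‖ (norm_nonneg _)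
    rw [norm_mul_exp_arg_mul_I] at this
    exact hw (by simpa using this)
  have h2π : exp ((θ + 2 * Real.pi : ℝ) * I) = exp (θ * I) := by
    push_cast
    rw [add_mul, exp_add, exp_two_pi_mul_I, mul_one]
  have hper := volume_exp_preimage_inter_Ioc hCc.measurableSet (-Real.pi) θ
  rw [show -Real.pi + 2 * Real.pi = Real.pi by ring] at hper
  rw [hper] at hvol
  set A := {t : ℝ | exp (t * I) ∈ C} ∩ Set.Ioc θ (θ + 2 * Real.pi) with hA
  have hAlt : ∀ t ∈ A, t < θ + 2 * Real.pi := by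
    intro t ht
    refine lt_of_le_of_ne ht.2.2 ?_
    rintro rfl
    exact hθC (h2π ▸ ht.1)
  -- If t - s > π, then t and s + 2π are less than π apart, and the cone would contain the direction
  -- θ + 2π between them.
  have hdist : ∀ s ∈ A, ∀ t ∈ A, t - s ≤ Real.pi := by
    intro s hs t ht
    by_contra hcon
    have h1 := hAlt t ht
    have h2 := hs.2.1
    have h3 : exp ((s + 2 * Real.pi : ℝ) * I) ∈ C := by
      push_cast
      rw [add_mul, exp_add, exp_two_pi_mul_I, mul_one]
      exact hs.1
    refine hθC (h2π ▸ exp_mem_recessionCone hK ht.1 h3 h1.le (by linarith) (by linarith))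
  have hpos : MeasureTheory.volume A ≠ 0 := by
    refine (lt_of_lt_of_le ?_ hvol).ne'
    simpa using hη
  have hAne : A.Nonempty := by
    rw [Set.nonempty_iff_ne_empty]
    intro h
    rw [h] at hpos
    simp at hpos
  have hbb : BddBelow A := ⟨θ, fun t ht => ht.2.1.le⟩
  have hba : BddAbove A := ⟨θ + 2 * Real.pi, fun t ht => ht.2.2⟩
  have hsub : A ⊆ Set.Icc (sInf A) (sSup A) := fun t ht => ⟨csInf_le hbb ht, le_csSup hba ht⟩
  have hlen : 2 * η ≤ sSup A - sInf A := by
    have := hvol.trans (MeasureTheory.measure_mono hsub)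
    rw [Real.volume_Icc] at this
    exact (ENNReal.ofReal_le_ofReal_iff'.1 this).resolve_right (by linarith)
  have hIoo : Set.Ioo (sInf A) (sSup A) ⊆ {t : ℝ | exp (t * I) ∈ C} := by
    intro x hx
    obtain ⟨s, hs, hsx⟩ := exists_lt_of_csInf_lt hAne hx.1
    obtain ⟨t, ht, hxt⟩ := exists_lt_of_lt_csSup hAne hx.2
    rcases lt_or_eq_of_le (hdist s hs t ht) with h | h
    · exact exp_mem_recessionCone hK hs.1 ht.1 hsx.le hxt.le h
    -- Opposite directions do not span the directions between them. Positive measure supplies a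
    -- third one, which splits the half-turn.
    · have : ∃ r ∈ A, r ≠ s ∧ r ≠ t := by
        by_contra! hcon
        have h1 : A ⊆ {s, t} := fun r hr => by
          rcases eq_or_ne r s with h | h
          · exact Or.inl h
          · exact Or.inr (hcon r hr h)
        exact hpos (MeasureTheory.measure_mono_null h1 ((Set.toFinite _).measure_zero _))
      obtain ⟨r, hr, hrs, hrt⟩ := this
      have h1 := hdist s hs r hr
      have h2 := hdist r hr t ht
      have h3 : s < r := lt_of_le_of_ne (by linarith) hrs.symm
      have h4 : r < t := lt_of_le_of_ne (by linarith) hrt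
      rcases le_total x r with h5 | h5
      · exact exp_mem_recessionCone hK hs.1 hr.1 hsx.le h5 (by linarith)
      · exact exp_mem_recessionCone hK hr.1 ht.1 h5 hxt.le (by linarith)
  have hIcc : Set.Icc (sInf A) (sSup A) ⊆ {t : ℝ | exp (t * I) ∈ C} := by
    rw [← closure_Ioo (by linarith)]
    exact (IsClosed.closure_subset_iff (hCc.preimage (by fun_prop))).2 hIoo
  refine ⟨(sInf A + sSup A) / 2, fun s hs => hIcc ⟨?_, ?_⟩⟩
  · have := (abs_le.1 hs).1; linarith
  · have := (abs_le.1 hs).2; linarith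

/-- The part of the angular interval `(-π, π]` where the circle of radius `R` lies in `Ω`. -/
def circleAngles (Ω : Set ℂ) (R : ℝ) : Set ℝ :=
  {t : ℝ | t ∈ Set.Ioc (-Real.pi) Real.pi ∧ (R : ℂ) * exp ((t : ℂ) * I) ∈ Ω}

theorem measurableSet_circleAngles {Ω : Set ℂ} (hΩ : MeasurableSet Ω) (R : ℝ) :
    MeasurableSet (circleAngles Ω R) := measurableSet_Ioc.inter
  ((Continuous.measurable (by fun_prop : Continuous fun t : ℝ => (R : ℂ) * exp (t * I))) hΩ)

/-- Fatou's lemma for the indicator functions. -/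
theorem volume_le_liminf_circleAngles {Ω : Set ℂ} (hΩ : MeasurableSet Ω) {ι : Type*} {l : Filter ι}
    [l.IsCountablyGenerated] {r : ι → ℝ} {E : Set ℝ} (hE : MeasurableSet E)
    (hEl : ∀ t ∈ E, ∀ᶠ i in l, t ∈ circleAngles Ω (r i)) :
    MeasureTheory.volume E ≤
      liminf (fun i => MeasureTheory.volume (circleAngles Ω (r i))) l := by
  have h1 := MeasureTheory.lintegral_liminf_le (μ := MeasureTheory.volume) (u := l)
    (f := fun i => (circleAngles Ω (r i)).indicator (1 : ℝ → ENNReal)) fun i =>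
      measurable_one.indicator (measurableSet_circleAngles hΩ _)
  have h2 : ∀ i, ∫⁻ t, (circleAngles Ω (r i)).indicator (1 : ℝ → ENNReal) t =
      MeasureTheory.volume (circleAngles Ω (r i)) :=
    fun i => MeasureTheory.lintegral_indicator_one (measurableSet_circleAngles hΩ _)
  simp only [h2] at h1
  refine le_trans ?_ h1
  rw [← MeasureTheory.lintegral_indicator_one hE]
  refine MeasureTheory.lintegral_mono fun t => ?_
  by_cases ht : t ∈ E
  · rw [Set.indicator_of_mem ht]
    refine le_liminf_of_le (by isBoundedDefault) ?_
    filter_upwards [hEl t ht] with i hi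
    rw [Set.indicator_of_mem hi]
  · rw [Set.indicator_of_notMem ht]
    exact zero_le

/-- Along a direction outside the cone, large circles eventually lie in Ω, so by Fatou these
directions have measure at most the opening angle. -/
theorem volume_recessionCone_ge {Ω : Set ℂ} (hΩ : IsOpen Ω) (hK : Convex ℝ Ωᶜ) {k : ℂ}
    (hk : k ∉ Ω) {α : ℝ} (hα : 0 ≤ α)
    (hang : openingAngleAtInfinity Ω ≤ ENNReal.ofReal (Real.pi * α)) :
    ENNReal.ofReal (Real.pi * (2 - α)) ≤ MeasureTheory.volume
      ({t : ℝ | exp (t * I) ∈ recessionCone Ωᶜ k} ∩ Set.Ioc (-Real.pi) Real.pi) := by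
  set A := {t : ℝ | exp (t * I) ∈ recessionCone Ωᶜ k} ∩ Set.Ioc (-Real.pi) Real.pi
  have hE : MeasurableSet (Set.Ioc (-Real.pi) Real.pi \ A) := measurableSet_Ioc.diff
    ((measurableSet_exp_preimage (isClosed_recessionCone hΩ.isClosed_compl k).measurableSet).inter
      measurableSet_Ioc)
  have h1 : MeasureTheory.volume (Set.Ioc (-Real.pi) Real.pi \ A) ≤
      ENNReal.ofReal (Real.pi * α) := by
    refine (volume_le_liminf_circleAngles hΩ.measurableSet (l := atTop) (r := id) hE ?_).trans
      (le_trans liminf_le_limsup hang)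
    rintro t ⟨ht, htA⟩
    by_contra hcon
    refine htA ⟨mem_recessionCone_of_frequently hK hΩ.isClosed_compl hk ?_, ht⟩
    rw [not_eventually] at hcon
    exact hcon.mono fun R hR hmem => hR ⟨ht, hmem⟩
  have hsub : Set.Ioc (-Real.pi) Real.pi ⊆ (Set.Ioc (-Real.pi) Real.pi \ A) ∪ A := fun t ht => by
    by_cases h : t ∈ A
    · exact Or.inr h
    · exact Or.inl ⟨ht, h⟩
  have h2 := (MeasureTheory.measure_mono (μ := MeasureTheory.volume) hsub).trans
    (MeasureTheory.measure_union_le _ A)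
  rw [Real.volume_Ioc] at h2
  have h3 : ENNReal.ofReal (Real.pi * (2 - α)) =
      ENNReal.ofReal (Real.pi - -Real.pi) - ENNReal.ofReal (Real.pi * α) := by
    rw [← ENNReal.ofReal_sub _ (by positivity)]
    congr 1; ring
  rw [h3, tsub_le_iff_left]
  exact h2.trans (by gcongr)

/-- If the complement were bounded, the inverse would extend over ∞ with value 1 there, against the
maximum principle. This serves α = 2, where the angle hypothesis is void. -/
theorem not_isBounded_compl_image {f : ℂ → ℂ} (hf : DifferentiableOn ℂ f (Metric.ball 0 1))
    (hi : Set.InjOn f (Metric.ball 0 1))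
    (h1 : Tendsto f (𝓝[Metric.ball 0 1] 1) (cobounded ℂ)) :
    ¬ IsBounded (f '' Metric.ball 0 1)ᶜ := by
  intro hb
  obtain ⟨g, hgd, hg⟩ := exists_differentiableOn_leftInverse Metric.isOpen_ball hf hi
  have ho := isOpen_image_of_injOn Metric.isOpen_ball hf hi
  have hev : ∀ᶠ ζ in 𝓝[≠] (0 : ℂ), ζ⁻¹ ∈ f '' Metric.ball 0 1 := by
    have h2 : (f '' Metric.ball 0 1) ∈ cobounded ℂ := by
      have := isBounded_def.1 hb
      rwa [compl_compl] at this
    exact tendsto_inv₀_nhdsNE_zero.eventually h2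
  let h : ℂ → ℂ := fun ζ => g ζ⁻¹
  have hball : ∀ᶠ ζ in 𝓝[≠] (0 : ℂ), h ζ ∈ Metric.ball (0 : ℂ) 1 := by
    filter_upwards [hev] with ζ hζ
    obtain ⟨z, hz, he⟩ := hζ
    simp only [h]
    rwa [← he, hg z hz]
  have hdiff : ∀ᶠ ζ in 𝓝[≠] (0 : ℂ), DifferentiableAt ℂ h ζ := by
    filter_upwards [hev, self_mem_nhdsWithin] with ζ hζ hζ0
    exact (hgd.differentiableAt (ho.mem_nhds hζ)).comp ζ (differentiableAt_inv hζ0)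
  have hlim := tendsto_limUnder_of_differentiable_on_punctured_nhds_of_bounded_under hdiff
    ⟨1 + ‖h 0‖, by
      rw [eventually_map]
      filter_upwards [hball] with ζ hζ
      rw [mem_ball_zero_iff] at hζ
      exact (norm_sub_le _ _).trans (by linarith)⟩
  set L := limUnder (𝓝[≠] (0 : ℂ)) h
  have hL : L = 1 := by
    have h2 : Tendsto (fun z => (f z)⁻¹) (𝓝[Metric.ball 0 1] 1) (𝓝[≠] 0) := by
      refine tendsto_nhdsWithin_iff.2 ⟨tendsto_inv₀_cobounded.comp h1, ?_⟩
      have h3 : ({0}ᶜ : Set ℂ) ∈ cobounded ℂ := isBounded_def.1 isBounded_singleton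
      filter_upwards [h1.eventually h3] with z hz
      exact inv_ne_zero hz
    have h3 : Tendsto (fun z : ℂ => z) (𝓝[Metric.ball 0 1] 1) (𝓝 L) := by
      refine (hlim.comp h2).congr' ?_
      filter_upwards [self_mem_nhdsWithin] with z hz
      simp only [h, Function.comp, inv_inv, hg z hz]
    exact tendsto_nhds_unique h3 nhdsWithin_le_nhds
  let H := Function.update h 0 1
  have hHh : ∀ ζ, ζ ≠ 0 → H ζ = h ζ := fun ζ hζ => Function.update_of_ne hζ _ _
  have hH0 : H 0 = 1 := Function.update_self _ _ _
  have hHc : ContinuousAt H 0 := by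
    rw [continuousAt_update_same]; rw [← hL]; exact hlim
  have hHd : ∀ᶠ ζ in 𝓝[≠] (0 : ℂ), DifferentiableAt ℂ H ζ := by
    filter_upwards [hdiff, self_mem_nhdsWithin] with ζ hζ hζ0
    refine hζ.congr_of_eventuallyEq ?_
    filter_upwards [isOpen_ne.mem_nhds hζ0] with x hx using hHh x hx
  have hHa : AnalyticAt ℂ H 0 :=
    analyticAt_of_differentiable_on_punctured_nhds_of_continuousAt hHd hHc
  have hmax : IsLocalMax (norm ∘ H) 0 := by
    have := eventually_nhdsWithin_iff.1 hball
    filter_upwards [this] with ζ hζ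
    rcases eq_or_ne ζ 0 with rfl | hne
    · rfl
    · simp only [Function.comp, hHh ζ hne, hH0, norm_one]
      exact (mem_ball_zero_iff.1 (hζ hne)).le
  have h5 := eventually_eq_of_isLocalMax_norm
    (hHa.eventually_analyticAt.mono fun _ h => h.differentiableAt) hmax
  have h6 := (h5.filter_mono nhdsWithin_le_nhds).and (hball.and self_mem_nhdsWithin)
  obtain ⟨ζ, h7, h8, h9⟩ := h6.exists
  rw [hHh ζ h9, hH0] at h7
  rw [h7] at h8
  simp at h8

theorem exists_mem_recessionCone {K : Set ℂ} (hK : Convex ℝ K) (hKc : IsClosed K) {k : ℂ}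
    (hk : k ∈ K) (hb : ¬ IsBounded K) : ∃ d ∈ recessionCone K k, ‖d‖ = 1 := by
  have hex : ∀ n : ℕ, ∃ x ∈ K, (n : ℝ) < ‖x - k‖ := by
    intro n
    by_contra! hcon
    refine hb (isBounded_iff_forall_norm_le.2 ⟨n + ‖k‖, fun x hx => ?_⟩)
    have h1 := hcon x hx
    have h2 := norm_sub_norm_le x k
    linarith
  choose x hx hxn using hex
  have hpos : ∀ n, 0 < ‖x n - k‖ := fun n => (Nat.cast_nonneg n).trans_lt (hxn n)
  have hpos' : ∀ n, ((‖x n - k‖ : ℝ) : ℂ) ≠ 0 := fun n => ofReal_ne_zero.2 (hpos n).ne'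
  obtain ⟨d, hd, ψ, hψ, hlim⟩ := (isCompact_sphere (0 : ℂ) 1).tendsto_subseq
    (x := fun n => (x n - k) / (‖x n - k‖ : ℝ)) fun n => by
      rw [mem_sphere_zero_iff_norm, norm_div, norm_real, norm_norm, div_self (hpos n).ne']
  refine ⟨d, fun t ht => ?_, by simpa using hd⟩
  refine hKc.mem_of_tendsto ((hlim.const_mul (t : ℂ)).const_add k) ?_
  have htop : Tendsto (fun n => ‖x (ψ n) - k‖) atTop atTop :=
    tendsto_atTop_mono (fun n => (hxn (ψ n)).le)
      (tendsto_natCast_atTop_atTop.comp hψ.tendsto_atTop)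
  filter_upwards [htop.eventually_ge_atTop t] with n hn
  have := hK hk (hx (ψ n)) (a := 1 - t / ‖x (ψ n) - k‖) (b := t / ‖x (ψ n) - k‖)
    (sub_nonneg.2 ((div_le_one (hpos _)).2 hn)) (div_nonneg ht (hpos _).le) (by ring)
  convert this using 1
  simp only [real_smul, Function.comp]
  have := hpos' (ψ n)
  push_cast
  field_simp
  ring

/-- The image of a function in `Co(α)` lies in a sector of opening `πα`. -/
theorem IsConcaveUnivalent.exists_sector {α : ℝ} (hα : α ∈ Set.Ioc (1 : ℝ) 2) {f : ℂ → ℂ}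
    (h : IsConcaveUnivalent α f) : ∃ k ∉ f '' Metric.ball 0 1, ∃ τ : ℂ, τ ≠ 0 ∧
      ∀ w ∈ f '' Metric.ball 0 1, |arg (τ * (w - k))| < Real.pi * α / 2 := by
  obtain ⟨k, hk⟩ := exists_not_mem_image h.analytic h.injective
  have ho := isOpen_image_of_injOn Metric.isOpen_ball h.analytic h.injective
  refine ⟨k, hk, ?_⟩
  have hex : ∃ c : ℝ, ∀ s : ℝ, |s| ≤ Real.pi * (2 - α) / 2 →
      exp ((c + s : ℝ) * I) ∈ recessionCone (f '' Metric.ball 0 1)ᶜ k := by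
    rcases eq_or_lt_of_le hα.2 with rfl | hα2
    · obtain ⟨d, hd, hd1⟩ := exists_mem_recessionCone h.convex_compl ho.isClosed_compl hk
        (not_isBounded_compl_image h.analytic h.injective h.map_one)
      refine ⟨arg d, fun s hs => ?_⟩
      have : s = 0 := by simpa using hs
      rw [this, add_zero]
      have h2 := norm_mul_exp_arg_mul_I d
      rw [hd1, ofReal_one, one_mul] at h2
      rwa [h2]
    · refine exists_sector_subset_recessionCone h.convex_compl ho.isClosed_compl ?_ ?_ ?_
      · intro h2
        have : f 0 ∈ (f '' Metric.ball 0 1)ᶜ := by rw [h2]; trivial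
        exact this ⟨0, by simp, rfl⟩
      · have := Real.pi_pos
        have : 0 < 2 - α := by linarith
        positivity
      · have := volume_recessionCone_ge ho h.convex_compl hk (by linarith [hα.1])
          h.opening_angle_le
        rwa [mul_div_cancel₀ _ (two_ne_zero)]
  obtain ⟨c, hc⟩ := hex
  -- This rotation takes the axis of the omitted sector to the negative real axis.
  refine ⟨exp (((Real.pi - c : ℝ) : ℂ) * I), exp_ne_zero _, fun w hw => ?_⟩
  by_contra! hcon
  set ν := exp (((Real.pi - c : ℝ) : ℂ) * I) * (w - k) with hν
  have hwν : w - k = ‖ν‖ * exp ((arg ν - Real.pi + c : ℝ) * I) := by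
    have h2 : w - k = exp (-(((Real.pi - c : ℝ) : ℂ) * I)) * ν := by
      rw [hν, ← mul_assoc, ← exp_add]; simp
    rw [h2]
    nth_rewrite 1 [← norm_mul_exp_arg_mul_I ν]
    rw [mul_left_comm, ← exp_add]
    congr 2
    push_cast
    ring
  have hmem : exp ((arg ν - Real.pi + c : ℝ) * I) ∈ recessionCone (f '' Metric.ball 0 1)ᶜ k := by
    have h3 := arg_le_pi ν
    have h4 := neg_pi_lt_arg ν
    rcases le_total 0 (arg ν) with h5 | h5
    · rw [abs_of_nonneg h5] at hcon
      have := hc (arg ν - Real.pi) (by rw [abs_le]; constructor <;> linarith)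
      rwa [add_comm c] at this
    · rw [abs_of_nonpos h5] at hcon
      have := hc (arg ν + Real.pi) (by rw [abs_le]; constructor <;> linarith)
      have e : exp ((arg ν - Real.pi + c : ℝ) * I) = exp ((c + (arg ν + Real.pi) : ℝ) * I) := by
        rw [← exp_periodic]
        congr 1
        push_cast
        ring
      rwa [e]
  have := hmem ‖ν‖ (norm_nonneg _)
  rw [← hwν, add_sub_cancel] at this
  exact this hw

/-! ### Growth at infinity, Julia's inequality and the sharp bound. -/

theorem eq_of_re_nonneg_of_re_eq_zero {φ : ℂ → ℂ} (hd : DifferentiableOn ℂ φ rightHalfPlane)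
    (hm : ∀ u ∈ rightHalfPlane, 0 ≤ (φ u).re) {u₀ u : ℂ} (hu₀ : u₀ ∈ rightHalfPlane)
    (h0 : (φ u₀).re = 0) (hu : u ∈ rightHalfPlane) : φ u = φ u₀ := by
  have h1 := schwarz_pick hd hm hu hu₀
  rw [h0, mul_zero, mul_zero] at h1
  have hu' : 0 < u.re := hu
  have hu₀' : 0 < u₀.re := hu₀
  have h2 : ‖φ u - φ u₀‖ ^ 2 ≤ 0 := le_of_mul_le_mul_right (by simpa using h1) (mul_pos hu' hu₀')
  have h3 : ‖φ u - φ u₀‖ = 0 := by nlinarith [norm_nonneg (φ u - φ u₀)]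
  exact sub_eq_zero.1 (norm_eq_zero.1 h3)

theorem re_cpow_pos {w : ℂ} (hw : w ≠ 0) {r : ℝ} (h : |arg w * r| < Real.pi / 2) :
    0 < (w ^ (r : ℂ)).re := by
  rw [cpow_def_of_ne_zero hw, exp_re]
  refine mul_pos (Real.exp_pos _) (Real.cos_pos_of_mem_Ioo ?_)
  rw [im_mul_ofReal, log_im]
  exact abs_lt.1 h

theorem norm_le_mul_of_re_pos {g : ℂ → ℂ} (hd : DifferentiableOn ℂ g rightHalfPlane)
    (hm : ∀ u ∈ rightHalfPlane, 0 < (g u).re) {x : ℝ} (hx : 1 ≤ x) :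
    ‖g x‖ ≤ 4 * ‖g 1‖ * x := by
  have h1m : (1 : ℂ) ∈ rightHalfPlane := by simp [rightHalfPlane]
  have hxm : (x : ℂ) ∈ rightHalfPlane := by
    show 0 < (x : ℂ).re
    rw [ofReal_re]; linarith
  have h1 := schwarz_pick_of_pos hd hm hxm h1m
  have h2 := norm_sub_norm_le (g x) (g 1)
  have h3 : ‖(x : ℂ) - 1‖ = x - 1 := by
    rw [← ofReal_one, ← ofReal_sub, norm_real, Real.norm_of_nonneg (by linarith)]
  rw [h3, ofReal_re, one_re, mul_one] at h1
  by_contra! hcon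
  have p1 : 0 ≤ ‖g 1‖ := norm_nonneg _
  have p0 : 0 < ‖g x‖ := lt_of_le_of_lt (by positivity) hcon
  have h4 : 2 * ‖g 1‖ ≤ ‖g x‖ := by nlinarith
  have h5 : ‖g x‖ ^ 2 / 4 ≤ ‖g x - g 1‖ ^ 2 := by nlinarith
  have h6 : (g x).re * (g 1).re ≤ ‖g x‖ * ‖g 1‖ :=
    mul_le_mul (re_le_norm _) (re_le_norm _) (hm _ h1m).le p0.le
  have h7 : (x - 1) ^ 2 * ((g x).re * (g 1).re) ≤ x ^ 2 * (‖g x‖ * ‖g 1‖) :=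
    mul_le_mul (by nlinarith) h6 (mul_pos (hm _ hxm) (hm _ h1m)).le (by positivity)
  have h8 : ‖g x‖ ^ 2 / 4 * x ≤ x ^ 2 * (‖g x‖ * ‖g 1‖) := by nlinarith
  have h9 : (‖g x‖ * x) * ‖g x‖ ≤ (‖g x‖ * x) * (4 * ‖g 1‖ * x) := by nlinarith
  exact absurd (le_of_mul_le_mul_left h9 (by positivity)) (not_le.2 hcon)

/-- Logarithmic derivative and growth bounds for functions with values in a sector. -/
theorem bounds_of_sector {F : ℂ → ℂ} (hF : DifferentiableOn ℂ F rightHalfPlane) {α : ℝ}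
    (hα : α ∈ Set.Ioc (1 : ℝ) 2) {k τ : ℂ} (hτ : τ ≠ 0) (hk : ∀ u ∈ rightHalfPlane, F u ≠ k)
    (hsec : ∀ u ∈ rightHalfPlane, |arg (τ * (F u - k))| < Real.pi * α / 2) :
    (∀ u ∈ rightHalfPlane, ‖deriv F u‖ * u.re ≤ α * ‖F u - k‖) ∧
      ∃ C > 0, ∀ x : ℝ, 1 ≤ x → ‖F x - k‖ ≤ C * x ^ α := by
  have hα0 : 0 < α := by linarith [hα.1]
  let w : ℂ → ℂ := fun u => τ * (F u - k)
  -- The α-th root opens the sector to the right half-plane, where Schwarz–Pick controls both g'/g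
  -- and the growth of g.
  let g : ℂ → ℂ := fun u => w u ^ ((α⁻¹ : ℝ) : ℂ)
  have hw0 : ∀ u ∈ rightHalfPlane, w u ≠ 0 := fun u hu =>
    mul_ne_zero hτ (sub_ne_zero.2 (hk u hu))
  have hslit : ∀ u ∈ rightHalfPlane, w u ∈ slitPlane := by
    intro u hu
    rw [mem_slitPlane_iff_arg]
    refine ⟨fun h => ?_, hw0 u hu⟩
    have := hsec u hu
    rw [show τ * (F u - k) = w u from rfl, h, abs_of_pos Real.pi_pos] at this
    nlinarith [Real.pi_pos, hα.2]
  have hwd : ∀ u ∈ rightHalfPlane, HasDerivAt w (τ * deriv F u) u := fun u hu =>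
    ((hF.differentiableAt (isOpen_rightHalfPlane.mem_nhds hu)).hasDerivAt.sub_const k).const_mul τ
  have hgd : ∀ u ∈ rightHalfPlane, HasDerivAt g
      (((α⁻¹ : ℝ) : ℂ) * w u ^ (((α⁻¹ : ℝ) : ℂ) - 1) * (τ * deriv F u)) u := fun u hu =>
    (hwd u hu).cpow_const (hslit u hu)
  have hgD : DifferentiableOn ℂ g rightHalfPlane := fun u hu =>
    (hgd u hu).differentiableAt.differentiableWithinAt
  have hgm : ∀ u ∈ rightHalfPlane, 0 < (g u).re := by
    intro u hu
    refine re_cpow_pos (hw0 u hu) ?_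
    rw [abs_mul, abs_of_pos (inv_pos.2 hα0), ← div_eq_mul_inv, div_lt_iff₀ hα0]
    have := hsec u hu
    linarith
  refine ⟨fun u hu => ?_, ‖τ‖⁻¹ * (4 * ‖g 1‖) ^ α, ?_, fun x hx => ?_⟩
  · have h1 := norm_deriv_mul_re_le hgD (fun u hu => (hgm u hu).le) hu
    have hF0 : F u - k ≠ 0 := sub_ne_zero.2 (hk u hu)
    have h2 : deriv g u = ((α⁻¹ : ℝ) : ℂ) * (deriv F u / (F u - k)) * g u := by
      rw [(hgd u hu).deriv, cpow_sub _ _ (hw0 u hu), cpow_one]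
      simp only [g, w]
      field_simp
    have hg0 : 0 < ‖g u‖ := (hgm u hu).trans_le (re_le_norm _)
    have h3 := h1.trans (re_le_norm (g u))
    rw [h2, norm_mul, norm_mul, norm_real, norm_div, Real.norm_of_nonneg (inv_pos.2 hα0).le] at h3
    have hFn : 0 < ‖F u - k‖ := norm_pos_iff.2 hF0
    have h4 : (‖deriv F u‖ * u.re) * ‖g u‖ ≤ (α * ‖F u - k‖) * ‖g u‖ := by
      have h5 := mul_le_mul_of_nonneg_left h3 (mul_pos hα0 hFn).le
      calc (‖deriv F u‖ * u.re) * ‖g u‖ = α * ‖F u - k‖ *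
          (α⁻¹ * (‖deriv F u‖ / ‖F u - k‖) * ‖g u‖ * u.re) := by field_simp
        _ ≤ _ := h5
    exact le_of_mul_le_mul_right h4 hg0
  · have h1 : (1 : ℂ) ∈ rightHalfPlane := by simp [rightHalfPlane]
    have := (hgm 1 h1).trans_le (re_le_norm _)
    have := norm_pos_iff.2 hτ
    positivity
  · have hxm : (x : ℂ) ∈ rightHalfPlane := by
      show 0 < (x : ℂ).re
      rw [ofReal_re]; linarith
    have h1 := norm_le_mul_of_re_pos hgD hgm hx
    have h2 : ‖g x‖ ^ α = ‖τ‖ * ‖F x - k‖ := by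
      simp only [g]
      rw [norm_cpow_real, ← Real.rpow_mul (norm_nonneg _), inv_mul_cancel₀ hα0.ne', Real.rpow_one]
      simp only [w, norm_mul]
    have h3 := Real.rpow_le_rpow (norm_nonneg _) h1 hα0.le
    rw [h2, Real.mul_rpow (by positivity) (by linarith)] at h3
    have := norm_pos_iff.2 hτ
    rw [mul_assoc, ← div_eq_inv_mul, le_div_iff₀ this]
    linarith

/-- A function whose derivative grows at most like `x ^ (α - 1)` has small pre-Schwarzian along a
sequence tending to infinity. -/
theorem frequently_mul_re_preSchwarzian_le {F : ℂ → ℂ} (hF : DifferentiableOn ℂ F rightHalfPlane)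
    (hne : ∀ u ∈ rightHalfPlane, deriv F u ≠ 0) {β C : ℝ} (hC : 0 < C)
    (hb : ∀ x : ℝ, 1 ≤ x → ‖deriv F x‖ ≤ C * x ^ β) {ε : ℝ} (hε : 0 < ε) :
    ∃ᶠ x : ℝ in atTop, x * (preSchwarzian F x).re ≤ β + ε := by
  intro hcon
  obtain ⟨X₀, hX₀⟩ := eventually_atTop.1 hcon
  set X := max X₀ 1 with hX
  have hX1 : 1 ≤ X := le_max_right _ _
  have hmem : ∀ x : ℝ, X ≤ x → (x : ℂ) ∈ rightHalfPlane := fun x hx => by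
    show 0 < (x : ℂ).re
    rw [ofReal_re]; linarith
  have hF' := hF.deriv isOpen_rightHalfPlane
  -- If the claim failed for all large x, this function would be nondecreasing, forcing |F'(x)| to
  -- grow at least like x^(β+ε).
  have hd : ∀ x : ℝ, X ≤ x → HasDerivAt
      (fun x : ℝ => Real.log (‖deriv F x‖ ^ 2) - 2 * (β + ε) * Real.log x)
      (2 * (preSchwarzian F x).re - 2 * (β + ε) * x⁻¹) x := by
    intro x hx
    have h1 : HasDerivAt (fun x : ℝ => deriv F x) (deriv (deriv F) x) x :=
      (hF'.differentiableAt (isOpen_rightHalfPlane.mem_nhds (hmem x hx))).hasDerivAt.comp_ofReal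
    have h0 : 0 < ‖deriv F x‖ := norm_pos_iff.2 (hne _ (hmem x hx))
    have h2 := h1.norm_sq.log (by positivity)
    have h3 := (Real.hasDerivAt_log (show x ≠ 0 by linarith)).const_mul (2 * (β + ε))
    have e : (preSchwarzian F x).re =
        inner ℝ (deriv F x) (deriv (deriv F) x) / ‖deriv F x‖ ^ 2 := by
      simp only [preSchwarzian]
      rw [Complex.inner, div_re, ← normSq_eq_norm_sq]
      simp
      ring
    rw [e, mul_div_assoc']
    exact h2.sub h3
  have hmono : MonotoneOn
      (fun x : ℝ => Real.log (‖deriv F x‖ ^ 2) - 2 * (β + ε) * Real.log x) (Set.Ici X) := by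
    refine monotoneOn_of_deriv_nonneg (convex_Ici X)
      (fun x hx => (hd x hx).continuousAt.continuousWithinAt) ?_ ?_
    · intro x hx
      rw [interior_Ici] at hx
      exact (hd x (le_of_lt hx)).differentiableAt.differentiableWithinAt
    · intro x hx
      rw [interior_Ici] at hx
      have hx' : X < x := hx
      rw [(hd x hx'.le).deriv]
      have h1 := not_le.1 (hX₀ x ((le_max_left _ _).trans hx'.le))
      have hx0 : 0 < x := by linarith
      have : (β + ε) * x⁻¹ ≤ (preSchwarzian F x).re := by
        rw [← div_eq_mul_inv, div_le_iff₀ hx0]; linarith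
      linarith
  set c := Real.log (‖deriv F X‖ ^ 2) - 2 * (β + ε) * Real.log X with hc
  obtain ⟨x, hx1, hx2⟩ := ((Real.tendsto_log_atTop.eventually_gt_atTop
    ((2 * Real.log C - c) / (2 * ε))).and (eventually_ge_atTop X)).exists
  have h1 : c ≤ _ := hmono Set.self_mem_Ici hx2 hx2
  have hx0 : 0 < x := by linarith
  have h0 : 0 < ‖deriv F x‖ := norm_pos_iff.2 (hne _ (hmem x hx2))
  have h2 : Real.log (‖deriv F x‖ ^ 2) ≤ 2 * (Real.log C + β * Real.log x) := by
    rw [Real.log_pow, ← Real.log_rpow hx0, ← Real.log_mul hC.ne' (Real.rpow_pos_of_pos hx0 _).ne']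
    have := Real.log_le_log h0 (hb x (hX1.trans hx2))
    push_cast
    linarith
  rw [div_lt_iff₀ (by positivity)] at hx1
  dsimp only at h1
  linarith

/-- Julia's inequality at infinity. -/
theorem re_mul_norm_sq_le_of_frequently {N : ℂ → ℂ} (hN : DifferentiableOn ℂ N rightHalfPlane)
    (hm : ∀ u ∈ rightHalfPlane, 0 ≤ (N u).re) {β : ℝ}
    (h0 : Tendsto (fun x : ℝ => N x) atTop (𝓝 0))
    (hfr : ∀ ε > 0, ∃ᶠ x : ℝ in atTop, x * (N x).re ≤ β + ε) {u : ℂ} (hu : u ∈ rightHalfPlane) :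
    u.re * ‖N u‖ ^ 2 ≤ β * (N u).re := by
  have hu' : 0 < u.re := hu
  have key : ∀ ε > 0, u.re * ‖N u‖ ^ 2 ≤ (β + ε) * (N u).re := by
    intro ε hε
    have hl : Tendsto (fun x : ℝ => u / x - 1) atTop (𝓝 (0 - 1)) := by
      refine Tendsto.sub_const ?_ _
      have : Tendsto (fun x : ℝ => ((x⁻¹ : ℝ) : ℂ)) atTop (𝓝 ((0 : ℝ) : ℂ)) :=
        (continuous_ofReal.tendsto 0).comp tendsto_inv_atTop_zero
      simpa [div_eq_mul_inv] using this.const_mul u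
    -- The claim is the limit of Schwarz–Pick between u and x, divided by x. The inequality is
    -- needed only for arbitrarily large x, as the left side converges.
    have h1 : Tendsto (fun x : ℝ => u.re * ‖N u - N x‖ ^ 2 -
        ‖u / x - 1‖ ^ 2 * ((β + ε) * (N u).re)) atTop
        (𝓝 (u.re * ‖N u - 0‖ ^ 2 - ‖(0 : ℂ) - 1‖ ^ 2 * ((β + ε) * (N u).re))) :=
      (((h0.const_sub _).norm.pow 2).const_mul _).sub ((hl.norm.pow 2).mul_const _)
    simp only [sub_zero, zero_sub, norm_neg, norm_one, one_pow, one_mul] at h1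
    have h2 : u.re * ‖N u‖ ^ 2 - (β + ε) * (N u).re ≤ 0 := by
      refine le_of_tendsto_of_frequently h1 ?_
      refine ((hfr ε hε).and_eventually (eventually_gt_atTop 0)).mono ?_
      rintro x ⟨hx, hx0⟩
      have hxm : (x : ℂ) ∈ rightHalfPlane := by
        show 0 < (x : ℂ).re
        rwa [ofReal_re]
      have h3 := schwarz_pick hN hm hu hxm
      rw [ofReal_re] at h3
      have hxc : (x : ℂ) ≠ 0 := ofReal_ne_zero.2 hx0.ne'
      have h4 : ‖u - x‖ = ‖u / x - 1‖ * x := by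
        have : u - x = (u / x - 1) * x := by field_simp
        rw [this, norm_mul, norm_real, Real.norm_of_nonneg hx0.le]
      rw [h4] at h3
      have h5 : (‖u / x - 1‖ ^ 2 * (N u).re * x) * (x * (N x).re) ≤
          (‖u / x - 1‖ ^ 2 * (N u).re * x) * (β + ε) :=
        mul_le_mul_of_nonneg_left hx
          (mul_nonneg (mul_nonneg (by positivity) (hm u hu)) hx0.le)
      have h6 : (u.re * ‖N u - N x‖ ^ 2) * x ≤ (‖u / x - 1‖ ^ 2 * ((β + ε) * (N u).re)) * x := by
        nlinarith
      have := le_of_mul_le_mul_right h6 hx0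
      linarith
    linarith
  refine le_of_forall_pos_le_add fun δ hδ => ?_
  have hp := hm u hu
  have h1 := key (δ / ((N u).re + 1)) (by positivity)
  have h2 : δ / ((N u).re + 1) * (N u).re ≤ δ := by
    rw [div_mul_eq_mul_div, div_le_iff₀ (by positivity)]
    nlinarith
  linarith

theorem preSchwarzian_eq {F : ℂ → ℂ} (hF : DifferentiableOn ℂ F rightHalfPlane)
    (hne : ∀ u ∈ rightHalfPlane, deriv F u ≠ 0) {k u : ℂ} (hk : F u ≠ k) (hu : u ∈ rightHalfPlane) :
    preSchwarzian F u =
      (1 - deriv (fun u => (F u - k) / deriv F u) u) / ((F u - k) / deriv F u) := by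
  have h1 := (hF.differentiableAt (isOpen_rightHalfPlane.mem_nhds hu)).hasDerivAt
  have h2 := ((hF.deriv isOpen_rightHalfPlane).differentiableAt
    (isOpen_rightHalfPlane.mem_nhds hu)).hasDerivAt
  have h0 := hne u hu
  have hk' : F u - k ≠ 0 := sub_ne_zero.2 hk
  have h3 := ((h1.sub_const k).div h2 h0).deriv
  have h4 : deriv (fun u => (F u - k) / deriv F u) u =
    (deriv F u * deriv F u - (F u - k) * deriv (deriv F) u) / deriv F u ^ 2 := h3
  rw [h4, preSchwarzian]
  field_simp
  ring

/-- The sharp inequality for the pre-Schwarzian of a function in `Co(α)` in half-plane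
coordinates. -/
theorem IsConcaveUnivalent.re_mul_norm_sq_le {α : ℝ} (hα : α ∈ Set.Ioc (1 : ℝ) 2) {f : ℂ → ℂ}
    (h : IsConcaveUnivalent α f) {u : ℂ} (hu : u ∈ rightHalfPlane) :
    u.re * ‖preSchwarzian (fun u => f (toDisk u)) u‖ ^ 2 ≤
      (α - 1) * (preSchwarzian (fun u => f (toDisk u)) u).re := by
  have hα0 : 0 < α := by linarith [hα.1]
  obtain ⟨k, hk, τ, hτ, hsec⟩ := h.exists_sector hα
  set F : ℂ → ℂ := fun u => f (toDisk u) with hFdef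
  have hF : DifferentiableOn ℂ F rightHalfPlane := differentiableOn_comp_toDisk h.analytic
  have hi : Set.InjOn F rightHalfPlane := injOn_comp_toDisk h.injective
  have hne : ∀ u ∈ rightHalfPlane, deriv F u ≠ 0 := fun u hu =>
    deriv_ne_zero_of_injOn isOpen_rightHalfPlane hF hi hu
  have hFk : ∀ u ∈ rightHalfPlane, F u ≠ k := fun u hu he => hk ⟨_, toDisk_mem hu, he⟩
  obtain ⟨hb, C, hC, hgr⟩ := bounds_of_sector hF hα hτ hFk
    fun u hu => hsec _ ⟨_, toDisk_mem hu, rfl⟩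
  have hG : ∀ u ∈ rightHalfPlane, 0 ≤ ((F u - k) / deriv F u).re := fun u hu =>
    re_sub_div_deriv_nonneg h.analytic h.injective h.convex_compl h.map_one hk hu
  have hN : DifferentiableOn ℂ (preSchwarzian F) rightHalfPlane :=
    ((hF.deriv isOpen_rightHalfPlane).deriv isOpen_rightHalfPlane).div
      (hF.deriv isOpen_rightHalfPlane) hne
  have hxm : ∀ x : ℝ, 1 ≤ x → (x : ℂ) ∈ rightHalfPlane := fun x hx => by
    show 0 < (x : ℂ).re
    rw [ofReal_re]; linarith
  refine re_mul_norm_sq_le_of_frequently hN (fun u hu => re_preSchwarzian_nonneg h.analytic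
    h.injective h.convex_compl h.map_one hu) ?_ (fun ε hε =>
    frequently_mul_re_preSchwarzian_le hF hne (C := α * C) (by positivity) (fun x hx => ?_) hε) hu
  -- With G = (F-k)/F' one has N = (1-G')/G, while |G'(x)| x ≤ |G(x)| and x ≤ α|G(x)|. Hence |N(x)|
  -- ≤ 1/|G(x)| + 1/x ≤ (α+1)/x.
  · have hlim : Tendsto (fun x : ℝ => (α + 1) / x) atTop (𝓝 0) :=
      tendsto_const_nhds.div_atTop tendsto_id
    refine squeeze_zero_norm' ?_ hlim
    filter_upwards [eventually_ge_atTop 1] with x hx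
    have hx0 : 0 < x := by linarith
    have hm := hxm x hx
    have h1 := norm_deriv_mul_re_le (differentiableOn_sub_div_deriv hF hi k) hG hm
    have h2 := h1.trans (re_le_norm _)
    have h3 := hb _ hm
    have hGpos : 0 < ‖(F x - k) / deriv F x‖ :=
      norm_pos_iff.2 (div_ne_zero (sub_ne_zero.2 (hFk _ hm)) (hne _ hm))
    rw [ofReal_re] at h2 h3
    rw [preSchwarzian_eq hF hne (hFk _ hm) hm, norm_div, div_le_div_iff₀ hGpos hx0]
    have h4 : x ≤ α * ‖(F x - k) / deriv F x‖ := by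
      have := norm_pos_iff.2 (hne _ hm)
      rw [norm_div, mul_div_assoc', le_div_iff₀ this]
      linarith
    have h5 := norm_sub_le (1 : ℂ) (deriv (fun u => (F u - k) / deriv F u) x)
    rw [norm_one] at h5
    nlinarith
  · have hx0 : 0 < x := by linarith
    have h1 := hb _ (hxm x hx)
    have h2 := hgr x hx
    rw [ofReal_re] at h1
    rw [Real.rpow_sub_one hx0.ne', mul_div_assoc', le_div_iff₀ hx0]
    nlinarith

/-- Unless N vanishes, the sharp inequality says that (α-1)/N - u has nonnegative real part.
Equality at one point makes this function an imaginary constant. A single zero of N makes N vanish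
identically, for the same reason. -/
theorem IsConcaveUnivalent.preSchwarzian_of_eq {α : ℝ} (hα : α ∈ Set.Ioc (1 : ℝ) 2) {f : ℂ → ℂ}
    (h : IsConcaveUnivalent α f) {u₀ : ℂ} (hu₀ : u₀ ∈ rightHalfPlane)
    (heq : u₀.re * ‖preSchwarzian (fun u => f (toDisk u)) u₀‖ ^ 2 =
      (α - 1) * (preSchwarzian (fun u => f (toDisk u)) u₀).re) :
    (∀ u ∈ rightHalfPlane, preSchwarzian (fun u => f (toDisk u)) u = 0) ∨
      ∃ r : ℂ, r.re = 0 ∧ ∀ u ∈ rightHalfPlane,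
        preSchwarzian (fun u => f (toDisk u)) u = (α - 1) / (u + r) := by
  set F : ℂ → ℂ := fun u => f (toDisk u) with hFdef
  have hF : DifferentiableOn ℂ F rightHalfPlane := differentiableOn_comp_toDisk h.analytic
  have hi : Set.InjOn F rightHalfPlane := injOn_comp_toDisk h.injective
  have hN : DifferentiableOn ℂ (preSchwarzian F) rightHalfPlane :=
    ((hF.deriv isOpen_rightHalfPlane).deriv isOpen_rightHalfPlane).div
      (hF.deriv isOpen_rightHalfPlane) fun u hu =>
        deriv_ne_zero_of_injOn isOpen_rightHalfPlane hF hi hu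
  have hNm : ∀ u ∈ rightHalfPlane, 0 ≤ (preSchwarzian F u).re := fun u hu =>
    re_preSchwarzian_nonneg h.analytic h.injective h.convex_compl h.map_one hu
  have hineq : ∀ u ∈ rightHalfPlane, u.re * ‖preSchwarzian F u‖ ^ 2 ≤
      (α - 1) * (preSchwarzian F u).re := fun u hu => h.re_mul_norm_sq_le hα hu
  by_cases hz : ∃ u ∈ rightHalfPlane, preSchwarzian F u = 0
  · obtain ⟨u₁, hu₁, h1⟩ := hz
    refine Or.inl fun u hu => ?_
    rw [← h1]
    exact eq_of_re_nonneg_of_re_eq_zero hN hNm hu₁ (by rw [h1, zero_re]) hu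
  push Not at hz
  right
  have hre : ∀ u ∈ rightHalfPlane, ((α - 1 : ℝ) / preSchwarzian F u - u).re =
      (α - 1) * (preSchwarzian F u).re / ‖preSchwarzian F u‖ ^ 2 - u.re := by
    intro u _
    rw [sub_re, div_re, ofReal_re, ofReal_im, normSq_eq_norm_sq]
    simp
  have hR : DifferentiableOn ℂ (fun u => (α - 1 : ℝ) / preSchwarzian F u - u) rightHalfPlane :=
    ((differentiableOn_const _).div hN hz).sub differentiableOn_id
  have hRm : ∀ u ∈ rightHalfPlane, 0 ≤ ((α - 1 : ℝ) / preSchwarzian F u - u).re := by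
    intro u hu
    have := norm_pos_iff.2 (hz u hu)
    rw [hre u hu, sub_nonneg, le_div_iff₀ (by positivity)]
    exact hineq u hu
  have hR0 : ((α - 1 : ℝ) / preSchwarzian F u₀ - u₀).re = 0 := by
    have := norm_pos_iff.2 (hz _ hu₀)
    rw [hre _ hu₀, sub_eq_zero, div_eq_iff (by positivity)]
    exact heq.symm
  refine ⟨(α - 1 : ℝ) / preSchwarzian F u₀ - u₀, hR0, fun u hu => ?_⟩
  have h2 := eq_of_re_nonneg_of_re_eq_zero hR hRm hu₀ hR0 hu
  have hα1 : ((α - 1 : ℝ) : ℂ) ≠ 0 := ofReal_ne_zero.2 (by linarith [hα.1])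
  have h3 := hz u hu
  rw [← h2, add_sub_cancel]
  push_cast at hα1 ⊢
  field_simp

/-! ### Powers of half-planes: convex complement and opening angle. -/

theorem abs_arg_lt_of_re_pos {p : ℂ} (h : 0 < p.re) : |arg p| < Real.pi / 2 :=
  abs_arg_lt_pi_div_two_iff.2 (Or.inl h)

theorem polar_cpow {ρ θ : ℝ} (hρ : 0 < ρ) (h1 : -Real.pi < θ) (h2 : θ ≤ Real.pi) (β : ℝ) :
    ((ρ : ℂ) * exp (θ * I)) ^ (β : ℂ) = ((ρ ^ β : ℝ) : ℂ) * exp ((β * θ : ℝ) * I) := by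
  have h3 : (ρ : ℂ) * exp (θ * I) = exp ((Real.log ρ : ℝ) + θ * I) := by
    rw [exp_add, ← ofReal_exp, Real.exp_log hρ]
  rw [h3, cpow_def_of_ne_zero (exp_ne_zero _), log_exp (by simpa using h1) (by simpa using h2),
    Real.rpow_def_of_pos hρ, ofReal_exp, ← exp_add]
  congr 1
  push_cast
  ring

/-- Images of half-planes under powers between `1` and `2` have convex complements. -/
theorem convex_compl_image_cpow {β d : ℝ} (hβ : β ∈ Set.Icc (1 : ℝ) 2) (hd : 0 ≤ d) :
    Convex ℝ ((fun p : ℂ => p ^ (β : ℂ)) '' {p | d < p.re})ᶜ := by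
  have hβ0 : 0 < β := by linarith [hβ.1]
  have hpi := Real.pi_pos
  -- Every image point lies in an open half-plane contained in the image, so no convex combination
  -- of omitted points can reach it.
  have key : ∀ x ∈ (fun p : ℂ => p ^ (β : ℂ)) '' {p | d < p.re}, ∃ (ν : ℂ) (c : ℝ),
      c < (x * ν).re ∧ ∀ y : ℂ, c < (y * ν).re →
        y ∈ (fun p : ℂ => p ^ (β : ℂ)) '' {p | d < p.re} := by
    rintro _ ⟨p, hp, rfl⟩
    have hp' : d < p.re := hp
    have hp0 : 0 < p.re := hd.trans_lt hp'
    set t := arg p with ht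
    have htlt := abs_lt.1 (abs_arg_lt_of_re_pos hp0)
    have hcos : 0 < Real.cos t := Real.cos_pos_of_mem_Ioo htlt
    have hρ : 0 < ‖p‖ := hp0.trans_le (re_le_norm p)
    have hpeq : p = (‖p‖ : ℂ) * exp (t * I) := (norm_mul_exp_arg_mul_I p).symm
    have hre : p.re = ‖p‖ * Real.cos t := by
      rw [ht, cos_arg (by rintro rfl; simp at hp0)]; field_simp
    -- For d > 0 the half-plane is bounded by the tangent to the image of Re p = d at the point of
    -- argument t: its normal has argument (β-1)t, that of p^(β-1).
    refine ⟨exp ((-((β - 1) * t) : ℝ) * I), (d / Real.cos t) ^ β * Real.cos t, ?_, ?_⟩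
    · simp only
      rw [hpeq, polar_cpow hρ (by linarith) (by linarith), mul_assoc, ← exp_add, ← add_mul,
        ← ofReal_add, re_ofReal_mul, exp_ofReal_mul_I_re,
        show β * t + -((β - 1) * t) = t by ring]
      refine mul_lt_mul_of_pos_right ?_ hcos
      refine Real.rpow_lt_rpow (by positivity) ?_ hβ0
      rw [div_lt_iff₀ hcos]
      linarith
    · intro y hy
      set ν := exp ((-((β - 1) * t) : ℝ) * I) with hν
      have hyν : 0 < (y * ν).re := lt_of_le_of_lt (by positivity) hy
      set s := arg (y * ν) with hs
      have hslt := abs_lt.1 (abs_arg_lt_of_re_pos hyν)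
      have hcs : 0 < Real.cos s := Real.cos_pos_of_mem_Ioo hslt
      have hν1 : ‖ν‖ = 1 := norm_exp_ofReal_mul_I _
      have hyn : ‖y * ν‖ = ‖y‖ := by rw [norm_mul, hν1, mul_one]
      have hy0 : 0 < ‖y‖ := by rw [← hyn]; exact hyν.trans_le (re_le_norm _)
      have hyre : (y * ν).re = ‖y‖ * Real.cos s := by
        rw [hs, cos_arg (by intro h; rw [h] at hyν; simp at hyν), hyn]; field_simp
      have hyeq : y = (‖y‖ : ℂ) * exp ((s + (β - 1) * t : ℝ) * I) := by
        have h1 : y = (y * ν) * exp (((β - 1) * t : ℝ) * I) := by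
          rw [mul_assoc, hν, ← exp_add, ← add_mul, ← ofReal_add]
          simp
        nth_rewrite 1 [h1]
        nth_rewrite 1 [← norm_mul_exp_arg_mul_I (y * ν)]
        rw [hyn, mul_assoc, ← exp_add]
        congr 2
        push_cast
        ring
      have hq : (β - 1) / β * t + 1 / β * s = (s + (β - 1) * t) / β := by field_simp; ring
      have hq1 : 0 ≤ (β - 1) / β := div_nonneg (by linarith [hβ.1]) hβ0.le
      have hq2 : 0 ≤ 1 / β := by positivity
      have hqs : (β - 1) / β + 1 / β = 1 := by field_simp; ring
      have hbd : -(Real.pi / 2) < (s + (β - 1) * t) / β ∧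
          (s + (β - 1) * t) / β < Real.pi / 2 := by
        have : 0 ≤ β - 1 := by linarith [hβ.1]
        rw [lt_div_iff₀ hβ0, div_lt_iff₀ hβ0]
        constructor <;> nlinarith
      -- Log-concavity of the cosine, from the weighted AM–GM inequality and concavity.
      have hconc : Real.cos t ^ ((β - 1) / β) * Real.cos s ^ (1 / β) ≤
          Real.cos ((s + (β - 1) * t) / β) := by
        refine (Real.geom_mean_le_arith_mean2_weighted hq1 hq2 hcos.le hcs.le hqs).trans ?_
        rw [← hq]
        exact strictConcaveOn_cos_Icc.concaveOn.2 ⟨htlt.1.le, htlt.2.le⟩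
          ⟨hslt.1.le, hslt.2.le⟩ hq1 hq2 hqs
      refine ⟨((‖y‖ ^ (1 / β) : ℝ) : ℂ) * exp (((s + (β - 1) * t) / β : ℝ) * I), ?_, ?_⟩
      · show d < _
        rw [re_ofReal_mul, exp_ofReal_mul_I_re]
        have h1 : ((d / Real.cos t) ^ β * Real.cos t) ^ (1 / β) <
            (‖y‖ * Real.cos s) ^ (1 / β) :=
          Real.rpow_lt_rpow (by positivity) (by rw [← hyre]; exact hy) (by positivity)
        rw [Real.mul_rpow (by positivity) hcos.le, Real.mul_rpow hy0.le hcs.le,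
          ← Real.rpow_mul (by positivity), mul_one_div_cancel hβ0.ne', Real.rpow_one] at h1
        have h2 : Real.cos t ^ (1 / β) * Real.cos t ^ ((β - 1) / β) = Real.cos t := by
          rw [← Real.rpow_add hcos, add_comm, hqs, Real.rpow_one]
        calc d = d / Real.cos t * Real.cos t ^ (1 / β) * Real.cos t ^ ((β - 1) / β) := by
              rw [mul_assoc, h2]; field_simp
          _ < ‖y‖ ^ (1 / β) * Real.cos s ^ (1 / β) * Real.cos t ^ ((β - 1) / β) :=
              mul_lt_mul_of_pos_right h1 (by positivity)
          _ = ‖y‖ ^ (1 / β) * (Real.cos t ^ ((β - 1) / β) * Real.cos s ^ (1 / β)) := by ring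
          _ ≤ _ := mul_le_mul_of_nonneg_left hconc (by positivity)
      · simp only
        rw [polar_cpow (by positivity) (by linarith [hbd.1]) (by linarith [hbd.2]),
          ← Real.rpow_mul hy0.le, one_div_mul_cancel hβ0.ne', Real.rpow_one,
          mul_div_cancel₀ _ hβ0.ne']
        exact hyeq.symm
  intro x hx y hy a b ha hb hab hmem
  obtain ⟨ν, c, hc, hall⟩ := key _ hmem
  have hx' : (x * ν).re ≤ c := not_lt.1 fun h => hx (hall x h)
  have hy' : (y * ν).re ≤ c := not_lt.1 fun h => hy (hall y h)
  have : ((a • x + b • y) * ν).re = a * (x * ν).re + b * (y * ν).re := by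
    rw [add_mul, real_smul, real_smul, mul_assoc, mul_assoc, add_re, re_ofReal_mul, re_ofReal_mul]
  rw [this] at hc
  have h1 := mul_le_mul_of_nonneg_left hx' ha
  have h2 := mul_le_mul_of_nonneg_left hy' hb
  have h3 : a * c + b * c = c := by rw [← add_mul, hab, one_mul]
  linarith

theorem measurableSet_sector (a b : ℂ) (c : ℝ) :
    MeasurableSet {w : ℂ | c * ‖(w - b) / a‖ < ((w - b) / a).re} :=
  measurableSet_lt (Continuous.measurable (by fun_prop))
    (Continuous.measurable (continuous_re.comp (by fun_prop)))

theorem volume_sector_directions_ge {a : ℂ} (ha : a ≠ 0) {α : ℝ} (hα : α ∈ Set.Icc (0 : ℝ) 2) :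
    ENNReal.ofReal (2 * Real.pi - Real.pi * α) ≤ MeasureTheory.volume
      ({t : ℝ | exp (t * I) ∈ {y : ℂ | (y / a).re < Real.cos (Real.pi * α / 2) * ‖y / a‖}} ∩
        Set.Ioc (-Real.pi) Real.pi) := by
  have hpi := Real.pi_pos
  have hmeas : MeasurableSet {y : ℂ | (y / a).re < Real.cos (Real.pi * α / 2) * ‖y / a‖} :=
    measurableSet_lt (Continuous.measurable (continuous_re.comp (by fun_prop)))
      (Continuous.measurable (by fun_prop))
  have h1 := volume_exp_preimage_inter_Ioc hmeas (-Real.pi) (arg a)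
  rw [show -Real.pi + 2 * Real.pi = Real.pi by ring] at h1
  rw [h1]
  have h2 : MeasureTheory.volume (Set.Ioo (arg a + Real.pi * α / 2)
      (arg a + 2 * Real.pi - Real.pi * α / 2)) = ENNReal.ofReal (2 * Real.pi - Real.pi * α) := by
    rw [Real.volume_Ioo]; congr 1; ring
  rw [← h2]
  refine MeasureTheory.measure_mono fun t ht => ⟨?_, ?_, ?_⟩
  · have ha' : 0 < ‖a‖ := norm_pos_iff.2 ha
    have h3 : exp (t * I) / a = ((‖a‖⁻¹ : ℝ) : ℂ) * exp ((t - arg a : ℝ) * I) := by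
      nth_rewrite 1 [← norm_mul_exp_arg_mul_I a]
      rw [← div_div, div_right_comm, ← exp_sub, div_eq_inv_mul]
      push_cast
      rw [sub_mul]
    show (exp (t * I) / a).re < Real.cos (Real.pi * α / 2) * ‖exp (t * I) / a‖
    rw [h3, re_ofReal_mul, exp_ofReal_mul_I_re, norm_mul, norm_exp_ofReal_mul_I, norm_real,
      Real.norm_of_nonneg (by positivity), mul_one, mul_comm]
    refine mul_lt_mul_of_pos_right ?_ (by positivity)
    have h4 : 0 ≤ Real.pi * α / 2 := by have := hα.1; positivity
    have h5 : Real.pi * α / 2 ≤ Real.pi := by nlinarith [hα.2]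
    rcases le_total (t - arg a) Real.pi with h | h
    · exact Real.cos_lt_cos_of_nonneg_of_le_pi h4 h (by linarith [ht.1])
    · rw [← Real.cos_two_pi_sub]
      exact Real.cos_lt_cos_of_nonneg_of_le_pi h4 (by linarith) (by linarith [ht.2])
  · have := hα.1
    have : 0 ≤ Real.pi * α / 2 := by positivity
    linarith [ht.1]
  · have := hα.1
    have : 0 ≤ Real.pi * α / 2 := by positivity
    linarith [ht.2]

/-- A set contained in a sector of opening `πα` has opening angle at most `πα`. -/
theorem openingAngleAtInfinity_le {Ω : Set ℂ} {a b : ℂ} (ha : a ≠ 0) {α : ℝ}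
    (hα : α ∈ Set.Icc (0 : ℝ) 2)
    (hΩ : Ω ⊆ {w : ℂ | Real.cos (Real.pi * α / 2) * ‖(w - b) / a‖ < ((w - b) / a).re}) :
    openingAngleAtInfinity Ω ≤ ENNReal.ofReal (Real.pi * α) := by
  have hpi := Real.pi_pos
  set c := Real.cos (Real.pi * α / 2)
  set S := {w : ℂ | c * ‖(w - b) / a‖ < ((w - b) / a).re} with hS
  have hSm : MeasurableSet S := measurableSet_sector a b c
  have hmeas : MeasurableSet {y : ℂ | (y / a).re < c * ‖y / a‖} :=
    measurableSet_lt (Continuous.measurable (continuous_re.comp (by fun_prop)))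
      (Continuous.measurable (by fun_prop))
  have h1 := (volume_sector_directions_ge ha hα).trans
    (volume_le_liminf_circleAngles hSm.compl (l := atTop) (r := id)
      ((measurableSet_exp_preimage hmeas).inter measurableSet_Ioc) (by
        rintro t ⟨ht, htm⟩
        -- After division by R the vertex b becomes negligible, so a direction strictly outside the
        -- sector with vertex 0 is eventually outside the translated one.
        have hlim : Tendsto (fun R : ℝ => (exp (t * I) - ((R⁻¹ : ℝ) : ℂ) * b) / a) atTop
            (𝓝 ((exp (t * I) - ((0 : ℝ) : ℂ) * b) / a)) :=
          ((((continuous_ofReal.tendsto 0).comp tendsto_inv_atTop_zero).mul_const b).const_sub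
            _).div_const a
        simp only [ofReal_zero, zero_mul, sub_zero] at hlim
        have h2 := ((continuous_re.tendsto _).comp hlim).eventually_lt
          (hlim.norm.const_mul c) ht
        filter_upwards [h2, eventually_gt_atTop 0] with R hR hR0
        refine ⟨htm, ?_⟩
        show ¬ (c * ‖((id R : ℝ) * exp (t * I) - b) / a‖ < (((id R : ℝ) * exp (t * I) - b) / a).re)
        have hRc : (R : ℂ) ≠ 0 := ofReal_ne_zero.2 hR0.ne'
        have h3 : ((id R : ℝ) * exp (t * I) - b) / a =
            (R : ℂ) * ((exp (t * I) - ((R⁻¹ : ℝ) : ℂ) * b) / a) := by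
          push_cast
          simp only [id]
          field_simp
        rw [h3, re_ofReal_mul, norm_mul, norm_real, Real.norm_of_nonneg hR0.le, not_lt]
        have h4 := mul_le_mul_of_nonneg_left (le_of_lt hR) hR0.le
        simp only [Function.comp] at h4
        linarith))
  have h2 : ∀ R : ℝ, MeasureTheory.volume (circleAngles Ω R) ≤
      ENNReal.ofReal (2 * Real.pi) - MeasureTheory.volume (circleAngles Sᶜ R) := by
    intro R
    have hm2 := measurableSet_circleAngles hSm.compl R
    have hfin : MeasureTheory.volume (circleAngles Sᶜ R) ≠ ⊤ := by
      refine ne_top_of_le_ne_top (b := MeasureTheory.volume (Set.Ioc (-Real.pi) Real.pi)) ?_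
        (MeasureTheory.measure_mono fun t ht => ht.1)
      rw [Real.volume_Ioc]; exact ENNReal.ofReal_ne_top
    refine ENNReal.le_sub_of_add_le_right hfin ?_
    rw [← MeasureTheory.measure_union _ hm2]
    · have : ENNReal.ofReal (2 * Real.pi) =
          MeasureTheory.volume (Set.Ioc (-Real.pi) Real.pi) := by
        rw [Real.volume_Ioc]; congr 1; ring
      rw [this]
      exact MeasureTheory.measure_mono (Set.union_subset (fun t ht => ht.1) fun t ht => ht.1)
    · rw [Set.disjoint_left]
      exact fun t ht ht' => ht'.2 (hΩ ht.2)
  have h3 : openingAngleAtInfinity Ω ≤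
      limsup (fun R : ℝ => ENNReal.ofReal (2 * Real.pi) -
        MeasureTheory.volume (circleAngles Sᶜ R)) atTop := limsup_le_limsup (Eventually.of_forall h2)
  rw [ENNReal.limsup_const_sub _ _ ENNReal.ofReal_ne_top] at h3
  refine h3.trans ((tsub_le_tsub_left h1 _).trans ?_)
  have := hα.2
  rw [← ENNReal.ofReal_sub _ (by nlinarith)]
  exact le_of_eq (by congr 1; ring)

/-! ### Translation between disk and half-plane, and uniqueness. -/

theorem hasDerivAt_toHalf {z : ℂ} (hz : 1 - z ≠ 0) : HasDerivAt toHalf (2 / (1 - z) ^ 2) z := by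
  have h := ((hasDerivAt_id z).const_add 1).div ((hasDerivAt_id z).const_sub 1) hz
  refine h.congr_deriv ?_
  show (1 * (1 - z) - (1 + z) * -1) / (1 - z) ^ 2 = _
  congr 1
  ring

theorem hasDerivAt_toDisk {u : ℂ} (hu : u + 1 ≠ 0) : HasDerivAt toDisk (2 / (u + 1) ^ 2) u := by
  have h := ((hasDerivAt_id u).sub_const 1).div ((hasDerivAt_id u).add_const 1) hu
  refine h.congr_deriv ?_
  show (1 * (u + 1) - (u - 1) * 1) / (u + 1) ^ 2 = _
  congr 1
  ring

theorem preSchwarzian_eqOn {f g : ℂ → ℂ} {U : Set ℂ} (hU : IsOpen U) (h : Set.EqOn f g U) :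
    Set.EqOn (preSchwarzian f) (preSchwarzian g) U := fun _ hz => by
  simp only [preSchwarzian, h.deriv hU hz, (h.deriv hU).deriv hU hz]

theorem IsConcaveUnivalent.congr {α : ℝ} {f g : ℂ → ℂ} (hf : IsConcaveUnivalent α f)
    (h : Set.EqOn g f (Metric.ball 0 1)) : IsConcaveUnivalent α g := by
  have h0 : (0 : ℂ) ∈ Metric.ball (0 : ℂ) 1 := by simp
  have himg : g '' Metric.ball 0 1 = f '' Metric.ball 0 1 := h.image_eq
  exact
    { analytic := hf.analytic.congr h
      map_zero := by rw [h h0, hf.map_zero]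
      deriv_zero := by rw [h.deriv Metric.isOpen_ball h0, hf.deriv_zero]
      map_one := hf.map_one.congr' (by
        filter_upwards [self_mem_nhdsWithin] with z hz using (h hz).symm)
      injective := hf.injective.congr h.symm
      convex_compl := by rw [himg]; exact hf.convex_compl
      opening_angle_le := by rw [himg]; exact hf.opening_angle_le }

/-- The weighted pre-Schwarzian relative to the centre, in half-plane coordinates. -/
theorem weightedPreSchwarzian_sub_center (α : ℝ) {f : ℂ → ℂ}
    (hf : DifferentiableOn ℂ f (Metric.ball 0 1)) (hi : Set.InjOn f (Metric.ball 0 1)) {z : ℂ}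
    (hz : z ∈ Metric.ball (0 : ℂ) 1) :
    weightedPreSchwarzian z f - variabilityCenter α z = (1 - starRingEnd ℂ z) / (1 - z) *
      (2 * (toHalf z).re * preSchwarzian (fun u => f (toDisk u)) (toHalf z) - (α - 1)) := by
  set F : ℂ → ℂ := fun u => f (toDisk u) with hFdef
  have hF : DifferentiableOn ℂ F rightHalfPlane := differentiableOn_comp_toDisk hf
  have hF' := hF.deriv isOpen_rightHalfPlane
  have h0 := deriv_ne_zero_of_injOn isOpen_rightHalfPlane hF (injOn_comp_toDisk hi) (toHalf_mem hz)
  have hfF : Set.EqOn f (fun w => F (toHalf w)) (Metric.ball 0 1) := fun w hw => by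
    simp only [F, toDisk_toHalf (ne_one_of_mem_ball hw)]
  have hd1 : Set.EqOn (deriv f) (fun w => deriv F (toHalf w) * (2 / (1 - w) ^ 2))
      (Metric.ball 0 1) := fun w hw => by
    rw [hfF.deriv Metric.isOpen_ball hw]
    exact ((hF.differentiableAt (isOpen_rightHalfPlane.mem_nhds (toHalf_mem hw))).hasDerivAt.comp w
      (hasDerivAt_toHalf (one_sub_ne_zero_of_mem_ball hw))).deriv
  have hz1 := one_sub_ne_zero_of_mem_ball hz
  have hq : HasDerivAt (fun w : ℂ => 2 / (1 - w) ^ 2) (4 / (1 - z) ^ 3) z := by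
    have h := (hasDerivAt_const z (2 : ℂ)).div (((hasDerivAt_id z).const_sub 1).pow 2)
      (pow_ne_zero 2 hz1)
    refine h.congr_deriv ?_
    show (0 * (1 - z) ^ 2 - 2 * ((2 : ℕ) * (1 - z) ^ (2 - 1) * -1)) / ((1 - z) ^ 2) ^ 2 = _
    norm_num
    field_simp
    norm_num
  have hd2 : deriv (deriv f) z = deriv (deriv F) (toHalf z) * (2 / (1 - z) ^ 2) *
      (2 / (1 - z) ^ 2) + deriv F (toHalf z) * (4 / (1 - z) ^ 3) := by
    rw [hd1.deriv Metric.isOpen_ball hz]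
    exact (((hF'.differentiableAt (isOpen_rightHalfPlane.mem_nhds (toHalf_mem hz))).hasDerivAt.comp z
      (hasDerivAt_toHalf hz1)).mul hq).deriv
  have hz2 : 1 - starRingEnd ℂ z ≠ 0 := by
    intro h
    apply hz1
    have := congrArg (starRingEnd ℂ) h
    simpa using this
  have hnorm : (‖z‖ : ℂ) ^ 2 = z * starRingEnd ℂ z := (mul_conj' z).symm
  have hre : ((toHalf z).re : ℂ) =
      (1 - z * starRingEnd ℂ z) / ((1 - z) * (1 - starRingEnd ℂ z)) := by
    rw [re_toHalf]
    push_cast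
    rw [hnorm, ← mul_conj' (1 - z), map_sub, map_one]
  rw [weightedPreSchwarzian, variabilityCenter, preSchwarzian, preSchwarzian, hd2, hd1 hz, hre,
    hnorm]
  generalize starRingEnd ℂ z = w at *
  field_simp
  ring

/-- The prefactor is unimodular; expand |2xN - (α-1)|². The sign of the bracket decides whether the
point is inside, on or outside the circle. -/
theorem norm_weightedPreSchwarzian_sub_center (α : ℝ) {f : ℂ → ℂ}
    (hf : DifferentiableOn ℂ f (Metric.ball 0 1)) (hi : Set.InjOn f (Metric.ball 0 1)) {z : ℂ}
    (hz : z ∈ Metric.ball (0 : ℂ) 1) :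
    ‖weightedPreSchwarzian z f - variabilityCenter α z‖ ^ 2 =
      4 * (toHalf z).re * ((toHalf z).re * ‖preSchwarzian (fun u => f (toDisk u)) (toHalf z)‖ ^ 2 -
        (α - 1) * (preSchwarzian (fun u => f (toDisk u)) (toHalf z)).re) + (α - 1) ^ 2 := by
  have h1 : ‖(1 - starRingEnd ℂ z) / (1 - z)‖ = 1 := by
    have h2 : 1 - starRingEnd ℂ z = starRingEnd ℂ (1 - z) := by simp
    rw [norm_div, h2, norm_conj, div_self]
    exact norm_ne_zero_iff.2 (one_sub_ne_zero_of_mem_ball hz)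
  rw [weightedPreSchwarzian_sub_center α hf hi hz, norm_mul, h1, one_mul]
  generalize preSchwarzian (fun u => f (toDisk u)) (toHalf z) = N
  generalize (toHalf z).re = x
  rw [← normSq_eq_norm_sq, ← normSq_eq_norm_sq, normSq_apply, normSq_apply]
  have e1 : (2 * (x : ℂ) * N - (α - 1)).re = 2 * x * N.re - (α - 1) := by simp
  have e2 : (2 * (x : ℂ) * N - (α - 1)).im = 2 * x * N.im := by simp
  rw [e1, e2]
  ring

/-- Equal pre-Schwarzians make F'/G' constant, and the normalization at 0 fixes both constants of
integration. -/
theorem eqOn_of_preSchwarzian_eqOn {f g : ℂ → ℂ} (hf : DifferentiableOn ℂ f (Metric.ball 0 1))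
    (hfi : Set.InjOn f (Metric.ball 0 1)) (hg : DifferentiableOn ℂ g (Metric.ball 0 1))
    (hgi : Set.InjOn g (Metric.ball 0 1)) (h0 : f 0 = g 0) (h1 : deriv f 0 = deriv g 0)
    (hN : ∀ u ∈ rightHalfPlane, preSchwarzian (fun u => f (toDisk u)) u =
      preSchwarzian (fun u => g (toDisk u)) u) : Set.EqOn f g (Metric.ball 0 1) := by
  have hone : (1 : ℂ) ∈ rightHalfPlane := by simp [rightHalfPlane]
  have hdisk1 : toDisk 1 = 0 := by simp [toDisk]
  have hder : ∀ {f : ℂ → ℂ}, DifferentiableOn ℂ f (Metric.ball 0 1) →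
      deriv (fun u => f (toDisk u)) 1 = deriv f 0 * (2 / (1 + 1) ^ 2) := by
    intro f hf
    have h2 : HasDerivAt f (deriv f 0) (toDisk 1) := by
      rw [hdisk1]
      exact (hf.differentiableAt (Metric.isOpen_ball.mem_nhds (by simp))).hasDerivAt
    exact (h2.comp 1 (hasDerivAt_toDisk (by norm_num))).deriv
  set F : ℂ → ℂ := fun u => f (toDisk u) with hFdef
  set G : ℂ → ℂ := fun u => g (toDisk u) with hGdef
  have hF : DifferentiableOn ℂ F rightHalfPlane := differentiableOn_comp_toDisk hf
  have hG : DifferentiableOn ℂ G rightHalfPlane := differentiableOn_comp_toDisk hg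
  have hF' := hF.deriv isOpen_rightHalfPlane
  have hG' := hG.deriv isOpen_rightHalfPlane
  have hF0 : ∀ u ∈ rightHalfPlane, deriv F u ≠ 0 := fun u hu =>
    deriv_ne_zero_of_injOn isOpen_rightHalfPlane hF (injOn_comp_toDisk hfi) hu
  have hG0 : ∀ u ∈ rightHalfPlane, deriv G u ≠ 0 := fun u hu =>
    deriv_ne_zero_of_injOn isOpen_rightHalfPlane hG (injOn_comp_toDisk hgi) hu
  have hpre := convex_rightHalfPlane.isPreconnected
  have h11 : deriv F 1 = deriv G 1 := by rw [hder hf, hder hg, h1]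
  have hquot : ∀ u ∈ rightHalfPlane, deriv F u / deriv G u = deriv F 1 / deriv G 1 := by
    intro u hu
    refine isOpen_rightHalfPlane.is_const_of_deriv_eq_zero hpre
      (f := fun u => deriv F u / deriv G u) (hF'.div hG' hG0) (fun v hv => ?_) hu hone
    have hm := isOpen_rightHalfPlane.mem_nhds hv
    have h2 := ((hF'.differentiableAt hm).hasDerivAt.div (hG'.differentiableAt hm).hasDerivAt
      (hG0 v hv)).deriv
    have h3 := hN v hv
    simp only [preSchwarzian] at h3
    rw [div_eq_div_iff (hF0 v hv) (hG0 v hv)] at h3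
    have h4 : deriv (fun u => deriv F u / deriv G u) v = _ := h2
    rw [h4, h3, mul_comm, sub_self, zero_div]
    rfl
  have hFG : Set.EqOn F G rightHalfPlane := by
    refine isOpen_rightHalfPlane.eqOn_of_deriv_eq hpre hF hG (fun u hu => ?_) hone
      (by simp only [F, G, hdisk1, h0])
    have := hquot u hu
    rw [h11, div_self (hG0 1 hone), div_eq_one_iff_eq (hG0 u hu)] at this
    exact this
  intro z hz
  have := hFG (toHalf_mem hz)
  simpa only [F, G, toDisk_toHalf (ne_one_of_mem_ball hz)] using this

/-! ### Power models and the functions g_θ. -/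

/-- The normalized power of a shifted half-plane, as a function on the half-plane. -/
noncomputable def powerModel (β : ℝ) (r u : ℂ) : ℂ :=
  (1 + r) / (2 * β) * ((u + r) ^ (β : ℂ) / (1 + r) ^ (β : ℂ) - 1)

theorem re_add_pos {u r : ℂ} (hu : u ∈ rightHalfPlane) (hr : 0 ≤ r.re) : 0 < (u + r).re := by
  have : 0 < u.re := hu
  rw [add_re]; linarith

theorem ne_zero_of_zero_lt_re {u : ℂ} (hu : 0 < u.re) : u ≠ 0 := by
  rintro rfl; simp at hu

theorem hasDerivAt_powerModel {β : ℝ} (hβ : β ≠ 0) {r : ℂ} (hr : 0 ≤ r.re) {u : ℂ}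
    (hu : u ∈ rightHalfPlane) : HasDerivAt (powerModel β r)
      ((1 + r) / (2 * (1 + r) ^ (β : ℂ)) * (u + r) ^ ((β : ℂ) - 1)) u := by
  have hs : u + r ∈ slitPlane := Or.inl (re_add_pos hu hr)
  have h1 := ((((hasDerivAt_id u).add_const r).cpow_const (c := (β : ℂ)) hs).div_const
    ((1 + r) ^ (β : ℂ)) |>.sub_const 1).const_mul ((1 + r) / (2 * β))
  have hβ' : (β : ℂ) ≠ 0 := ofReal_ne_zero.2 hβ
  refine h1.congr_deriv ?_
  show (1 + r) / (2 * β) * (β * (u + r) ^ ((β : ℂ) - 1) * 1 / (1 + r) ^ (β : ℂ)) = _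
  field_simp

theorem preSchwarzian_powerModel {β : ℝ} (hβ : β ≠ 0) {r : ℂ} (hr : 0 ≤ r.re) {u : ℂ}
    (hu : u ∈ rightHalfPlane) : preSchwarzian (powerModel β r) u = (β - 1) / (u + r) := by
  have hone : (1 : ℂ) ∈ rightHalfPlane := by simp [rightHalfPlane]
  have hs : u + r ∈ slitPlane := Or.inl (re_add_pos hu hr)
  have h0 := ne_zero_of_zero_lt_re (re_add_pos hu hr)
  have h1 := ne_zero_of_zero_lt_re (re_add_pos hone hr)
  have hp1 : (1 + r) ^ (β : ℂ) ≠ 0 := fun h => h1 (cpow_eq_zero_iff _ _ |>.1 h).1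
  have hp2 : (u + r) ^ ((β : ℂ) - 1) ≠ 0 := fun h => h0 (cpow_eq_zero_iff _ _ |>.1 h).1
  have hd : Set.EqOn (deriv (powerModel β r)) (fun u => (1 + r) / (2 * (1 + r) ^ (β : ℂ)) *
      (u + r) ^ ((β : ℂ) - 1)) rightHalfPlane := fun v hv => (hasDerivAt_powerModel hβ hr hv).deriv
  have hd2 := (((hasDerivAt_id u).add_const r).cpow_const (c := (β : ℂ) - 1) hs).const_mul
    ((1 + r) / (2 * (1 + r) ^ (β : ℂ))) |>.deriv
  simp only [id] at hd2
  rw [preSchwarzian, hd.deriv isOpen_rightHalfPlane hu, hd hu, hd2,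
    cpow_sub ((β : ℂ) - 1) 1 h0, cpow_one]
  field_simp

theorem tendsto_toHalf_one : Tendsto toHalf (𝓝[Metric.ball 0 1] 1) (cobounded ℂ) := by
  have h1 : Tendsto (fun z : ℂ => (1 - z) / 2) (𝓝[Metric.ball 0 1] 1) (𝓝[≠] 0) := by
    refine tendsto_nhdsWithin_iff.2 ⟨?_, ?_⟩
    · have : Tendsto (fun z : ℂ => (1 - z) / 2) (𝓝 1) (𝓝 ((1 - 1) / 2)) :=
        Continuous.tendsto (by fun_prop) 1
      rw [sub_self, zero_div] at this
      exact this.mono_left nhdsWithin_le_nhds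
    · filter_upwards [self_mem_nhdsWithin] with z hz
      exact div_ne_zero (one_sub_ne_zero_of_mem_ball hz) two_ne_zero
  have h2 := (tendsto_sub_const_cobounded (1 : ℂ)).comp (tendsto_inv₀_nhdsNE_zero.comp h1)
  refine h2.congr' ?_
  filter_upwards [self_mem_nhdsWithin] with z hz
  have := one_sub_ne_zero_of_mem_ball hz
  simp only [Function.comp, toHalf]
  field_simp
  ring

/-- The image is an affine copy of the β-th power of the half-plane Re p > Re r, hence lies in a
sector of opening πβ ≤ πα. Only β = α and β = 1 are used. -/
theorem powerModel_mem_Co {α : ℝ} (hα : α ∈ Set.Ioc (1 : ℝ) 2) {β : ℝ} (hβ : β ∈ Set.Icc 1 α)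
    {r : ℂ} (hr : 0 ≤ r.re) : IsConcaveUnivalent α (fun z => powerModel β r (toHalf z)) := by
  have hpi := Real.pi_pos
  have hβ0 : 0 < β := by linarith [hβ.1]
  have hβ2 : β ≤ 2 := hβ.2.trans hα.2
  have hβc : (β : ℂ) ≠ 0 := ofReal_ne_zero.2 hβ0.ne'
  have hone : (1 : ℂ) ∈ rightHalfPlane := by simp [rightHalfPlane]
  have h1 := ne_zero_of_zero_lt_re (re_add_pos hone hr)
  have hp1 : (1 + r) ^ (β : ℂ) ≠ 0 := fun h => h1 (cpow_eq_zero_iff _ _ |>.1 h).1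
  have h00 : (0 : ℂ) ∈ Metric.ball (0 : ℂ) 1 := by simp
  have hH0 : toHalf 0 = 1 := by simp [toHalf]
  set a := (1 + r) / (2 * β * (1 + r) ^ (β : ℂ)) with ha
  set b := -((1 + r) / (2 * β)) with hb
  have ha0 : a ≠ 0 := div_ne_zero h1 (mul_ne_zero (mul_ne_zero two_ne_zero hβc) hp1)
  have hab : ∀ u, powerModel β r u = a * (u + r) ^ (β : ℂ) + b := fun u => by
    simp only [powerModel, ha, hb]; field_simp; ring
  have hargβ : ∀ p : ℂ, 0 < p.re → |β * arg p| < Real.pi * β / 2 := fun p hp => by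
    rw [abs_mul, abs_of_pos hβ0]
    have := abs_arg_lt_of_re_pos hp
    nlinarith
  have hinv : ∀ p : ℂ, 0 < p.re → (p ^ (β : ℂ)) ^ (β : ℂ)⁻¹ = p := fun p hp => by
    have h2 := abs_lt.1 (hargβ p hp)
    have h3 : (log p * β).im = β * arg p := by rw [im_mul_ofReal, log_im, mul_comm]
    rw [← cpow_mul _ (by rw [h3]; nlinarith) (by rw [h3]; nlinarith), mul_inv_cancel₀ hβc,
      cpow_one]
  have hS : ∀ w, w ∈ (fun z => powerModel β r (toHalf z)) '' Metric.ball 0 1 ↔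
      (w - b) / a ∈ (fun p : ℂ => p ^ (β : ℂ)) '' {p | r.re < p.re} := by
    intro w
    constructor
    · rintro ⟨z, hz, rfl⟩
      refine ⟨toHalf z + r, ?_, ?_⟩
      · have : 0 < (toHalf z).re := toHalf_mem hz
        show r.re < (toHalf z + r).re
        rw [add_re]; linarith
      · simp only [hab]; field_simp; ring
    · rintro ⟨p, hp, he⟩
      have hp' : r.re < p.re := hp
      have hu : p - r ∈ rightHalfPlane := by
        show 0 < (p - r).re
        rw [sub_re]; linarith
      refine ⟨toDisk (p - r), toDisk_mem hu, ?_⟩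
      simp only at he ⊢
      rw [toHalf_toDisk hu, hab, sub_add_cancel, he]
      field_simp; ring
  have hdiff : DifferentiableOn ℂ (powerModel β r) rightHalfPlane := fun u hu =>
    (hasDerivAt_powerModel hβ0.ne' hr hu).differentiableAt.differentiableWithinAt
  constructor
  · exact hdiff.comp differentiableOn_toHalf fun _ h => toHalf_mem h
  · rw [hH0, powerModel, div_self hp1, sub_self, mul_zero]
  · have h2 : HasDerivAt (powerModel β r) ((1 + r) / (2 * (1 + r) ^ (β : ℂ)) *
        (1 + r) ^ ((β : ℂ) - 1)) (toHalf 0) := by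
      rw [hH0]; exact hasDerivAt_powerModel hβ0.ne' hr hone
    have h3 : HasDerivAt (fun z => powerModel β r (toHalf z)) _ 0 :=
      h2.comp 0 (hasDerivAt_toHalf (by simp))
    rw [h3.deriv, cpow_sub _ _ h1, cpow_one]
    field_simp
    norm_num
  · have h2 : Tendsto (fun z => toHalf z + r) (𝓝[Metric.ball 0 1] 1) (cobounded ℂ) :=
      (tendsto_add_const_cobounded r).comp tendsto_toHalf_one
    have h3 : Tendsto (fun z => (toHalf z + r) ^ (β : ℂ)) (𝓝[Metric.ball 0 1] 1) (cobounded ℂ) := by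
      rw [← tendsto_norm_atTop_iff_cobounded] at h2 ⊢
      refine ((tendsto_rpow_atTop hβ0).comp h2).congr fun z => ?_
      simp only [Function.comp]
      rw [norm_cpow_real]
    have h4 := (tendsto_add_const_cobounded b).comp ((tendsto_mul_left_cobounded ha0).comp h3)
    refine h4.congr fun z => ?_
    simp only [Function.comp, hab]
  · intro z hz w hw he
    dsimp only at he
    rw [hab, hab] at he
    have h2 : (toHalf z + r) ^ (β : ℂ) = (toHalf w + r) ^ (β : ℂ) :=
      mul_left_cancel₀ ha0 (add_right_cancel he)
    have h3 := congrArg (fun y => y ^ (β : ℂ)⁻¹) h2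
    rw [hinv _ (re_add_pos (toHalf_mem hz) hr), hinv _ (re_add_pos (toHalf_mem hw) hr)] at h3
    have h4 : toHalf z = toHalf w := add_right_cancel h3
    rw [← toDisk_toHalf (ne_one_of_mem_ball hz), h4, toDisk_toHalf (ne_one_of_mem_ball hw)]
  · intro x hx y hy s t hs ht hst hmem
    have hx' : (x - b) / a ∈ ((fun p : ℂ => p ^ (β : ℂ)) '' {p | r.re < p.re})ᶜ :=
      fun h => hx ((hS x).2 h)
    have hy' : (y - b) / a ∈ ((fun p : ℂ => p ^ (β : ℂ)) '' {p | r.re < p.re})ᶜ :=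
      fun h => hy ((hS y).2 h)
    have := convex_compl_image_cpow ⟨hβ.1, hβ2⟩ hr hx' hy' hs ht hst
    refine this ?_
    have h2 := (hS _).1 hmem
    convert h2 using 1
    simp only [real_smul]
    have hst' : (s : ℂ) + t = 1 := by rw [← ofReal_add, hst, ofReal_one]
    field_simp
    linear_combination (-b) * hst'
  · refine openingAngleAtInfinity_le ha0 (b := b) ⟨by linarith [hα.1], hα.2⟩ fun w hw => ?_
    obtain ⟨p, hp, he⟩ := (hS w).1 hw
    have hp0 : 0 < p.re := hr.trans_lt hp
    have hρ : 0 < ‖p‖ := hp0.trans_le (re_le_norm p)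
    show Real.cos (Real.pi * α / 2) * ‖(w - b) / a‖ < ((w - b) / a).re
    have h2 := abs_lt.1 (abs_arg_lt_of_re_pos hp0)
    rw [← he]
    dsimp only
    rw [← norm_mul_exp_arg_mul_I p, polar_cpow hρ (by linarith) (by linarith), re_ofReal_mul,
      exp_ofReal_mul_I_re, norm_mul, norm_exp_ofReal_mul_I, mul_one, norm_real,
      Real.norm_of_nonneg (by positivity), mul_comm]
    refine mul_lt_mul_of_pos_left ?_ (by positivity)
    rw [← Real.cos_abs (β * arg p)]
    refine Real.cos_lt_cos_of_nonneg_of_le_pi (abs_nonneg _) ?_ ?_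
    · nlinarith [hα.2]
    · exact (hargβ p hp0).trans_le (by nlinarith [hβ.2])

theorem preSchwarzian_powerModel_comp {β : ℝ} (hβ : β ≠ 0) {r : ℂ} (hr : 0 ≤ r.re) {u : ℂ}
    (hu : u ∈ rightHalfPlane) :
    preSchwarzian (fun u => powerModel β r (toHalf (toDisk u))) u = (β - 1) / (u + r) := by
  rw [preSchwarzian_eqOn isOpen_rightHalfPlane (g := powerModel β r)
    (fun v hv => by simp only [toHalf_toDisk hv]) hu, preSchwarzian_powerModel hβ hr hu]

theorem div_cpow_of_re_pos {x y : ℂ} (hx : 0 < x.re) (hy : 0 < y.re) (c : ℂ) :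
    (x / y) ^ c = x ^ c / y ^ c := by
  have hx0 := ne_zero_of_zero_lt_re hx
  have hy0 := ne_zero_of_zero_lt_re hy
  have h1 := abs_lt.1 (abs_arg_lt_of_re_pos hx)
  have h2 := abs_lt.1 (abs_arg_lt_of_re_pos hy)
  have hlog : log (x / y) = log x - log y := by
    rw [← log_exp (x := log x - log y) (by rw [sub_im, log_im, log_im]; linarith)
      (by rw [sub_im, log_im, log_im]; linarith), exp_sub, exp_log hx0, exp_log hy0]
  rw [cpow_def_of_ne_zero (div_ne_zero hx0 hy0), cpow_def_of_ne_zero hx0, cpow_def_of_ne_zero hy0,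
    hlog, sub_mul, exp_sub]

theorem extremalFun_pi_eqOn (α : ℝ) : Set.EqOn (extremalFun α Real.pi)
    (fun z => powerModel 1 0 (toHalf z)) (Metric.ball 0 1) := by
  intro z hz
  have h1 := one_sub_ne_zero_of_mem_ball hz
  simp only [extremalFun, if_true, powerModel, toHalf, add_zero, ofReal_one, cpow_one]
  field_simp
  ring

theorem re_cayley_of_norm_eq_one {e : ℂ} (he : ‖e‖ = 1) : ((1 - e) / (1 + e)).re = 0 := by
  have h := re_toHalf (-e)
  rw [norm_neg, he] at h
  simpa [toHalf, sub_eq_add_neg] using h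

theorem extremalFun_eqOn (α : ℝ) {θ : ℝ} (hθ : exp (θ * I) ≠ -1) (hθπ : θ ≠ Real.pi) :
    Set.EqOn (extremalFun α θ)
      (fun z => powerModel α ((1 - exp (θ * I)) / (1 + exp (θ * I))) (toHalf z))
      (Metric.ball 0 1) := by
  intro z hz
  have h1 := one_sub_ne_zero_of_mem_ball hz
  have hr := re_cayley_of_norm_eq_one (norm_exp_ofReal_mul_I θ)
  simp only [extremalFun, if_neg hθπ, powerModel]
  generalize exp (θ * I) = e at *
  have he : 1 + e ≠ 0 := fun h => hθ (by linear_combination h)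
  have hone : (1 : ℂ) ∈ rightHalfPlane := by simp [rightHalfPlane]
  have h2 : 1 + (1 - e) / (1 + e) = 2 / (1 + e) := by field_simp; ring
  rw [← div_cpow_of_re_pos (re_add_pos (toHalf_mem hz) hr.ge) (re_add_pos hone hr.ge)]
  have h3 : (toHalf z + (1 - e) / (1 + e)) / (1 + (1 - e) / (1 + e)) = (1 + e * z) / (1 - z) := by
    rw [h2, toHalf]
    field_simp
    ring
  rw [h3, h2]
  congr 1
  rcases eq_or_ne α 0 with rfl | hα
  · simp
  · have : (α : ℂ) ≠ 0 := ofReal_ne_zero.2 hα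
    field_simp

theorem eq_pi_of_exp_eq_neg_one {θ : ℝ} (hθ : θ ∈ Set.Icc (0 : ℝ) (2 * Real.pi))
    (h : exp (θ * I) = -1) : θ = Real.pi := by
  rw [← exp_pi_mul_I, exp_eq_exp_iff_exists_int] at h
  obtain ⟨n, hn⟩ := h
  have h1 : (θ : ℂ) = Real.pi + n * (2 * Real.pi) := by
    apply mul_right_cancel₀ I_ne_zero
    rw [hn]; ring
  have h2 : θ = Real.pi + n * (2 * Real.pi) := by exact_mod_cast h1
  have hpi := Real.pi_pos
  have hn0 : n = 0 := by
    have h3 : (-1 : ℝ) < n := by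
      by_contra hcon
      nlinarith [hθ.1]
    have h4 : (n : ℝ) < 1 := by
      by_contra hcon
      nlinarith [hθ.2]
    have h5 : -1 < n := by exact_mod_cast h3
    have h6 : n < 1 := by exact_mod_cast h4
    omega
  rw [h2, hn0]
  simp

theorem exists_exp_eq {e : ℂ} (he : ‖e‖ = 1) :
    ∃ θ ∈ Set.Icc (0 : ℝ) (2 * Real.pi), exp (θ * I) = e := by
  have h1 := norm_mul_exp_arg_mul_I e
  rw [he, ofReal_one, one_mul] at h1
  have hpi := Real.pi_pos
  rcases le_total 0 (arg e) with h | h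
  · exact ⟨arg e, ⟨h, by linarith [arg_le_pi e]⟩, h1⟩
  · refine ⟨arg e + 2 * Real.pi, ⟨by linarith [neg_pi_lt_arg e], by linarith⟩, ?_⟩
    push_cast
    rw [add_mul, exp_add, exp_two_pi_mul_I, mul_one, h1]

theorem weightedPreSchwarzian_congr {f g : ℂ → ℂ} (h : Set.EqOn f g (Metric.ball 0 1)) {z : ℂ}
    (hz : z ∈ Metric.ball (0 : ℂ) 1) : weightedPreSchwarzian z f = weightedPreSchwarzian z g := by
  rw [weightedPreSchwarzian, weightedPreSchwarzian, preSchwarzian_eqOn Metric.isOpen_ball h hz]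

/-! ### The disk of variability and its extremal functions. -/

/-- Every point of the closed disk of variability is attained by a power model. -/
theorem exists_powerModel_of_mem_closedBall {α : ℝ} (hα : α ∈ Set.Ioc (1 : ℝ) 2) {z : ℂ}
    (hz : z ∈ Metric.ball (0 : ℂ) 1) {y : ℂ}
    (hy : y ∈ Metric.closedBall (variabilityCenter α z) (α - 1)) :
    ∃ f ∈ Co α, weightedPreSchwarzian z f = y := by
  have hα1 : 0 < α - 1 := by linarith [hα.1]
  have hz1 := one_sub_ne_zero_of_mem_ball hz
  have hz2 : 1 - starRingEnd ℂ z ≠ 0 := by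
    have : 1 - starRingEnd ℂ z = starRingEnd ℂ (1 - z) := by simp
    rw [this]
    exact (map_ne_zero _).2 hz1
  set μ := (1 - starRingEnd ℂ z) / (1 - z) with hμ
  have hμ0 : μ ≠ 0 := div_ne_zero hz2 hz1
  have hμ1 : ‖μ‖ = 1 := by
    have h2 : 1 - starRingEnd ℂ z = starRingEnd ℂ (1 - z) := by simp
    rw [hμ, norm_div, h2, norm_conj, div_self (norm_ne_zero_iff.2 hz1)]
  set ψ := (y - variabilityCenter α z) / (μ * (α - 1 : ℝ)) with hψ
  have hα1c : ((α - 1 : ℝ) : ℂ) ≠ 0 := ofReal_ne_zero.2 hα1.ne'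
  have hyψ : y = variabilityCenter α z + μ * ((α - 1 : ℝ) * ψ) := by
    rw [hψ]; field_simp; ring
  have hψ1 : ‖ψ‖ ≤ 1 := by
    rw [hψ, norm_div, norm_mul, hμ1, one_mul, norm_real, Real.norm_of_nonneg hα1.le,
      div_le_one hα1, ← dist_eq_norm]
    exact hy
  have hu := toHalf_mem hz
  have hu' : 0 < (toHalf z).re := hu
  by_cases hψm : ψ = -1
  -- The value ψ = -1 requires N = 0, the limit r → ∞ of the α-powers; it is attained by the affine
  -- model.
  · have hm := powerModel_mem_Co hα (β := 1) ⟨le_rfl, hα.1.le⟩ (r := 0) (by simp)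
    refine ⟨_, hm, ?_⟩
    have h1 := weightedPreSchwarzian_sub_center α hm.analytic hm.injective hz
    rw [preSchwarzian_powerModel_comp one_ne_zero (by simp) hu] at h1
    rw [sub_eq_iff_eq_add'] at h1
    rw [h1, hyψ, hψm]
    push_cast
    ring
  · have hψ0 : 1 + ψ ≠ 0 := fun h => hψm (by linear_combination h)
    -- Solves 2x/(u+r) = 1 + ψ with u = `toHalf z` and x = Re u. The condition |ψ| ≤ 1 is exactly Re
    -- r ≥ 0.
    set r := 2 * ((toHalf z).re : ℂ) / (1 + ψ) - toHalf z with hr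
    have hr0 : 0 ≤ r.re := by
      have h2 : (2 * ((toHalf z).re : ℂ) / (1 + ψ)).re =
          (toHalf z).re * (2 * (1 + ψ.re) / ‖1 + ψ‖ ^ 2) := by
        have h3 : 2 * ((toHalf z).re : ℂ) / (1 + ψ) = ((2 * (toHalf z).re : ℝ) : ℂ) * (1 / (1 + ψ)) := by
          push_cast; ring
        rw [h3, re_ofReal_mul, re_one_div, add_re, one_re]
        ring
      have h4 : 1 ≤ 2 * (1 + ψ.re) / ‖1 + ψ‖ ^ 2 := by
        have h5 : 0 < ‖1 + ψ‖ := norm_pos_iff.2 hψ0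
        rw [le_div_iff₀ (by positivity), one_mul]
        have h6 : ‖1 + ψ‖ ^ 2 = 1 + 2 * ψ.re + ‖ψ‖ ^ 2 := by
          rw [← normSq_eq_norm_sq, ← normSq_eq_norm_sq, normSq_apply, normSq_apply]
          simp; ring
        rw [h6]
        nlinarith [norm_nonneg ψ]
      rw [hr, sub_re, h2]
      nlinarith
    have hα0 : α ≠ 0 := by linarith
    have hm := powerModel_mem_Co hα (β := α) ⟨hα.1.le, le_rfl⟩ hr0
    refine ⟨_, hm, ?_⟩
    have h1 := weightedPreSchwarzian_sub_center α hm.analytic hm.injective hz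
    rw [preSchwarzian_powerModel_comp hα0 hr0 hu, hr, add_sub_cancel] at h1
    rw [sub_eq_iff_eq_add'] at h1
    rw [← hμ] at h1
    rw [h1, hyψ]
    have h3 : ((toHalf z).re : ℂ) ≠ 0 := ofReal_ne_zero.2 hu'.ne'
    push_cast
    field_simp
    ring

theorem IsConcaveUnivalent.mem_closedBall {α : ℝ} (hα : α ∈ Set.Ioc (1 : ℝ) 2) {f : ℂ → ℂ}
    (h : IsConcaveUnivalent α f) {z : ℂ} (hz : z ∈ Metric.ball (0 : ℂ) 1) :
    weightedPreSchwarzian z f ∈ Metric.closedBall (variabilityCenter α z) (α - 1) := by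
  rw [Metric.mem_closedBall, dist_eq_norm]
  have hα1 : 0 ≤ α - 1 := by linarith [hα.1]
  refine (sq_le_sq₀ (norm_nonneg _) hα1).1 ?_
  rw [norm_weightedPreSchwarzian_sub_center α h.analytic h.injective hz]
  have h1 := h.re_mul_norm_sq_le hα (toHalf_mem hz)
  have h2 : 0 < (toHalf z).re := toHalf_mem hz
  nlinarith

theorem IsConcaveUnivalent.mem_sphere_iff {α : ℝ} (hα : α ∈ Set.Ioc (1 : ℝ) 2) {f : ℂ → ℂ}
    (h : IsConcaveUnivalent α f) {z : ℂ} (hz : z ∈ Metric.ball (0 : ℂ) 1) :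
    weightedPreSchwarzian z f ∈ Metric.sphere (variabilityCenter α z) (α - 1) ↔
      (toHalf z).re * ‖preSchwarzian (fun u => f (toDisk u)) (toHalf z)‖ ^ 2 =
        (α - 1) * (preSchwarzian (fun u => f (toDisk u)) (toHalf z)).re := by
  rw [mem_sphere_iff_norm]
  have hα1 : 0 ≤ α - 1 := by linarith [hα.1]
  rw [← sq_eq_sq₀ (norm_nonneg _) hα1,
    norm_weightedPreSchwarzian_sub_center α h.analytic h.injective hz]
  have h2 : 0 < (toHalf z).re := toHalf_mem hz
  rw [add_eq_right, mul_eq_zero, sub_eq_zero]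
  exact or_iff_right (by positivity)

theorem exists_extremalFun_of_mem_sphere {α : ℝ} (hα : α ∈ Set.Ioc (1 : ℝ) 2) {f : ℂ → ℂ}
    (h : IsConcaveUnivalent α f) {z : ℂ} (hz : z ∈ Metric.ball (0 : ℂ) 1)
    (hs : weightedPreSchwarzian z f ∈ Metric.sphere (variabilityCenter α z) (α - 1)) :
    ∃ θ ∈ Set.Icc (0 : ℝ) (2 * Real.pi), Set.EqOn f (extremalFun α θ) (Metric.ball 0 1) := by
  have hα0 : α ≠ 0 := by linarith [hα.1]
  rcases h.preSchwarzian_of_eq hα (toHalf_mem hz) ((h.mem_sphere_iff hα hz).1 hs) with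
    hN | ⟨r, hr, hN⟩
  · have hm := powerModel_mem_Co hα (β := 1) ⟨le_rfl, hα.1.le⟩ (r := 0) (by simp)
    refine ⟨Real.pi, ⟨Real.pi_pos.le, by linarith [Real.pi_pos]⟩, ?_⟩
    refine Set.EqOn.trans ?_ (extremalFun_pi_eqOn α).symm
    refine eqOn_of_preSchwarzian_eqOn h.analytic h.injective hm.analytic hm.injective
      (h.map_zero.trans hm.map_zero.symm) (h.deriv_zero.trans hm.deriv_zero.symm) fun u hu => ?_
    rw [hN u hu, preSchwarzian_powerModel_comp one_ne_zero (by simp) hu]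
    simp
  · have hm := powerModel_mem_Co hα (β := α) ⟨hα.1.le, le_rfl⟩ hr.ge
    have hone : (1 : ℂ) ∈ rightHalfPlane := by simp [rightHalfPlane]
    have h1r := ne_zero_of_zero_lt_re (re_add_pos hone hr.ge)
    -- The map r ↦ (1-r)/(1+r) is its own inverse and takes the imaginary axis to the unit circle
    -- without -1, so θ = π is left to the affine case.
    have he : ‖(1 - r) / (1 + r)‖ = 1 := by
      have h2 : 1 - r = starRingEnd ℂ (1 + r) := by
        apply Complex.ext <;> simp [hr]
      rw [norm_div, h2, norm_conj, div_self (norm_ne_zero_iff.2 h1r)]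
    obtain ⟨θ, hθ, hexp⟩ := exists_exp_eq he
    have hne : exp (θ * I) ≠ -1 := by
      rw [hexp]
      intro h2
      rw [div_eq_iff h1r] at h2
      have : (2 : ℂ) = 0 := by linear_combination h2
      norm_num at this
    have hθπ : θ ≠ Real.pi := by
      rintro rfl
      exact hne exp_pi_mul_I
    refine ⟨θ, hθ, Set.EqOn.trans ?_ (extremalFun_eqOn α hne hθπ).symm⟩
    have hrr : (1 - exp (θ * I)) / (1 + exp (θ * I)) = r := by
      rw [hexp]
      have h3 : 1 + (1 - r) / (1 + r) = 2 / (1 + r) := by field_simp; ring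
      rw [h3]
      field_simp
      ring
    rw [hrr]
    refine eqOn_of_preSchwarzian_eqOn h.analytic h.injective hm.analytic hm.injective
      (h.map_zero.trans hm.map_zero.symm) (h.deriv_zero.trans hm.deriv_zero.symm) fun u hu => ?_
    rw [hN u hu, preSchwarzian_powerModel_comp hα0 hr.ge hu]

theorem extremalFun_mem_and_mem_sphere {α : ℝ} (hα : α ∈ Set.Ioc (1 : ℝ) 2) {θ : ℝ}
    (hθ : θ ∈ Set.Icc (0 : ℝ) (2 * Real.pi)) {z : ℂ} (hz : z ∈ Metric.ball (0 : ℂ) 1) :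
    IsConcaveUnivalent α (extremalFun α θ) ∧ weightedPreSchwarzian z (extremalFun α θ) ∈
      Metric.sphere (variabilityCenter α z) (α - 1) := by
  have hα0 : α ≠ 0 := by linarith [hα.1]
  have hu := toHalf_mem hz
  rcases eq_or_ne θ Real.pi with rfl | hθπ
  · have hm := powerModel_mem_Co hα (β := 1) ⟨le_rfl, hα.1.le⟩ (r := 0) (by simp)
    refine ⟨hm.congr (extremalFun_pi_eqOn α), ?_⟩
    rw [weightedPreSchwarzian_congr (extremalFun_pi_eqOn α) hz, hm.mem_sphere_iff hα hz,
      preSchwarzian_powerModel_comp one_ne_zero (by simp) hu]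
    simp
  · have hne : exp (θ * I) ≠ -1 := fun h => hθπ (eq_pi_of_exp_eq_neg_one hθ h)
    have hr := re_cayley_of_norm_eq_one (norm_exp_ofReal_mul_I θ)
    have hEq := extremalFun_eqOn α hne hθπ
    set r := (1 - exp (θ * I)) / (1 + exp (θ * I))
    have hm := powerModel_mem_Co hα (β := α) ⟨hα.1.le, le_rfl⟩ hr.ge
    refine ⟨hm.congr hEq, ?_⟩
    rw [weightedPreSchwarzian_congr hEq hz, hm.mem_sphere_iff hα hz,
      preSchwarzian_powerModel_comp hα0 hr.ge hu]
    have hpos := re_add_pos hu hr.ge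
    have h0 := norm_pos_iff.2 (ne_zero_of_zero_lt_re hpos)
    have h1 : ((α : ℂ) - 1) / (toHalf z + r) = ((α - 1 : ℝ) : ℂ) * (1 / (toHalf z + r)) := by
      push_cast; ring
    rw [h1, re_ofReal_mul, re_one_div, norm_mul, norm_real, norm_div, norm_one,
      Real.norm_of_nonneg (by linarith [hα.1]), add_re, hr, add_zero]
    field_simp

theorem theorem2p3 (α : ℝ) (hα : α ∈ Set.Ioc (1 : ℝ) 2) (z : ℂ) (hz : z ∈ Metric.ball (0 : ℂ) 1) :
    weightedPreSchwarzian z '' Co α = Metric.closedBall (variabilityCenter α z) (α - 1) ∧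
    ∀ f : ℂ → ℂ,
      (f ∈ Co α ∧ weightedPreSchwarzian z f ∈ Metric.sphere (variabilityCenter α z) (α - 1)) ↔
        ∃ θ ∈ Set.Icc (0 : ℝ) (2 * Real.pi), Set.EqOn f (extremalFun α θ) (Metric.ball 0 1) := by
  refine ⟨Set.Subset.antisymm ?_ fun y hy => exists_powerModel_of_mem_closedBall hα hz hy,
    fun f => ⟨fun ⟨hf, hs⟩ => exists_extremalFun_of_mem_sphere hα hf hz hs, ?_⟩⟩
  · rintro _ ⟨f, hf, rfl⟩
    exact IsConcaveUnivalent.mem_closedBall hα hf hz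
  · rintro ⟨θ, hθ, hEq⟩
    obtain ⟨h1, h2⟩ := extremalFun_mem_and_mem_sphere hα hθ hz
    refine ⟨h1.congr hEq, ?_⟩
    rwa [weightedPreSchwarzian_congr hEq hz]
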